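/- **Setting.** Let $V$ be a set of $n$ vertices and let $e_1,\dots,e_{n-1}$ be a fixed sequence of edges that forms a tree on $V$; the edges arrive one after the other and an orientation of the edges present is maintained. Write $\log=\log_2$. **The algorithm** (Rank-Based Dancing-Walk Algorithm with maximum out-degree $k+1$, where $k\ge 2$, with parameters $c,d>0$). Every vertex may have up to $k$ primary and, once it has $k$ primary ones, one secondary out-going edge. The combination rank of a one-vertex tree is $0$; when an edge joins two trees of ranks $R_1,R_2$, the new tree has rank $\max(R_1,R_2)$ if $R_1\ne R_2$ and $R_1+1$ if $R_1=R_2$. When an edge joining $T_1$ and $T_2$ arrives, let $v$ be its endpoint in the tree of smaller combination rank (ties are broken by an arbitrary rule). Starting at $v$, a random walk moves in each step along a uniformly random primary out-going edge of the current vertex; it stops successfully at any vertex of out-degree less than $k$, and otherwise runs for $\lceil c\log_k\log n\rceil$ steps and succeeds if its last vertex has no secondary out-going edge. A failed walk is restarted from scratch; if $\lceil d\log n\rceil$ walks in a row fail, the algorithm declares failure and stops. After a successful walk all edges it traversed are flipped and the new edge is oriented out of $v$. The ranks are maintained by rank trees (parent-pointer trees whose leaves are the vertices of a component $T$, all at depth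 $R(T)$), which are combined by climbing from the two endpoints in lockstep until a root is reached. Time is counted as the number of elementary instructions: reads and writes of single memory cells (out-degree counters, cells of the arrays of out-neighbours, parent pointers), allocations of rank-tree nodes, and uniformly random choices from $\{1,\dots,k\}$. **Theorem.** There is a constant $c_0$ such that for every $c\ge c_0$ and every $\gamma>0$ there is $d_0$ such that for every $d\ge d_0$ there are constants $C$ and $N$ such that for all $n\ge N$, all $k\ge 2$ (possibly depending on $n$), every tie-breaking rule and every edge sequence $e_1,\dots,e_{n-1}$ forming a tree on the $n$ vertices: 1. With probability at least $1-n^{-\gamma}$ the algorithm processes all of $e_1,\dots,e_{n-1}$ without declaring failure. 2. In every run, after each completed insertion of an edge $e_t$ the algorithm holds an orientation of exactly the edges $e_1,\dots,e_t$ in which every vertex has out-degree at most $k+1$; and each completed insertion flips at most $C\log_k\log n$ edges and takes time at most $C\log n\cdot\max(1,\log_k\log n)$ (which is $C\log n\,\log_k\log n$ when $k\le\log n$). 3. With probability at least $1-n^{-\gamma}$ the total running time of all insertions is at most $Cn$. 4. In particular, if $k=\lfloor(\log n)^{1/q}\rfloor$ for a real $q>0$, then all out-degrees are at most $(\log n)^{1/q}+1$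 and each completed insertion flips at most $Cq$ edges, with the same $C$, not depending on $q$. -/

import Mathlib

namespace DancingWalk

/-- The memory of the algorithm on the vertex set `Fin n`, together with a clock.

* `deg v` is the number of out-going edges of `v`, and `nbr v i`, for `i < deg v`, is the head of the
  `i`-th out-going edge of `v` (cells with `i ≥ deg v` hold garbage). When `v` has `k` primary slots,
  the edges in cells `0, …, k - 1` are primary and the one in cell `k`, if present, is secondary.
* `parent` holds the parent pointers of the rank trees. The nodes of the rank trees are natural
  numbers: the leaves are the vertices `0, …, n - 1`, inner nodes are allocated from `n` upwards, and
  `fresh` is the next unused one. The leaves of a rank tree are the vertices of one connected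
  component `T`, and all of them have the same depth, which is the combination rank `R(T)`.
* `clock` is the number of elementary instructions executed so far. -/
structure Config (n : ℕ) where
  deg : Fin n → ℕ
  nbr : Fin n → ℕ → Fin n
  parent : ℕ → Option ℕ
  fresh : ℕ
  clock : ℕ

/-- No edges, and every vertex is a rank tree by itself (combination rank `0`). -/
def Config.init (n : ℕ) : Config n where
  deg := fun _ => 0
  nbr := fun v _ => v
  parent := fun _ => none
  fresh := n
  clock := 0

/-- In configuration `s` there is an edge oriented from `u` to `v`. -/
def Config.Arc {n : ℕ} (s : Config n) (u v : Fin n) : Prop :=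
  ∃ i, i < s.deg u ∧ s.nbr u i = v

/-- The out-degree of `v`. -/
noncomputable def Config.outDegree {n : ℕ} (s : Config n) (v : Fin n) : ℕ :=
  {w | s.Arc v w}.ncard

/-- `s` stores an orientation of the graph with edge set `E`: every edge of `E` is oriented in exactly
one direction, and there are no other oriented edges. -/
def Config.IsOrientation {n : ℕ} (s : Config n) (E : Set (Sym2 (Fin n))) : Prop :=
  (∀ u v, (s.Arc u v ∨ s.Arc v u) ↔ s(u, v) ∈ E) ∧ ∀ u v, s.Arc u v → ¬ s.Arc v u

/-- The number of edges whose orientation in `s'` is opposite to their orientation in `s`. -/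
noncomputable def flips {n : ℕ} (s s' : Config n) : ℕ :=
  {e : Fin n × Fin n | s.Arc e.1 e.2 ∧ s'.Arc e.2 e.1}.ncard

/-- Randomized programs acting on configurations. -/
abbrev Prog (n : ℕ) (α : Type) : Type := StateT (Config n) PMF α

/-! ### The elementary instructions

Each access to a memory cell, each allocation and each random choice takes one unit of time. The
programs below do only a bounded number of comparisons and operations on local variables per
elementary instruction. -/

section Instructions

variable {n : ℕ}

noncomputable def readDeg (v : Fin n) : Prog n ℕ := do
  let s ← get
  set { s with clock := s.clock + 1 }
  return s.deg v

noncomputable def writeDeg (v : Fin n) (x : ℕ) : Prog n Unit :=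
  modify fun s => { s with deg := Function.update s.deg v x, clock := s.clock + 1 }

noncomputable def readNbr (v : Fin n) (i : ℕ) : Prog n (Fin n) := do
  let s ← get
  set { s with clock := s.clock + 1 }
  return s.nbr v i

noncomputable def writeNbr (v : Fin n) (i : ℕ) (w : Fin n) : Prog n Unit :=
  modify fun s =>
    { s with nbr := Function.update s.nbr v (Function.update (s.nbr v) i w), clock := s.clock + 1 }

noncomputable def readParent (p : ℕ) : Prog n (Option ℕ) := do
  let s ← get
  set { s with clock := s.clock + 1 }
  return s.parent p

noncomputable def writeParent (p q : ℕ) : Prog n Unit :=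
  modify fun s => { s with parent := Function.update s.parent p (some q), clock := s.clock + 1 }

/-- Allocates a new inner node for the rank trees. -/
noncomputable def allocate : Prog n ℕ := do
  let s ← get
  set { s with fresh := s.fresh + 1, clock := s.clock + 1 }
  return s.fresh

/-- A fresh uniformly random element of `{0, …, k - 1}`. -/
noncomputable def randomIndex (k : ℕ) [NeZero k] : Prog n (Fin k) := do
  let s ← get
  set { s with clock := s.clock + 1 }
  StateT.lift (PMF.uniformOfFintype (Fin k))

end Instructions

/-! ### The algorithm -/

section Algorithm

variable {n : ℕ}

/-- Combines the rank trees of two components. The nodes `p` and `q` are ancestors, at equal height, of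
a vertex of the first and of a vertex of the second component; the two leaf-to-root paths are followed
in lockstep until a root is reached. If only one of `p`, `q` is a root, its component has the smaller
combination rank, and it becomes a child of the parent of the other node. If both are roots, the
ranks are equal, and both become children of a new root. The result is `true` if the first component
is the one to be searched (smaller rank, or equal ranks and `tie = true`), and `false` otherwise. The
first argument bounds the number of iterations; with the value used below it is never exhausted on
the inputs considered. -/
noncomputable def combine (tie : Bool) : ℕ → ℕ → ℕ → Prog n Bool
  | 0, _, _ => return true
  | fuel + 1, p, q => do
    let p' ← readParent p
    let q' ← readParent q
    match p', q' with
    | some p₁, some q₁ => combine tie fuel p₁ q₁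
    | none, some q₁ => do
      writeParent p q₁
      return true
    | some p₁, none => do
      writeParent q p₁
      return false
    | none, none => do
      let r ← allocate
      writeParent p r
      writeParent q r
      return tie

/-- One random-walk attempt, currently at the vertex `v`, with `r` steps left. It stops successfully
at a vertex with fewer than `k` out-going edges. Otherwise it goes down a random primary edge; when no
steps are left it succeeds if `v` has no secondary edge, and fails if it has one. On success the
result is the final vertex and the list of edges (tail, cell of the edge) traversed, the last one
first. -/
noncomputable def walk (k : ℕ) [NeZero k] :
    ℕ → Fin n → List (Fin n × ℕ) → Prog n (Option (Fin n × List (Fin n × ℕ)))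
  | 0, v, path => do
    let d ← readDeg v
    if d ≤ k then return some (v, path) else return none
  | r + 1, v, path => do
    let d ← readDeg v
    if d < k then return some (v, path)
    else do
      let i ← randomIndex k
      let w ← readNbr v i
      walk k r w ((v, (i : ℕ)) :: path)

/-- Up to `a` random-walk attempts of at most `L` steps from the vertex `v`. -/
noncomputable def search (k L : ℕ) [NeZero k] :
    ℕ → Fin n → Prog n (Option (Fin n × List (Fin n × ℕ)))
  | 0, _ => return none
  | a + 1, v => do
    let res ← walk k L v []
    match res with
    | some x => return some x
    | none => search k L a v

/-- Reverses all edges of a traversed path that ends at `v`, where the edge coming back out of `v` is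
put into cell `i` of `v`; each inner vertex of the path reuses the cell of the edge that it loses, and
the first vertex of the path reuses it for the edge to `x`. -/
noncomputable def reversePath (x : Fin n) : Fin n → ℕ → List (Fin n × ℕ) → Prog n Unit
  | v, i, [] => writeNbr v i x
  | v, i, (u, j) :: path => do
    writeNbr v i u
    reversePath x u j path

/-- Insertion of the edge `{a, b}`. The result is `false` if the algorithm declares failure. Ties
between combination ranks are broken by the arbitrary rule `tie`. -/
noncomputable def insertEdge (k L A : ℕ) [NeZero k] (tie : Config n → Fin n → Fin n → Bool)
    (a b : Fin n) : Prog n Bool := do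
  let s ← get
  let first ← combine (tie s a b) n a b
  let source := if first then a else b
  let other := if first then b else a
  let res ← search k L A source
  match res with
  | none => return false
  | some (u, path) => do
    let d ← readDeg u
    reversePath other u d path
    writeDeg u (d + 1)
    return true

/-- Inserts the edges one after the other, until failure is declared or all are inserted. The result is
the list of the configurations at the start and after each completed insertion, and whether failure
was declared. -/
noncomputable def insertAll (k L A : ℕ) [NeZero k] (tie : Config n → Fin n → Fin n → Bool) :
    List (Fin n × Fin n) → Prog n (List (Config n) × Bool)
  | [] => do
    let s ← get
    return ([s], false)
  | e :: es => do
    let s ← get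
    let ok ← insertEdge k L A tie e.1 e.2
    if ok then do
      let res ← insertAll k L A tie es
      return (s :: res.1, res.2)
    else return ([s], true)

end Algorithm

/-- What is observed of a run: the configurations at the start and after each completed insertion,
whether failure was declared, and the total running time (also of an insertion that failed). -/
structure Outcome (n : ℕ) where
  snapshots : List (Config n)
  failed : Bool
  time : ℕ

/-- The law of the run of the Rank-Based Dancing-Walk Algorithm with at most `k` primary edges and one
secondary edge per vertex, random walks of at most `L` steps, and at most `A` random-walk attempts per
insertion. -/
noncomputable def run {n : ℕ} (k L A : ℕ) [NeZero k] (tie : Config n → Fin n → Fin n → Bool)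
    (es : List (Fin n × Fin n)) : PMF (Outcome n) :=
  ((insertAll k L A tie es).run (Config.init n)).map fun x => ⟨x.1.1, x.1.2, x.2.clock⟩

/-- The (undirected) edges that occur in a list. -/
def edgeSet {n : ℕ} (es : List (Fin n × Fin n)) : Set (Sym2 (Fin n)) :=
  {z | ∃ e ∈ es, z = s(e.1, e.2)}

/-- The list consists of `n - 1` edges that form a tree on the vertex set `Fin n`. -/
def IsTreeSequence {n : ℕ} (es : List (Fin n × Fin n)) : Prop :=
  es.length + 1 = n ∧ (SimpleGraph.fromEdgeSet (edgeSet es)).IsTree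

/-- `log_k log n`. -/
noncomputable def logLog (k n : ℕ) : ℝ := Real.logb k (Real.logb 2 n)

/-- The length `c log_k log n` of the random walks. -/
noncomputable def walkLength (c : ℝ) (k n : ℕ) : ℕ := ⌈c * logLog k n⌉₊

/-- The maximal number `d log n` of random-walk attempts per insertion. -/
noncomputable def maxAttempts (d : ℝ) (n : ℕ) : ℕ := ⌈d * Real.logb 2 n⌉₊

end DancingWalk

/-! The edges form a fixed tree, and every search runs inside a component of smaller or equal rank.
All vertices of that component are then in a component of strictly larger rank. Ranks are at most D,
the integer part of log n, because a component of rank r has at least 2^r vertices. So a vertex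
takes part in at most D searches, whatever the tie-breaking rule and the random choices are.

Dead ends. When a search for the new edge {v, x} flips an arc from q to y, the new head q is the
neighbour of y on the tree path to x. The possible heads of arcs out of y are therefore fixed in
advance, and there are at most D of them (`card_cand`). Hence the sets of vertices with a secondary
edge at the ends of L-step walks from a given vertex all belong to a deterministic family of at most
(8D²)^(k^L) sets (`deadEnds_mem_families`, `card_families`). A directed walk between two vertices of
a forest is unique. So a search of A attempts ends at a given w of out-degree k with probability at
most q = A k^(-L), and only such an end gives w its secondary edge. Consequently the product over w
∈ W of 1[w has a secondary edge] + q (D - rank of w) does not grow in expectation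
(`State.expect_insertEdge_risk`). It starts at (qD)^|W|. A union bound over all vertices and all
sets W of the family with more than k^L/2 elements leaves probability at most n 2^(-k^L)
(`totalRisk_start`), provided that k^L exceeds a suitable power of log n. Outside this event a walk
fails with probability at most 1/2, hence a search with probability at most 2^(-A).

Time. Directed walks from v of i steps, weighted by (3/4)^i, have total weight at most 20^rank;
flips preserve this bound (`growth_finish`, `Core.finish`). A random walk follows a given route of i
steps with probability at most 2^(-i), so its expected duration is linear in rank + 1, and so is
that of a search whose walks fail with probability at most 1/2. The sum of (smaller rank + 1) over
all mergers is at most 2n, by the potential `Comps.weight`. One insertion never takes longer than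
some B = O(log² n). Exponential moments at scale 1/B (`expect_exp_le`) then turn the linear
expectation into a bound with high probability. -/

open scoped ENNReal

namespace DancingWalk

/-! ### Expectations and almost sure properties -/

/-- The expectation of a nonnegative function. -/
noncomputable def expect {α : Type} (p : PMF α) (F : α → ℝ≥0∞) : ℝ≥0∞ := ∑' x, p x * F x

/-- The predicate holds on the support. -/
def Sat {α : Type} (p : PMF α) (Q : α → Prop) : Prop := ∀ x ∈ p.support, Q x

section Calculus

variable {α β : Type}

theorem expect_pure (a : α) (F : α → ℝ≥0∞) : expect (PMF.pure a) F = F a := by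
  rw [expect, tsum_eq_single a]
  · simp
  · intro b hb
    simp [PMF.pure_apply, hb]

theorem expect_bind (p : PMF α) (f : α → PMF β) (F : β → ℝ≥0∞) :
    expect (p.bind f) F = expect p fun a => expect (f a) F := by
  simp only [expect, PMF.bind_apply, ← ENNReal.tsum_mul_right, ← ENNReal.tsum_mul_left]
  rw [ENNReal.tsum_comm]
  simp only [mul_assoc]

theorem expect_map (p : PMF α) (f : α → β) (F : β → ℝ≥0∞) :
    expect (p.map f) F = expect p fun a => F (f a) := by
  rw [← PMF.bind_pure_comp, expect_bind]
  simp only [Function.comp, expect_pure]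

theorem expect_add (p : PMF α) (F G : α → ℝ≥0∞) :
    expect p (fun x => F x + G x) = expect p F + expect p G := by
  simp only [expect, mul_add, ENNReal.tsum_add]

theorem expect_const_mul (p : PMF α) (c : ℝ≥0∞) (F : α → ℝ≥0∞) :
    expect p (fun x => c * F x) = c * expect p F := by
  simp only [expect, ← ENNReal.tsum_mul_left]
  congr 1; ext x; ring

theorem expect_mul_const (p : PMF α) (c : ℝ≥0∞) (F : α → ℝ≥0∞) :
    expect p (fun x => F x * c) = expect p F * c := by
  simp only [mul_comm _ c, expect_const_mul]

theorem expect_const (p : PMF α) (c : ℝ≥0∞) : expect p (fun _ => c) = c := by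
  rw [expect, ENNReal.tsum_mul_right, p.tsum_coe, one_mul]

theorem expect_finset_sum {ι : Type} (p : PMF α) (t : Finset ι) (F : ι → α → ℝ≥0∞) :
    expect p (fun x => ∑ i ∈ t, F i x) = ∑ i ∈ t, expect p (F i) := by
  classical
  induction t using Finset.induction_on with
  | empty => simp [expect]
  | insert i t hi ih => simp only [Finset.sum_insert hi, expect_add, ih]

theorem expect_mono_of_sat {p : PMF α} {Q : α → Prop} (hp : Sat p Q) {F G : α → ℝ≥0∞}
    (h : ∀ x, Q x → F x ≤ G x) : expect p F ≤ expect p G := by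
  refine ENNReal.tsum_le_tsum fun x => ?_
  by_cases hx : p x = 0
  · simp [hx]
  · gcongr
    exact h x (hp x ((PMF.mem_support_iff _ _).2 hx))

theorem expect_mono {p : PMF α} {F G : α → ℝ≥0∞} (h : ∀ x, F x ≤ G x) :
    expect p F ≤ expect p G :=
  ENNReal.tsum_le_tsum fun x => by gcongr; exact h x

theorem expect_congr_of_sat {p : PMF α} {Q : α → Prop} (hp : Sat p Q) {F G : α → ℝ≥0∞}
    (h : ∀ x, Q x → F x = G x) : expect p F = expect p G :=
  le_antisymm (expect_mono_of_sat hp fun x hx => (h x hx).le)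
    (expect_mono_of_sat hp fun x hx => (h x hx).ge)

theorem expect_uniform {k : ℕ} [NeZero k] (F : Fin k → ℝ≥0∞) :
    expect (PMF.uniformOfFintype (Fin k)) F = (k : ℝ≥0∞)⁻¹ * ∑ i, F i := by
  rw [expect, tsum_fintype, Finset.mul_sum]
  simp

theorem toOuterMeasure_eq_expect (p : PMF α) (S : Set α) :
    p.toOuterMeasure S = expect p (S.indicator 1) := by
  rw [PMF.toOuterMeasure_apply, expect]
  congr 1; ext x
  by_cases hx : x ∈ S <;> simp [hx]

theorem sat_pure {a : α} {Q : α → Prop} (h : Q a) : Sat (PMF.pure a) Q := by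
  intro x hx
  rw [PMF.mem_support_pure_iff] at hx
  exact hx ▸ h

theorem sat_bind {p : PMF α} {f : α → PMF β} {Q : α → Prop} {R : β → Prop} (hp : Sat p Q)
    (hf : ∀ a, Q a → Sat (f a) R) : Sat (p.bind f) R := by
  intro y hy
  obtain ⟨a, ha, hy⟩ := (PMF.mem_support_bind_iff _ _ _).1 hy
  exact hf a (hp a ha) y hy

theorem sat_true (p : PMF α) : Sat p fun _ => True := fun _ _ => trivial

theorem Sat.mono {p : PMF α} {Q R : α → Prop} (hp : Sat p Q) (h : ∀ x, Q x → R x) : Sat p R :=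
  fun x hx => h x (hp x hx)

end Calculus

/-! ### What the programs do -/

section Semantics

variable {n : ℕ}

/-- The configuration with the clock advanced by `j`. -/
def Config.tick (s : Config n) (j : ℕ) : Config n := { s with clock := s.clock + j }

@[simp] theorem Config.tick_tick (s : Config n) (i j : ℕ) : (s.tick i).tick j = s.tick (i + j) := by
  simp [Config.tick, add_assoc]

@[simp] theorem Config.tick_deg (s : Config n) (i : ℕ) : (s.tick i).deg = s.deg := rfl
@[simp] theorem Config.tick_nbr (s : Config n) (i : ℕ) : (s.tick i).nbr = s.nbr := rfl
@[simp] theorem Config.tick_clock (s : Config n) (i : ℕ) : (s.tick i).clock = s.clock + i := rfl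

theorem run_walk_zero (k : ℕ) [NeZero k] (v : Fin n) (path : List (Fin n × ℕ)) (s : Config n) :
    (walk k 0 v path).run s =
      PMF.pure (if s.deg v ≤ k then some (v, path) else none, s.tick 1) := by
  simp only [walk, readDeg]
  split <;> rename_i h <;> 
  simp [StateT.run, bind, StateT.bind, get, getThe, MonadStateOf.get, StateT.get, set, StateT.set, pure, StateT.pure, h, Config.tick]

theorem run_walk_succ (k r : ℕ) [NeZero k] (v : Fin n) (path : List (Fin n × ℕ)) (s : Config n) :
    (walk k (r + 1) v path).run s =
      if s.deg v < k then PMF.pure (some (v, path), s.tick 1)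
      else (PMF.uniformOfFintype (Fin k)).bind fun i =>
        (walk k r (s.nbr v i) ((v, (i : ℕ)) :: path)).run (s.tick 3) := by
  simp only [walk, readDeg]
  split <;> rename_i h
  · simp [StateT.run, bind, StateT.bind, get, getThe, MonadStateOf.get, StateT.get, set, StateT.set, pure, StateT.pure, h, Config.tick]
  · simp [StateT.run, bind, StateT.bind, get, getThe, MonadStateOf.get, StateT.get, set, StateT.set, pure, StateT.pure, h, Config.tick, randomIndex, readNbr, StateT.lift, add_assoc]

theorem run_search_zero (k L : ℕ) [NeZero k] (v : Fin n) (s : Config n) :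
    (search k L 0 v).run s = PMF.pure (none, s) := by
  simp [search, StateT.run, pure, StateT.pure]

theorem run_search_succ (k L a : ℕ) [NeZero k] (v : Fin n) (s : Config n) :
    (search k L (a + 1) v).run s = ((walk k L v []).run s).bind fun x =>
      match x.1 with
      | some y => PMF.pure (some y, x.2)
      | none => (search k L a v).run x.2 := by
  simp only [search, StateT.run, bind, StateT.bind]
  congr 1
  funext x
  rcases x with ⟨_ | y, s'⟩ <;> rfl

/-- The memory of the out-neighbours after `reversePath`. -/
def revNbr (x : Fin n) : (Fin n → ℕ → Fin n) → Fin n → ℕ → List (Fin n × ℕ) → Fin n → ℕ → Fin n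
  | nbr, v, i, [] => Function.update nbr v (Function.update (nbr v) i x)
  | nbr, v, i, (u, j) :: path =>
    revNbr x (Function.update nbr v (Function.update (nbr v) i u)) u j path

theorem run_reversePath (x : Fin n) (path : List (Fin n × ℕ)) :
    ∀ (v : Fin n) (i : ℕ) (s : Config n), (reversePath x v i path).run s =
      PMF.pure ((), { s with nbr := revNbr x s.nbr v i path, clock := s.clock + path.length + 1 }) := by
  induction path with
  | nil =>
    intro v i s
    simp [reversePath, writeNbr, revNbr, StateT.run, modify, modifyGet, MonadStateOf.modifyGet, StateT.modifyGet, pure]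
  | cons e path ih =>
    intro v i s
    have := ih e.1 e.2 { s with nbr := Function.update s.nbr v (Function.update (s.nbr v) i e.1), clock := s.clock + 1 }
    simp only [StateT.run] at this
    simp [reversePath, writeNbr, revNbr, StateT.run, modify, modifyGet, MonadStateOf.modifyGet, StateT.modifyGet, pure, bind, StateT.bind, this]
    rw [show s.clock + 1 + path.length + 1 = s.clock + (path.length + 1) + 1 by omega]

/-- The configuration after a successful search that ended at `u`. -/
def finish (s : Config n) (x u : Fin n) (path : List (Fin n × ℕ)) : Config n :=
  { s with
    nbr := revNbr x s.nbr u (s.deg u) path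
    deg := Function.update s.deg u (s.deg u + 1)
    clock := s.clock + path.length + 3 }

/-- What follows the search. -/
noncomputable def conclude (x : Fin n) (r : Option (Fin n × List (Fin n × ℕ)) × Config n) :
    Bool × Config n :=
  match r.1 with
  | none => (false, r.2)
  | some y => (true, finish r.2 x y.1 y.2)

theorem run_insertEdge (k L A : ℕ) [NeZero k] (tie : Config n → Fin n → Fin n → Bool)
    (a b : Fin n) (s : Config n) :
    (insertEdge k L A tie a b).run s =
      ((combine (tie s a b) n a b).run s).bind fun y =>
        ((search k L A (if y.1 then a else b)).run y.2).map
          (conclude (if y.1 then b else a)) := by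
  simp only [insertEdge, StateT.run, bind, StateT.bind, get, getThe, MonadStateOf.get, StateT.get,
    pure, PMF.pure_bind]
  congr 1
  funext y
  rw [← PMF.bind_pure_comp]
  congr 1
  funext r
  rcases r with ⟨_ | ⟨u, path⟩, s'⟩
  · rfl
  · have := run_reversePath (if y.1 then b else a) path u (s'.deg u) (s'.tick 1)
    simp only [StateT.run, Config.tick] at this
    simp [readDeg, bind, StateT.bind, get, getThe, MonadStateOf.get, StateT.get, set, StateT.set, pure, StateT.pure, this, writeDeg, modify, modifyGet, MonadStateOf.modifyGet, StateT.modifyGet, conclude, finish]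
    rw [show s'.clock + 1 + path.length + 1 + 1 = s'.clock + path.length + 3 by omega]

theorem run_insertAll_nil (k L A : ℕ) [NeZero k] (tie : Config n → Fin n → Fin n → Bool)
    (s : Config n) : (insertAll k L A tie []).run s = PMF.pure (([s], false), s) := by
  simp [insertAll, StateT.run, bind, StateT.bind, get, getThe, MonadStateOf.get, StateT.get,
    pure, StateT.pure]

theorem run_insertAll_cons (k L A : ℕ) [NeZero k] (tie : Config n → Fin n → Fin n → Bool)
    (e : Fin n × Fin n) (es : List (Fin n × Fin n)) (s : Config n) :
    (insertAll k L A tie (e :: es)).run s =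
      ((insertEdge k L A tie e.1 e.2).run s).bind fun y =>
        if y.1 then ((insertAll k L A tie es).run y.2).map fun z => ((s :: z.1.1, z.1.2), z.2)
        else PMF.pure (([s], true), y.2) := by
  simp only [insertAll, StateT.run, bind, StateT.bind, get, getThe, MonadStateOf.get, StateT.get,
    pure, PMF.pure_bind]
  congr 1
  funext y
  rcases y with ⟨_ | _, s'⟩
  · rfl
  · simp only [if_true]
    rw [← PMF.bind_pure_comp]
    rfl

end Semantics

/-! ### Forests and their orientations -/

section Forest

variable {n : ℕ} {G : SimpleGraph (Fin n)}

/-- The vertices on the side of `q` of the edge from `y` to `q`. -/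
def side (G : SimpleGraph (Fin n)) (y q : Fin n) : Set (Fin n) :=
  {u | (G.deleteEdges {s(y, q)}).Reachable q u}

theorem mem_side_self (y q : Fin n) : q ∈ side G y q := SimpleGraph.Reachable.refl _

theorem notMem_side (hG : G.IsAcyclic) {y q : Fin n} (h : G.Adj y q) : y ∉ side G y q := by
  have hb := SimpleGraph.isAcyclic_iff_forall_adj_isBridge.1 hG h
  rw [SimpleGraph.isBridge_iff] at hb
  exact fun hy => hb hy.symm

/-- The deleted edge is the only exit from the side, and it can only be used from q to y because y
lies outside. -/
theorem side_step (hG : G.IsAcyclic) {y q a b : Fin n} (h : G.Adj y q) (ha : a ∈ side G y q)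
    (hab : G.Adj a b) : b ∈ side G y q ∨ (a = q ∧ b = y) := by
  by_cases he : s(a, b) = s(y, q)
  · rcases Sym2.eq_iff.1 he with ⟨rfl, rfl⟩ | ⟨rfl, rfl⟩
    · exact absurd ha (notMem_side hG h)
    · exact Or.inr ⟨rfl, rfl⟩
  · left
    have : (G.deleteEdges {s(y, q)}).Adj a b := by
      rw [SimpleGraph.deleteEdges_adj]
      exact ⟨hab, he⟩
    exact SimpleGraph.Reachable.trans ha this.reachable

/-- The branches of a forest at y are disjoint. A walk from u to q' that avoids the edge y q' cannot
leave the branch of q: it would have to pass through y, and then y would lie in the branch of q'.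
But q' is not in the branch of q. -/
theorem side_disjoint (hG : G.IsAcyclic) {y q q' u : Fin n} (h : G.Adj y q) (h' : G.Adj y q')
    (hu : u ∈ side G y q) (hu' : u ∈ side G y q') : q = q' := by
  by_contra hne
  have hq' : q' ∉ side G y q := by
    intro hm
    rcases side_step hG h hm h'.symm with hy | ⟨rfl, -⟩
    · exact notMem_side hG h hy
    · exact hne rfl
  have key : ∀ w, (G.deleteEdges {s(y, q')}).Reachable u w → w ∈ side G y q := by
    intro w hw
    rw [SimpleGraph.reachable_iff_reflTransGen] at hw
    induction hw with
    | refl => exact hu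
    | @tail b c hb hc ih =>
      rcases side_step hG h ih (SimpleGraph.deleteEdges_adj.1 hc).1 with hy | ⟨-, rfl⟩
      · exact hy
      · have : c ∈ side G c q' := by
          rw [← SimpleGraph.reachable_iff_reflTransGen] at hb
          exact SimpleGraph.Reachable.trans hu' (hb.trans hc.reachable)
        exact absurd this (notMem_side hG h')
  exact hq' (key q' hu'.symm)

/-- The arcs of `s` are edges of `G`, each with at most one orientation. -/
structure Config.OrientedIn (s : Config n) (G : SimpleGraph (Fin n)) : Prop where
  adj : ∀ {u v}, s.Arc u v → G.Adj u v
  antisymm : ∀ {u v}, s.Arc u v → ¬ s.Arc v u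

/-- Reachability along arcs. -/
def Config.Reach (s : Config n) : Fin n → Fin n → Prop := Relation.ReflTransGen s.Arc

variable {s : Config n}

/-- A directed walk that has crossed from y to q could return only over the same edge, which is
oriented the other way. -/
theorem Config.OrientedIn.reach_mem_side (hG : G.IsAcyclic) (hs : s.OrientedIn G) {y q w : Fin n}
    (h : s.Arc y q) (hw : s.Reach q w) : w ∈ side G y q := by
  induction hw with
  | refl => exact mem_side_self _ _
  | tail _ hc ih =>
    rcases side_step hG (hs.adj h) ih (hs.adj hc) with hy | ⟨rfl, rfl⟩
    · exact hy
    · exact absurd hc (hs.antisymm h)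

theorem Config.OrientedIn.not_reach (hG : G.IsAcyclic) (hs : s.OrientedIn G) {y q : Fin n}
    (h : s.Arc y q) : ¬ s.Reach q y :=
  fun hy => notMem_side hG (hs.adj h) (hs.reach_mem_side hG h hy)

/-- This uniqueness of directed walks gives both the bound k^(-L) for ending at a given vertex and
the control of `growth` under flips. -/
theorem Config.OrientedIn.arc_unique (hG : G.IsAcyclic) (hs : s.OrientedIn G) {y q q' w : Fin n}
    (h : s.Arc y q) (h' : s.Arc y q') (hw : s.Reach q w) (hw' : s.Reach q' w) : q = q' :=
  side_disjoint hG (hs.adj h) (hs.adj h') (hs.reach_mem_side hG h hw) (hs.reach_mem_side hG h' hw')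

/-- What reaches `q` before it steps to `y` lies behind `q`, seen from `y`. -/
theorem Config.OrientedIn.mem_side_of_reach (hG : G.IsAcyclic) (hs : s.OrientedIn G)
    {y q w : Fin n} (h : s.Arc q y) (hw : s.Reach w q) : w ∈ side G y q := by
  induction hw using Relation.ReflTransGen.head_induction_on with
  | refl => exact mem_side_self _ _
  | head hc _ ih =>
    rcases side_step hG (hs.adj h).symm ih (hs.adj hc).symm with hy | ⟨rfl, rfl⟩
    · exact hy
    · exact absurd hc (hs.antisymm h)

open Classical in
/-- The neighbours of `p` in the direction of `u`. -/
noncomputable def hop (G : SimpleGraph (Fin n)) (p u : Fin n) : Finset (Fin n) :=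
  Finset.univ.filter fun q => G.Adj p q ∧ u ∈ side G p q

theorem mem_hop {p u q : Fin n} : q ∈ hop G p u ↔ G.Adj p q ∧ u ∈ side G p q := by
  simp [hop]

theorem card_hop_le (hG : G.IsAcyclic) (p u : Fin n) : (hop G p u).card ≤ 1 := by
  refine Finset.card_le_one.2 fun q hq q' hq' => ?_
  rw [mem_hop] at hq hq'
  exact side_disjoint hG hq.1 hq'.1 hq.2 hq'.2

end Forest

/-! ### Components and combination ranks -/

section Components

variable {n : ℕ}

/-- A partition of the vertices into components with a rank for each of them. -/
structure Comps (n : ℕ) where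
  cls : Fin n → Fin n
  rk : Fin n → ℕ

/-- The rank of the union of two components. -/
def newRk (r₁ r₂ : ℕ) : ℕ := if r₁ = r₂ then r₁ + 1 else max r₁ r₂

theorem newRk_comm (r₁ r₂ : ℕ) : newRk r₁ r₂ = newRk r₂ r₁ := by
  simp only [newRk, eq_comm (a := r₁), max_comm r₁]
  split <;> simp_all

theorem le_newRk_left (r₁ r₂ : ℕ) : r₁ ≤ newRk r₁ r₂ := by
  unfold newRk; split <;> omega

theorem le_newRk_right (r₁ r₂ : ℕ) : r₂ ≤ newRk r₁ r₂ := by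
  unfold newRk; split <;> omega

theorem lt_newRk {r₁ r₂ : ℕ} (h : r₁ ≤ r₂) : r₁ < newRk r₁ r₂ := by
  unfold newRk; split <;> omega

/-- Singletons of rank `0`. -/
def Comps.start (n : ℕ) : Comps n := ⟨id, fun _ => 0⟩

/-- The components of `a` and `b` are united. -/
def Comps.link (U : Comps n) (a b : Fin n) : Comps n where
  cls v := if U.cls v = U.cls a then U.cls b else U.cls v
  rk v := if U.cls v = U.cls a ∨ U.cls v = U.cls b then newRk (U.rk a) (U.rk b) else U.rk v

/-- Ranks are attached to components and are logarithmic in their sizes. -/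
structure Comps.Wf (U : Comps n) : Prop where
  idem : ∀ v, U.cls (U.cls v) = U.cls v
  rk_eq : ∀ {u v}, U.cls u = U.cls v → U.rk u = U.rk v
  card : ∀ v, 2 ^ U.rk v ≤ (Finset.univ.filter fun u => U.cls u = U.cls v).card

theorem Comps.wf_start (n : ℕ) : (Comps.start n).Wf where
  idem _ := rfl
  rk_eq _ := rfl
  card v := by
    exact Nat.one_le_iff_ne_zero.2 (Finset.card_pos.2 ⟨v, by simp⟩).ne'

theorem Comps.Wf.rk_le {U : Comps n} (hU : U.Wf) (v : Fin n) : U.rk v ≤ Nat.log 2 n := by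
  have h := (hU.card v).trans (Finset.card_le_univ _)
  rw [Fintype.card_fin] at h
  exact Nat.le_log_of_pow_le (by norm_num) h

/-- The rank goes beyond the larger of the two only if they are equal, and then two components of
size at least 2^r each are united. -/
theorem Comps.Wf.link {U : Comps n} (hU : U.Wf) {a b : Fin n} (hab : U.cls a ≠ U.cls b) :
    (U.link a b).Wf where
  idem v := by
    simp only [Comps.link]
    by_cases h : U.cls v = U.cls a
    · simp [h, hU.idem, hab.symm]
    · simp [h, hU.idem]
  rk_eq {u v} h := by
    simp only [Comps.link] at h ⊢
    have key := @Comps.Wf.rk_eq _ _ hU u v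
    split_ifs at h ⊢ <;> simp_all
  card v := by
    have hcard : ∀ r₁ r₂ : ℕ, ∀ x y : ℕ, 2 ^ r₁ ≤ x → 2 ^ r₂ ≤ y → 2 ^ newRk r₁ r₂ ≤ x + y := by
      intro r₁ r₂ x y hx hy
      unfold newRk
      split_ifs with h
      · subst h; rw [pow_succ]; omega
      · rcases le_total r₁ r₂ with h' | h'
        · rw [max_eq_right h']; omega
        · rw [max_eq_left h']; omega
    by_cases h : U.cls v = U.cls a ∨ U.cls v = U.cls b
    · have hset : (Finset.univ.filter fun u => (U.link a b).cls u = (U.link a b).cls v) =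
          (Finset.univ.filter fun u => U.cls u = U.cls a) ∪
          (Finset.univ.filter fun u => U.cls u = U.cls b) := by
        ext u
        simp only [Finset.mem_filter, Finset.mem_univ, true_and, Finset.mem_union]
        simp only [Comps.link]
        split_ifs <;> simp_all
      rw [hset, Finset.card_union_of_disjoint]
      · simp only [Comps.link, if_pos h]
        exact hcard _ _ _ _ (hU.card a) (hU.card b)
      · rw [Finset.disjoint_filter]
        intro u _ h1 h2
        exact hab (h1.symm.trans h2)
    · have hset : (Finset.univ.filter fun u => (U.link a b).cls u = (U.link a b).cls v) =
          (Finset.univ.filter fun u => U.cls u = U.cls v) := by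
        ext u
        simp only [Finset.mem_filter, Finset.mem_univ, true_and]
        simp only [Comps.link]
        grind
      rw [hset]
      simp only [Comps.link, if_neg h]
      exact hU.card v

theorem Comps.rk_le_link (U : Comps n) (hU : U.Wf) (a b v : Fin n) :
    U.rk v ≤ (U.link a b).rk v := by
  simp only [Comps.link]
  split_ifs with h
  · rcases h with h | h
    · rw [hU.rk_eq h]; exact le_newRk_left _ _
    · rw [hU.rk_eq h]; exact le_newRk_right _ _
  · exact le_rfl

theorem Comps.rk_lt_link_left (U : Comps n) (hU : U.Wf) {a b v : Fin n} (hv : U.cls v = U.cls a)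
    (h : U.rk a ≤ U.rk b) : U.rk v < (U.link a b).rk v := by
  simp only [Comps.link, hv, true_or, if_true]
  rw [hU.rk_eq hv]
  exact lt_newRk h

theorem Comps.rk_lt_link_right (U : Comps n) (hU : U.Wf) {a b v : Fin n} (hv : U.cls v = U.cls b)
    (h : U.rk b ≤ U.rk a) : U.rk v < (U.link a b).rk v := by
  simp only [Comps.link, hv, or_true, if_true]
  rw [hU.rk_eq hv, newRk_comm]
  exact lt_newRk h

/-- The potential that pays for the mergers. -/
def Comps.weight (U : Comps n) : ℕ := ∑ v ∈ Finset.univ.filter fun v => U.cls v = v, (U.rk v + 2)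

theorem Comps.weight_start (n : ℕ) : (Comps.start n).weight = 2 * n := by
  simp [weight, start, mul_comm]

/-- With weight rank + 2 per component, a merger of equal ranks r releases 2(r + 2) - (r + 3) = r +
1, and a merger of different ranks releases the smaller rank plus 2. The total of 2n at the start
thus pays (smaller rank + 1) for every merger. -/
theorem Comps.weight_link {U : Comps n} (hU : U.Wf) {a b : Fin n} (hab : U.cls a ≠ U.cls b) :
    (U.link a b).weight + (min (U.rk a) (U.rk b) + 1) ≤ U.weight := by
  have hset : (Finset.univ.filter fun v => (U.link a b).cls v = v) =
      (Finset.univ.filter fun v => U.cls v = v).erase (U.cls a) := by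
    ext v
    simp only [Finset.mem_filter, Finset.mem_univ, true_and, Finset.mem_erase]
    simp only [Comps.link]
    split_ifs with h
    · constructor
      · rintro rfl
        rw [hU.idem] at h
        exact absurd h.symm hab
      · rintro ⟨h1, h2⟩
        exact absurd (h2.symm.trans h) h1
    · constructor
      · intro h1
        exact ⟨fun h2 => h (h1.trans h2), h1⟩
      · exact fun h1 => h1.2
  have ha : U.cls a ∈ Finset.univ.filter fun v => U.cls v = v := by simp [hU.idem]
  have hb : U.cls b ∈ (Finset.univ.filter fun v => U.cls v = v).erase (U.cls a) := by
    simp [hU.idem, hab.symm]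
  unfold Comps.weight
  rw [hset, ← Finset.add_sum_erase _ _ hb, ← Finset.add_sum_erase _ _ ha,
    ← Finset.add_sum_erase _ (fun v => U.rk v + 2) hb]
  have hsum : ∑ v ∈ ((Finset.univ.filter fun v => U.cls v = v).erase (U.cls a)).erase (U.cls b),
      ((U.link a b).rk v + 2) =
      ∑ v ∈ ((Finset.univ.filter fun v => U.cls v = v).erase (U.cls a)).erase (U.cls b),
      (U.rk v + 2) := by
    refine Finset.sum_congr rfl fun v hv => ?_
    simp only [Finset.mem_erase, Finset.mem_filter, Finset.mem_univ, true_and] at hv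
    simp only [Comps.link]
    rw [if_neg]
    rw [hv.2.2]
    exact fun h => h.elim hv.2.1 hv.1
  rw [hsum]
  have h1 : (U.link a b).rk (U.cls b) = newRk (U.rk a) (U.rk b) := by
    simp [Comps.link, hU.idem]
  have h2 : U.rk (U.cls a) = U.rk a := hU.rk_eq (hU.idem a)
  have h3 : U.rk (U.cls b) = U.rk b := hU.rk_eq (hU.idem b)
  rw [h1, h2, h3]
  unfold newRk
  split_ifs <;> omega

/-- Every edge of the list joins two different components. -/
def Merges : Comps n → List (Fin n × Fin n) → Prop
  | _, [] => True
  | U, e :: es => U.cls e.1 ≠ U.cls e.2 ∧ Merges (U.link e.1 e.2) es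

/-- The possible new head of an arc out of `p` when the edge from `a` to `b` is inserted. -/
noncomputable def eventHop (G : SimpleGraph (Fin n)) (U : Comps n) (a b p : Fin n) :
    Finset (Fin n) :=
  if U.cls p = U.cls a ∧ U.rk a ≤ U.rk b then hop G p b
  else if U.cls p = U.cls b ∧ U.rk b ≤ U.rk a then hop G p a
  else ∅

/-- All vertices that can become heads of arcs out of `p`. -/
noncomputable def cand (G : SimpleGraph (Fin n)) :
    List (Fin n × Fin n) → Comps n → Fin n → Finset (Fin n)
  | [], _, _ => ∅
  | e :: es, U, p => eventHop G U e.1 e.2 p ∪ cand G es (U.link e.1 e.2) p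

/-- Each merger contributes at most one candidate for p, and only if it raises the rank of p. The
sum of the number of future candidates and the current rank is therefore bounded by the largest
possible rank. -/
theorem card_cand {G : SimpleGraph (Fin n)} (hG : G.IsAcyclic) (p : Fin n) :
    ∀ (es : List (Fin n × Fin n)) (U : Comps n), U.Wf → Merges U es →
      (cand G es U p).card + U.rk p ≤ Nat.log 2 n := by
  intro es
  induction es with
  | nil => intro U hU _; simpa [cand] using hU.rk_le p
  | cons e es ih =>
    intro U hU hm
    have h := ih (U.link e.1 e.2) (hU.link hm.1) hm.2
    have h1 := Finset.card_union_le (eventHop G U e.1 e.2 p) (cand G es (U.link e.1 e.2) p)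
    have h2 : (eventHop G U e.1 e.2 p).card + U.rk p ≤ (U.link e.1 e.2).rk p := by
      unfold eventHop
      split_ifs with h3 h4
      · have := U.rk_lt_link_left hU h3.1 h3.2
        have := card_hop_le hG p e.2
        omega
      · have := U.rk_lt_link_right hU h4.1 h4.2
        have := card_hop_le hG p e.1
        omega
      · simpa using U.rk_le_link hU _ _ _
    simp only [cand]
    omega

end Components

/-! ### Rank trees -/

section RankTrees

variable {n : ℕ}

/-- The ancestor of `p` that is `h` levels above it. -/
def climb (par : ℕ → Option ℕ) : ℕ → ℕ → Option ℕ
  | 0, p => some p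
  | h + 1, p => (par p).bind (climb par h)

theorem climb_add (par : ℕ → Option ℕ) (i j p : ℕ) :
    climb par (i + j) p = (climb par i p).bind (climb par j) := by
  induction i generalizing p with
  | zero => simp [climb]
  | succ i ih =>
    rw [Nat.succ_add]
    simp only [climb, Option.bind_assoc]
    congr 1
    funext x
    exact ih x

theorem climb_mono {par par' : ℕ → Option ℕ} (h : ∀ z w, par z = some w → par' z = some w)
    {i p q : ℕ} (hp : climb par i p = some q) : climb par' i p = some q := by
  induction i generalizing p with
  | zero => exact hp
  | succ i ih =>
    simp only [climb, Option.bind_eq_some_iff] at hp ⊢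
    obtain ⟨x, hx, hq⟩ := hp
    exact ⟨x, h _ _ hx, ih hq⟩

/-- The parent pointers store a rank tree for each component. -/
def IsRankForest (par : ℕ → Option ℕ) (fresh : ℕ) (U : Comps n) : Prop :=
  (∀ z, fresh ≤ z → par z = none) ∧
  ∃ ρ : Fin n → ℕ, (∀ v, climb par (U.rk v) v = some (ρ v)) ∧ (∀ v, par (ρ v) = none) ∧
    (∀ v, ρ v < fresh) ∧ ∀ u v, ρ u = ρ v ↔ U.cls u = U.cls v

/-- The trees with roots `p` and `q` and heights `h₁` and `h₂` are combined. -/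
structure Joined (par : ℕ → Option ℕ) (fresh : ℕ) (par' : ℕ → Option ℕ) (fresh' : ℕ)
    (p q h₁ h₂ : ℕ) : Prop where
  fresh_le : fresh ≤ fresh'
  none_of_le : ∀ z, fresh' ≤ z → par' z = none
  mono : ∀ z w, par z = some w → par' z = some w
  frame : ∀ z, z ≠ p → z ≠ q → z < fresh → par' z = par z
  root : ∃ r d₁ d₂, par' r = none ∧ r < fresh' ∧ (r = p ∨ r = q ∨ fresh ≤ r) ∧
    climb par' d₁ p = some r ∧ climb par' d₂ q = some r ∧
    h₁ + d₁ = newRk h₁ h₂ ∧ h₂ + d₂ = newRk h₁ h₂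

theorem newRk_succ (r₁ r₂ : ℕ) : newRk (r₁ + 1) (r₂ + 1) = newRk r₁ r₂ + 1 := by
  unfold newRk; split_ifs <;> omega

theorem Joined.succ {par par' : ℕ → Option ℕ} {fresh fresh' p q h₁ h₂ : ℕ}
    (h : Joined par fresh par' fresh' p q h₁ h₂) :
    Joined par fresh par' fresh' p q (h₁ + 1) (h₂ + 1) where
  fresh_le := h.fresh_le
  none_of_le := h.none_of_le
  mono := h.mono
  frame := h.frame
  root := by
    obtain ⟨r, d₁, d₂, h1, h2, h3, h4, h5, h6, h7⟩ := h.root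
    exact ⟨r, d₁, d₂, h1, h2, h3, h4, h5, by rw [newRk_succ]; omega, by rw [newRk_succ]; omega⟩

/-- The root p hangs below `q₁`, one level above the height it has reached, so its leaves get the
same depth as those of the taller tree, whose rank stays unchanged. -/
theorem joined_of_root_left {par : ℕ → Option ℕ} {fresh p q₁ r h : ℕ}
    (hf : ∀ z, fresh ≤ z → par z = none) (hp : par p = none) (hpf : p < fresh)
    (hr : climb par h q₁ = some r) (hrn : par r = none) (hrf : r < fresh)
    (hpr : p ≠ r) :
    Joined par fresh (Function.update par p (some q₁)) fresh p r 0 (h + 1) := by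
  have hmono : ∀ z w, par z = some w → Function.update par p (some q₁) z = some w := by
    intro z w hz
    rw [Function.update_of_ne, hz]
    rintro rfl
    rw [hp] at hz
    cases hz
  refine ⟨le_rfl, fun z hz => ?_, hmono, fun z hz _ _ => Function.update_of_ne hz _ _,
    r, h + 1, 0, ?_, hrf, Or.inr (Or.inl rfl), ?_, rfl, ?_, ?_⟩
  · rw [Function.update_of_ne (by omega)]; exact hf z hz
  · rw [Function.update_of_ne hpr.symm, hrn]
  · simp only [climb, Function.update_self, Option.bind_some]
    exact climb_mono hmono hr
  · simp [newRk]
  · simp [newRk]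

theorem Joined.symm {par par' : ℕ → Option ℕ} {fresh fresh' p q h₁ h₂ : ℕ}
    (h : Joined par fresh par' fresh' p q h₁ h₂) :
    Joined par fresh par' fresh' q p h₂ h₁ where
  fresh_le := h.fresh_le
  none_of_le := h.none_of_le
  mono := h.mono
  frame z h1 h2 h3 := h.frame z h2 h1 h3
  root := by
    obtain ⟨r, d₁, d₂, h1, h2, h3, h4, h5, h6, h7⟩ := h.root
    exact ⟨r, d₂, d₁, h1, h2, by tauto, h5, h4, by rw [newRk_comm]; omega,
      by rw [newRk_comm]; omega⟩

theorem joined_of_roots {par : ℕ → Option ℕ} {fresh p q : ℕ}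
    (hf : ∀ z, fresh ≤ z → par z = none) (hp : par p = none) (hpf : p < fresh)
    (hq : par q = none) (hqf : q < fresh) (hpq : p ≠ q) :
    Joined par fresh (Function.update (Function.update par p (some fresh)) q (some fresh))
      (fresh + 1) p q 0 0 := by
  refine ⟨by omega, fun z hz => ?_, fun z w hz => ?_, fun z h1 h2 _ => ?_,
    fresh, 1, 1, ?_, by omega, Or.inr (Or.inr le_rfl), ?_, ?_, by simp [newRk], by simp [newRk]⟩
  · rw [Function.update_of_ne (by omega), Function.update_of_ne (by omega)]
    exact hf z (by omega)
  · rw [Function.update_of_ne, Function.update_of_ne, hz]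
    · rintro rfl; rw [hp] at hz; cases hz
    · rintro rfl; rw [hq] at hz; cases hz
  · rw [Function.update_of_ne h2, Function.update_of_ne h1]
  · rw [Function.update_of_ne (by omega), Function.update_of_ne (by omega)]
    exact hf _ le_rfl
  · simp [climb, Function.update_of_ne hpq]
  · simp [climb]

theorem run_combine_succ (tie : Bool) (fuel p q : ℕ) (s : Config n) :
    (combine tie (fuel + 1) p q).run s =
      match s.parent p, s.parent q with
      | some p₁, some q₁ => (combine tie fuel p₁ q₁).run (s.tick 2)
      | none, some q₁ => PMF.pure (true,
          { s with parent := Function.update s.parent p (some q₁), clock := s.clock + 3 })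
      | some p₁, none => PMF.pure (false,
          { s with parent := Function.update s.parent q (some p₁), clock := s.clock + 3 })
      | none, none => PMF.pure (tie,
          { s with
            parent := Function.update (Function.update s.parent p (some s.fresh)) q (some s.fresh)
            fresh := s.fresh + 1
            clock := s.clock + 5 }) := by
  simp only [combine, StateT.run]
  rcases hp : s.parent p with _ | p₁ <;> rcases hq : s.parent q with _ | q₁ <;>
  simp [readParent, bind, StateT.bind, get, getThe, MonadStateOf.get, StateT.get, set, StateT.set,
    pure, StateT.pure, hp, hq, writeParent, allocate, modify, modifyGet, MonadStateOf.modifyGet,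
    StateT.modifyGet, Config.tick]

/-- Heights are measured from the current nodes, so a step in lockstep lowers both by one, and
`newRk` is compatible with this shift (`Joined.succ`). The smaller height runs out first; this
reveals the side to be searched. The cost is two reads per level and at most five instructions in
the last round. -/
theorem combine_spec (tie : Bool) : ∀ (fuel p q : ℕ) (s : Config n) (h₁ h₂ r₁ r₂ : ℕ),
    climb s.parent h₁ p = some r₁ → climb s.parent h₂ q = some r₂ →
    s.parent r₁ = none → s.parent r₂ = none → r₁ < s.fresh → r₂ < s.fresh → r₁ ≠ r₂ →
    (∀ z, s.fresh ≤ z → s.parent z = none) → min h₁ h₂ < fuel →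
    ∃ first par' fresh' c,
      (combine tie fuel p q).run s = PMF.pure (first,
        { s with parent := par', fresh := fresh', clock := s.clock + c }) ∧
      c ≤ 2 * min h₁ h₂ + 5 ∧ (first = true → h₁ ≤ h₂) ∧ (first = false → h₂ ≤ h₁) ∧
      Joined s.parent s.fresh par' fresh' r₁ r₂ h₁ h₂ := by
  intro fuel
  induction fuel with
  | zero => intros; omega
  | succ fuel ih =>
    intro p q s h₁ h₂ r₁ r₂ h1 h2 hr1 hr2 hf1 hf2 hne hfresh hfuel
    rw [run_combine_succ]
    rcases hp : s.parent p with _ | p₁ <;> rcases hq : s.parent q with _ | q₁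
    · cases h₁ with
      | succ h₁ => simp [climb, hp] at h1
      | zero =>
        cases h₂ with
        | succ h₂ => simp [climb, hq] at h2
        | zero =>
          simp only [climb, Option.some.injEq] at h1 h2
          subst h1 h2
          exact ⟨_, _, _, 5, rfl, by omega, by simp, by simp,
            joined_of_roots hfresh hp hf1 hq hf2 hne⟩
    · cases h₁ with
      | succ h₁ => simp [climb, hp] at h1
      | zero =>
        simp only [climb, Option.some.injEq] at h1
        subst h1
        cases h₂ with
        | zero =>
          simp only [climb, Option.some.injEq] at h2
          rw [h2, hr2] at hq
          cases hq
        | succ h₂ =>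
          simp only [climb, hq, Option.bind_some] at h2
          exact ⟨_, _, _, 3, rfl, by omega, by simp, by simp,
            joined_of_root_left hfresh hp hf1 h2 hr2 hf2 hne⟩
    · cases h₂ with
      | succ h₂ => simp [climb, hq] at h2
      | zero =>
        simp only [climb, Option.some.injEq] at h2
        subst h2
        cases h₁ with
        | zero =>
          simp only [climb, Option.some.injEq] at h1
          rw [h1, hr1] at hp
          cases hp
        | succ h₁ =>
          simp only [climb, hp, Option.bind_some] at h1
          exact ⟨_, _, _, 3, rfl, by omega, by simp, by simp,
            (joined_of_root_left hfresh hq hf2 h1 hr1 hf1 hne.symm).symm⟩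
    · cases h₁ with
      | zero =>
        simp only [climb, Option.some.injEq] at h1
        rw [h1, hr1] at hp
        cases hp
      | succ h₁ =>
        cases h₂ with
        | zero =>
          simp only [climb, Option.some.injEq] at h2
          rw [h2, hr2] at hq
          cases hq
        | succ h₂ =>
          simp only [climb, hp, hq, Option.bind_some] at h1 h2
          obtain ⟨first, par', fresh', c, e1, e2, e3, e4, e5⟩ :=
            ih p₁ q₁ (s.tick 2) h₁ h₂ r₁ r₂ h1 h2 hr1 hr2 hf1 hf2 hne hfresh (by omega)
          refine ⟨first, par', fresh', 2 + c, ?_, by omega, fun h => ?_, fun h => ?_, e5.succ⟩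
          · simpa only [Config.tick_clock, add_assoc] using! e1
          · have := e3 h; omega
          · have := e4 h; omega

theorem isRankForest_start (n : ℕ) :
    IsRankForest (fun _ => none) n (Comps.start n) :=
  ⟨fun _ _ => rfl, fun v => v, fun _ => rfl, fun _ => rfl, fun v => v.2, fun u v => by
    simp [Comps.start, Fin.ext_iff]⟩

/-- Pointers are only added, so all old climbs survive. Since the leaves of a component share a
root, it suffices to prolong the climb from each of the two old roots. -/
theorem IsRankForest.link {par par' : ℕ → Option ℕ} {fresh fresh' : ℕ} {U : Comps n} (hU : U.Wf)
    {ρ : Fin n → ℕ} (hc : ∀ v, climb par (U.rk v) v = some (ρ v)) (hroot : ∀ v, par (ρ v) = none)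
    (hlt : ∀ v, ρ v < fresh) (hρ : ∀ u v, ρ u = ρ v ↔ U.cls u = U.cls v) {a b : Fin n}
    (hj : Joined par fresh par' fresh' (ρ a) (ρ b) (U.rk a) (U.rk b)) :
    IsRankForest par' fresh' (U.link a b) := by
  obtain ⟨r, d₁, d₂, h1, h2, h3, h4, h5, h6, h7⟩ := hj.root
  have hr : ∀ v, U.cls v ≠ U.cls a → U.cls v ≠ U.cls b → ρ v ≠ r := by
    intro v ha hb hv
    rcases h3 with rfl | rfl | h3
    · exact ha ((hρ _ _).1 hv)
    · exact hb ((hρ _ _).1 hv)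
    · exact absurd (hlt v) (by omega)
  refine ⟨hj.none_of_le,
    fun v => if U.cls v = U.cls a ∨ U.cls v = U.cls b then r else ρ v, fun v => ?_, fun v => ?_,
    fun v => ?_, fun u v => ?_⟩
  · simp only [Comps.link]
    have hv := climb_mono hj.mono (hc v)
    split_ifs with h
    · rcases h with h | h
      · rw [← h6, climb_add, ← hU.rk_eq h, hv, Option.bind_some, (hρ _ _).2 h, h4]
      · rw [← h7, climb_add, ← hU.rk_eq h, hv, Option.bind_some, (hρ _ _).2 h, h5]
    · exact hv
  · dsimp only
    split_ifs with h
    · exact h1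
    · push Not at h
      rw [hj.frame _ (fun h' => h.1 ((hρ _ _).1 h')) (fun h' => h.2 ((hρ _ _).1 h')) (hlt v)]
      exact hroot v
  · dsimp only
    split_ifs with h
    · exact h2
    · exact (hlt v).trans_le hj.fresh_le
  · simp only [Comps.link]
    have hu := hr u
    have hv := hr v
    have huv := hρ u v
    by_cases ha : U.cls u = U.cls a <;> by_cases hb : U.cls u = U.cls b <;>
      by_cases ha' : U.cls v = U.cls a <;> by_cases hb' : U.cls v = U.cls b <;>
      simp_all <;> grind

end RankTrees

/-! ### Flipping a path -/

section Flip

variable {n : ℕ}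

/-- The list consists of the edges (tail, cell) of a directed walk from `v` to `u`, the last one
first. -/
def IsPath (nbr : Fin n → ℕ → Fin n) (v : Fin n) : Fin n → List (Fin n × ℕ) → Prop
  | u, [] => u = v
  | u, e :: path => nbr e.1 e.2 = u ∧ IsPath nbr v e.1 path

theorem IsPath.congr {nbr nbr' : Fin n → ℕ → Fin n} {v : Fin n} {path : List (Fin n × ℕ)}
    (h : ∀ e ∈ path, nbr' e.1 = nbr e.1) : ∀ {u}, IsPath nbr v u path → IsPath nbr' v u path := by
  induction path with
  | nil => exact fun hu => hu
  | cons e path ih =>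
    intro u hu
    exact ⟨by rw [h e (by simp)]; exact hu.1, ih (fun e' he' => h e' (by simp [he'])) hu.2⟩

/-- The vertices of the path are distinct, so each is written once, in one cell, and the remaining
writes see the original contents of the rest of the path. The four parts are: the frame, the new
head in each changed cell, the reversal of every traversed arc, and the new arc from v to x. -/
theorem revNbr_spec (x v : Fin n) (path : List (Fin n × ℕ)) :
    ∀ (u : Fin n) (i : ℕ) (nbr : Fin n → ℕ → Fin n), IsPath nbr v u path →
      (u :: path.map Prod.fst).Nodup →
      (∀ y, y ∉ u :: path.map Prod.fst → revNbr x nbr u i path y = nbr y) ∧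
      (∀ e ∈ (u, i) :: path, ∃ p, revNbr x nbr u i path e.1 = Function.update (nbr e.1) e.2 p ∧
        ((∃ j, (p, j) ∈ path ∧ nbr p j = e.1) ∨ (e.1 = v ∧ p = x))) ∧
      (∀ e ∈ path, ∃ c, (nbr e.1 e.2, c) ∈ (u, i) :: path ∧
        revNbr x nbr u i path (nbr e.1 e.2) = Function.update (nbr (nbr e.1 e.2)) c e.1) ∧
      (∃ c, (v, c) ∈ (u, i) :: path ∧
        revNbr x nbr u i path v = Function.update (nbr v) c x) := by
  induction path with
  | nil =>
    intro u i nbr hp _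
    simp only [IsPath] at hp
    subst hp
    refine ⟨fun y hy => ?_, ?_, by simp, ?_⟩
    · simp only [List.map_nil, List.mem_singleton] at hy
      simp [revNbr, Function.update_of_ne hy]
    · intro e he
      simp only [List.mem_singleton] at he
      subst he
      exact ⟨x, by simp [revNbr], Or.inr ⟨rfl, rfl⟩⟩
    · exact ⟨i, by simp, by simp [revNbr]⟩
  | cons e path ih =>
    intro u i nbr hp hnd
    obtain ⟨p, j⟩ := e
    obtain ⟨hpu, hp⟩ := hp
    simp only [List.map_cons] at hnd
    have hu : ∀ e ∈ (p, j) :: path, e.1 ≠ u := by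
      rintro e he rfl
      have : e.1 ∈ p :: path.map Prod.fst := by
        rw [← List.map_cons (f := Prod.fst) (a := (p, j))]
        exact List.mem_map_of_mem he
      exact (List.nodup_cons.1 hnd).1 this
    set nbr₁ := Function.update nbr u (Function.update (nbr u) i p) with hnbr
    have hne : ∀ y, y ≠ u → nbr₁ y = nbr y := fun y hy => Function.update_of_ne hy _ _
    obtain ⟨h1, h2, h3, h4⟩ := ih p j nbr₁
      (IsPath.congr (fun e he => hne _ (hu e (List.mem_cons_of_mem _ he))) hp)
      (List.nodup_cons.1 hnd).2
    have hself : revNbr x nbr u i ((p, j) :: path) u = Function.update (nbr u) i p := by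
      simp only [revNbr]
      rw [h1 u (List.nodup_cons.1 hnd).1]
      simp [nbr₁]
    refine ⟨fun y hy => ?_, ?_, ?_, ?_⟩
    · simp only [List.map_cons] at hy
      rw [List.mem_cons, not_or] at hy
      simp only [revNbr]
      rw [h1 y hy.2, hne y hy.1]
    · intro e he
      rcases List.mem_cons.1 he with rfl | he
      · exact ⟨p, hself, Or.inl ⟨j, by simp, hpu⟩⟩
      · obtain ⟨p', hp', h⟩ := h2 e he
        refine ⟨p', by rw [← hne _ (hu e he)]; exact hp', ?_⟩
        rcases h with ⟨j', hj', hh⟩ | h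
        · refine Or.inl ⟨j', List.mem_cons_of_mem _ hj', ?_⟩
          rwa [hne _ (hu _ (List.mem_cons_of_mem _ hj'))] at hh
        · exact Or.inr h
    · intro e he
      rcases List.mem_cons.1 he with rfl | he
      · refine ⟨i, by rw [hpu]; simp, ?_⟩
        dsimp only
        rw [hpu]
        exact hself
      · obtain ⟨c, hc, h⟩ := h3 e he
        rw [hne _ (hu e (List.mem_cons_of_mem _ he))] at hc h
        rw [hne _ (hu _ hc)] at h
        exact ⟨c, List.mem_cons_of_mem _ hc, h⟩
    · obtain ⟨c, hc, h⟩ := h4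
      rw [hne _ (hu _ hc)] at h
      exact ⟨c, List.mem_cons_of_mem _ hc, h⟩

variable {G : SimpleGraph (Fin n)} {s : Config n}

theorem arc_cell {p : Fin n} {j : ℕ} (h : j < s.deg p) : s.Arc p (s.nbr p j) := ⟨j, h, rfl⟩

theorem IsPath.reach {v : Fin n} {path : List (Fin n × ℕ)} (hc : ∀ e ∈ path, e.2 < s.deg e.1) :
    ∀ {u}, IsPath s.nbr v u path → s.Reach v u ∧
      ∀ e ∈ path, s.Reach v e.1 ∧ s.Reach (s.nbr e.1 e.2) u := by
  induction path with
  | nil => rintro u rfl; exact ⟨.refl, by simp⟩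
  | cons e path ih =>
    rintro u ⟨hu, hp⟩
    obtain ⟨h1, h2⟩ := ih (fun e' he' => hc e' (by simp [he'])) hp
    have harc : s.Arc e.1 u := hu ▸ arc_cell (hc e (by simp))
    refine ⟨h1.tail harc, fun e' he' => ?_⟩
    rcases List.mem_cons.1 he' with rfl | he'
    · exact ⟨h1, hu ▸ .refl⟩
    · exact ⟨(h2 e' he').1, (h2 e' he').2.tail harc⟩

/-- A repeated vertex would close a directed cycle. -/
theorem IsPath.nodup (hG : G.IsAcyclic) (hs : s.OrientedIn G) {v : Fin n}
    {path : List (Fin n × ℕ)} (hc : ∀ e ∈ path, e.2 < s.deg e.1) :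
    ∀ {u}, IsPath s.nbr v u path → (u :: path.map Prod.fst).Nodup := by
  induction path with
  | nil => intro u _; simp
  | cons e path ih =>
    intro u hp
    refine List.nodup_cons.2 ⟨fun hu => ?_, ih (fun e' he' => hc e' (by simp [he'])) hp.2⟩
    obtain ⟨e', he', rfl⟩ := List.mem_map.1 hu
    exact hs.not_reach hG (arc_cell (hc e' he')) ((IsPath.reach hc hp).2 e' he').2

/-- The walk given by the list steps from `p` to `q`. -/
def Steps (s : Config n) (path : List (Fin n × ℕ)) (p q : Fin n) : Prop :=
  ∃ j, (p, j) ∈ path ∧ s.nbr p j = q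

/-- All about the path from `v` to `u` found by a walk. -/
structure Found (s : Config n) (G : SimpleGraph (Fin n)) (v u : Fin n)
    (path : List (Fin n × ℕ)) : Prop where
  oriented : s.OrientedIn G
  inj : ∀ v i j, i < s.deg v → j < s.deg v → s.nbr v i = s.nbr v j → i = j
  isPath : IsPath s.nbr v u path
  cell : ∀ e ∈ path, e.2 < s.deg e.1

variable {v u x : Fin n} {path : List (Fin n × ℕ)}

theorem Found.steps_arc (h : Found s G v u path) {p q : Fin n} (hpq : Steps s path p q) :
    s.Arc p q := by
  obtain ⟨j, hj, rfl⟩ := hpq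
  exact arc_cell (h.cell _ hj)

theorem Found.cell_unique (hG : G.IsAcyclic) (h : Found s G v u path) {y : Fin n} {c c' i : ℕ}
    (hc : (y, c) ∈ (u, i) :: path) (hc' : (y, c') ∈ (u, i) :: path) : c = c' := by
  have hnd : (((u, i) :: path).map Prod.fst).Nodup := h.isPath.nodup hG h.oriented h.cell
  have := List.inj_on_of_nodup_map hnd hc hc' rfl
  simpa using this

theorem finish_frame (hG : G.IsAcyclic) (h : Found s G v u path) {y : Fin n}
    (hy : y ∉ u :: path.map Prod.fst) :
    (finish s x u path).nbr y = s.nbr y ∧ (finish s x u path).deg y = s.deg y := by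
  refine ⟨(revNbr_spec x v path u _ _ h.isPath (h.isPath.nodup hG h.oriented h.cell)).1 y hy, ?_⟩
  exact Function.update_of_ne (fun hyu => hy (by simp [hyu])) _ _

/-- The only cell of a vertex of the path that is changed. -/
theorem finish_cell (hG : G.IsAcyclic) (h : Found s G v u path) {y : Fin n}
    (hy : y ∈ u :: path.map Prod.fst) :
    ∃ c p, (y, c) ∈ (u, s.deg u) :: path ∧ c < (finish s x u path).deg y ∧
      (finish s x u path).nbr y = Function.update (s.nbr y) c p ∧
      (Steps s path p y ∨ (y = v ∧ p = x)) ∧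
      ∀ i, i ≠ c → (i < (finish s x u path).deg y ↔ i < s.deg y) := by
  have hnd := h.isPath.nodup hG h.oriented h.cell
  have hy' : ∃ c, (y, c) ∈ (u, s.deg u) :: path := by
    rw [← List.map_cons (f := Prod.fst) (a := (u, s.deg u))] at hy
    obtain ⟨⟨y', c⟩, he, rfl⟩ := List.mem_map.1 hy
    exact ⟨c, he⟩
  obtain ⟨c, hc⟩ := hy'
  obtain ⟨p, hp, hpp⟩ :=
    (revNbr_spec x v path u (s.deg u) _ h.isPath hnd).2.1 (y, c) hc
  refine ⟨c, p, hc, ?_, hp, hpp, fun i hi => ?_⟩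
  · rcases List.mem_cons.1 hc with hc | hc
    · simp only [Prod.mk.injEq] at hc
      obtain ⟨rfl, rfl⟩ := hc
      simp [finish]
    · have := h.cell _ hc
      simp only [finish, Function.update_apply]
      split_ifs with hyu
      · subst hyu; dsimp only at this; omega
      · exact this
  · simp only [finish, Function.update_apply]
    split_ifs with hyu
    · subst hyu
      have : c = s.deg y := h.cell_unique hG hc (by simp)
      omega
    · rfl

theorem Found.steps_mem (hG : G.IsAcyclic) (h : Found s G v u path) {p q : Fin n}
    (hpq : Steps s path p q) : q ∈ u :: path.map Prod.fst := by
  obtain ⟨j, hj, rfl⟩ := hpq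
  obtain ⟨c, hc, -⟩ := (revNbr_spec p v path u 0 _ h.isPath
    (h.isPath.nodup hG h.oriented h.cell)).2.2.1 (p, j) hj
  rw [← List.map_cons (f := Prod.fst) (a := (u, 0))]
  exact List.mem_map_of_mem hc

/-- The arcs after the flip. -/
theorem finish_arc (hG : G.IsAcyclic) (h : Found s G v u path) (y q : Fin n) :
    (finish s x u path).Arc y q ↔
      (s.Arc y q ∧ ¬ Steps s path y q) ∨ Steps s path q y ∨ (y = v ∧ q = x) := by
  have hspec := revNbr_spec x v path u (s.deg u) _ h.isPath (h.isPath.nodup hG h.oriented h.cell)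
  by_cases hy : y ∈ u :: path.map Prod.fst
  · obtain ⟨c, p, hc, hlt, hnbr, hp, hiff⟩ := finish_cell (x := x) hG h hy
    have hq : q = p ↔ Steps s path q y ∨ (y = v ∧ q = x) := by
      constructor
      · rintro rfl; exact hp
      · rintro (⟨j, hj, hh⟩ | ⟨rfl, rfl⟩)
        · obtain ⟨c', hc', hn⟩ := hspec.2.2.1 (q, j) hj
          dsimp only at hc' hn
          rw [hh] at hc' hn
          obtain rfl := h.cell_unique hG hc hc'
          have e1 := congrFun hn c
          have e2 := congrFun hnbr c
          rw [Function.update_self] at e1 e2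
          exact e1.symm.trans e2
        · obtain ⟨c', hc', hn⟩ := hspec.2.2.2
          obtain rfl := h.cell_unique hG hc hc'
          have e1 := congrFun hn c
          have e2 := congrFun hnbr c
          rw [Function.update_self] at e1 e2
          exact e1.symm.trans e2
    -- The overwritten cell c holds the traversed arc out of y, or, at the end u of the path, is the
    -- first unused cell; so exactly the untraversed old arcs survive.
    have hold : (s.Arc y q ∧ ¬ Steps s path y q) ↔ ∃ i, i ≠ c ∧ i < s.deg y ∧ s.nbr y i = q := by
      constructor
      · rintro ⟨⟨i, hi, rfl⟩, hn⟩
        refine ⟨i, ?_, hi, rfl⟩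
        rintro rfl
        rcases List.mem_cons.1 hc with hc | hc
        · simp only [Prod.mk.injEq] at hc
          obtain ⟨rfl, rfl⟩ := hc
          omega
        · exact hn ⟨i, hc, rfl⟩
      · rintro ⟨i, hic, hi, rfl⟩
        refine ⟨⟨i, hi, rfl⟩, ?_⟩
        rintro ⟨j, hj, hh⟩
        have h1 := h.cell _ hj
        have h2 := h.inj y j i h1 hi hh
        have h3 := h.cell_unique hG hc (List.mem_cons_of_mem _ hj)
        omega
    rw [hold, ← hq]
    constructor
    · rintro ⟨i, hi, rfl⟩
      by_cases hic : i = c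
      · right; rw [hnbr, hic, Function.update_self]
      · left
        exact ⟨i, hic, (hiff i hic).1 hi, by rw [hnbr, Function.update_of_ne hic]⟩
    · rintro (⟨i, hic, hi, rfl⟩ | rfl)
      · exact ⟨i, (hiff i hic).2 hi, by rw [hnbr, Function.update_of_ne hic]⟩
      · exact ⟨c, hlt, by rw [hnbr, Function.update_self]⟩
  · obtain ⟨h1, h2⟩ := finish_frame (x := x) hG h hy
    have h3 : ¬ Steps s path y q := by
      rintro ⟨j, hj, -⟩
      exact hy (List.mem_cons_of_mem _ (List.mem_map_of_mem (f := Prod.fst) hj))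
    have h4 : ¬ Steps s path q y := fun hs => hy (h.steps_mem hG hs)
    have h5 : y ≠ v := by
      rintro rfl
      obtain ⟨c', hc', -⟩ := hspec.2.2.2
      apply hy
      rw [← List.map_cons (f := Prod.fst) (a := (u, s.deg u))]
      exact List.mem_map_of_mem (f := Prod.fst) hc'
    simp only [Config.Arc, h1, h2, h3, h4, h5]
    simp

theorem flips_finish_le (hG : G.IsAcyclic) (h : Found s G v u path) (hx : ¬ s.Arc x v) :
    flips s (finish s x u path) ≤ path.length := by
  have hsub : {e : Fin n × Fin n | s.Arc e.1 e.2 ∧ (finish s x u path).Arc e.2 e.1} ⊆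
      ((path.map fun e => (e.1, s.nbr e.1 e.2)).toFinset : Set (Fin n × Fin n)) := by
    rintro ⟨p, q⟩ ⟨h1, h2⟩
    rw [finish_arc hG h] at h2
    rcases h2 with h2 | ⟨j, hj, hh⟩ | ⟨rfl, rfl⟩
    · exact absurd h2.1 (h.oriented.antisymm h1)
    · simp only [List.coe_toFinset, List.mem_map, Set.mem_ofPred_eq]
      exact ⟨(p, j), hj, by dsimp only at hh ⊢; rw [hh]⟩
    · exact absurd h1 hx
  refine (Set.ncard_le_ncard hsub (Finset.finite_toSet _)).trans ?_
  rw [Set.ncard_coe_finset]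
  exact (List.toFinset_card_le _).trans (by simp)

end Flip

/-! ### The growth of the orientation -/

section Growth

variable {n : ℕ}

/-- The directed walks of at most `ℓ` steps from `v`, where a walk of `i` steps counts `(3/4)^i`. -/
noncomputable def growth (s : Config n) : ℕ → Fin n → ℝ
  | 0, _ => 1
  | ℓ + 1, v => 1 + 3 / 4 * ∑ i ∈ Finset.range (s.deg v), growth s ℓ (s.nbr v i)

theorem growth_nonneg (s : Config n) (ℓ : ℕ) : ∀ v, 0 ≤ growth s ℓ v := by
  induction ℓ with
  | zero => intro v; simp [growth]
  | succ ℓ ih =>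
    intro v
    simp only [growth]
    have := Finset.sum_nonneg fun i (_ : i ∈ Finset.range (s.deg v)) => ih (s.nbr v i)
    positivity

variable {G : SimpleGraph (Fin n)} {s : Config n} {v u x : Fin n} {path : List (Fin n × ℕ)}

/-- A vertex that does not reach u sees no change. On the path, one arc is exchanged for an arc to
the preceding vertex of the path or to x, so a bound M has to satisfy S + (3/4) max(M, B) ≤ M; the
choice M = 4S + (3/4)B does. Any other vertex has at most one arc towards u, so its walks can meet
the path in only one way, and M is added at most once. -/
theorem growth_finish (hG : G.IsAcyclic) (h : Found s G v u path) (hx : ¬ s.Reach x u) {S B : ℝ}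
    (hS : ∀ ℓ p, p ∈ u :: path.map Prod.fst → growth s ℓ p ≤ S) (hB : ∀ ℓ, growth s ℓ x ≤ B)
    (ℓ : ℕ) (y : Fin n) :
    (¬ s.Reach y u → growth (finish s x u path) ℓ y = growth s ℓ y) ∧
    (y ∈ u :: path.map Prod.fst → growth (finish s x u path) ℓ y ≤ 4 * S + 3 / 4 * B) ∧
    growth (finish s x u path) ℓ y ≤ growth s ℓ y + (4 * S + 3 / 4 * B) := by
  have hP : ∀ p ∈ u :: path.map Prod.fst, s.Reach p u := by
    intro p hp
    rcases List.mem_cons.1 hp with rfl | hp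
    · exact .refl
    · obtain ⟨e, he, rfl⟩ := List.mem_map.1 hp
      exact Relation.ReflTransGen.head (arc_cell (h.cell e he)) ((h.isPath.reach h.cell).2 e he).2
  have hS1 : 1 ≤ S := by simpa [growth] using hS 0 u (by simp)
  have hB1 : 1 ≤ B := by simpa [growth] using hB 0
  have hone : ∀ y i j, i < s.deg y → j < s.deg y → s.Reach (s.nbr y i) u → s.Reach (s.nbr y j) u →
      i = j := fun y i j hi hj h1 h2 =>
    h.inj y i j hi hj (h.oriented.arc_unique hG (arc_cell hi) (arc_cell hj) h1 h2)
  induction ℓ generalizing y with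
  | zero =>
    refine ⟨fun _ => rfl, fun _ => ?_, ?_⟩ <;> simp only [growth] <;> linarith
  | succ ℓ ih =>
    have h1 : ¬ s.Reach y u → growth (finish s x u path) (ℓ + 1) y = growth s (ℓ + 1) y := by
      intro hy
      obtain ⟨e1, e2⟩ := finish_frame (x := x) hG h (fun hyP => hy (hP y hyP))
      simp only [growth, e1, e2]
      congr 2
      refine Finset.sum_congr rfl fun i hi => (ih _).1 fun hr => hy ?_
      exact Relation.ReflTransGen.head (arc_cell (Finset.mem_range.1 hi)) hr
    have h2 : y ∈ u :: path.map Prod.fst →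
        growth (finish s x u path) (ℓ + 1) y ≤ 4 * S + 3 / 4 * B := by
      intro hy
      obtain ⟨c, p, hc, hlt, hnbr, hp, hiff⟩ := finish_cell (x := x) hG h hy
      -- The new head p is a vertex of the path, covered by induction, or it is x, whose walks never
      -- meet the path.
      have hp' : growth (finish s x u path) ℓ p ≤ 4 * S + 3 / 4 * B ∨
          growth (finish s x u path) ℓ p ≤ B := by
        rcases hp with ⟨j, hj, -⟩ | ⟨-, rfl⟩
        · exact Or.inl ((ih p).2.1
            (List.mem_cons_of_mem _ (List.mem_map_of_mem (f := Prod.fst) hj)))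
        · exact Or.inr ((ih p).1 hx ▸ hB ℓ)
      -- The surviving arcs of y do not lead to u, since the only one that did was flipped; the
      -- walks behind them are the old ones.
      have hold : 1 + 3 / 4 * ∑ i ∈ (Finset.range ((finish s x u path).deg y)).erase c,
          growth (finish s x u path) ℓ ((finish s x u path).nbr y i) ≤ growth s (ℓ + 1) y := by
        simp only [growth]
        have hle : ∑ i ∈ (Finset.range ((finish s x u path).deg y)).erase c,
            growth (finish s x u path) ℓ ((finish s x u path).nbr y i) ≤
            ∑ i ∈ Finset.range (s.deg y), growth s ℓ (s.nbr y i) := by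
          calc _ = ∑ i ∈ (Finset.range ((finish s x u path).deg y)).erase c,
              growth s ℓ (s.nbr y i) := by
                refine Finset.sum_congr rfl fun i hi => ?_
                have hic := Finset.ne_of_mem_erase hi
                have hid := (hiff i hic).1 (Finset.mem_range.1 (Finset.mem_of_mem_erase hi))
                rw [hnbr, Function.update_of_ne hic]
                refine (ih _).1 fun hr => ?_
                rcases List.mem_cons.1 hc with hc | hc
                · simp only [Prod.mk.injEq] at hc
                  obtain ⟨rfl, rfl⟩ := hc
                  exact h.oriented.not_reach hG (arc_cell hid) hr
                · exact hic (hone y i c hid (h.cell _ hc) hr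
                    ((h.isPath.reach h.cell).2 _ hc).2)
            _ ≤ _ := by
                refine Finset.sum_le_sum_of_subset_of_nonneg (fun i hi => ?_)
                  fun _ _ _ => growth_nonneg _ _ _
                have hic := Finset.ne_of_mem_erase hi
                exact Finset.mem_range.2
                  ((hiff i hic).1 (Finset.mem_range.1 (Finset.mem_of_mem_erase hi)))
        linarith
      have hS' := hS (ℓ + 1) y hy
      have heq : growth (finish s x u path) (ℓ + 1) y = 1 + 3 / 4 *
          ∑ i ∈ (Finset.range ((finish s x u path).deg y)).erase c,
            growth (finish s x u path) ℓ ((finish s x u path).nbr y i) +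
          3 / 4 * growth (finish s x u path) ℓ p := by
        rw [growth, ← Finset.add_sum_erase _ _ (Finset.mem_range.2 hlt), hnbr,
          Function.update_self]
        ring
      rw [heq]
      rcases hp' with hp' | hp' <;> linarith
    refine ⟨h1, h2, ?_⟩
    by_cases hy : y ∈ u :: path.map Prod.fst
    · have := growth_nonneg s (ℓ + 1) y
      linarith [h2 hy]
    · obtain ⟨e1, e2⟩ := finish_frame (x := x) hG h hy
      have hle : ∑ i ∈ Finset.range (s.deg y), growth (finish s x u path) ℓ (s.nbr y i) ≤
          ∑ i ∈ Finset.range (s.deg y), growth s ℓ (s.nbr y i) + (4 * S + 3 / 4 * B) := by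
        by_cases hex : ∃ i ∈ Finset.range (s.deg y), s.Reach (s.nbr y i) u
        · obtain ⟨i, hi, hr⟩ := hex
          rw [← Finset.add_sum_erase _ _ hi, ← Finset.add_sum_erase _ _ hi]
          have hrest : ∑ j ∈ (Finset.range (s.deg y)).erase i,
              growth (finish s x u path) ℓ (s.nbr y j) =
              ∑ j ∈ (Finset.range (s.deg y)).erase i, growth s ℓ (s.nbr y j) := by
            refine Finset.sum_congr rfl fun j hj => (ih _).1 fun hr' => ?_
            exact Finset.ne_of_mem_erase hj (hone y j i
              (Finset.mem_range.1 (Finset.mem_of_mem_erase hj)) (Finset.mem_range.1 hi) hr' hr)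
          rw [hrest]
          linarith [(ih (s.nbr y i)).2.2]
        · push Not at hex
          rw [Finset.sum_congr rfl fun i hi => (ih _).1 (hex i hi)]
          linarith
      simp only [growth, e1, e2]
      linarith

end Growth

/-! ### The invariant of the orientation -/

section Invariant

variable {n : ℕ}

/-- `s` stores an orientation of the edge set `E`, the components of which are given by `U`. All arcs
go to candidates, and the numbers of directed walks are bounded in terms of the ranks. -/
structure Core (G : SimpleGraph (Fin n)) (cd : Fin n → Finset (Fin n)) (k : ℕ)
    (E : Set (Sym2 (Fin n))) (U : Comps n) (s : Config n) : Prop where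
  deg_le : ∀ v, s.deg v ≤ k + 1
  deg_rk : ∀ v, s.deg v ≤ U.rk v
  inj : ∀ v i j, i < s.deg v → j < s.deg v → s.nbr v i = s.nbr v j → i = j
  arcs : ∀ u v, (s.Arc u v ∨ s.Arc v u) ↔ s(u, v) ∈ E
  antisymm : ∀ u v, s.Arc u v → ¬ s.Arc v u
  adj : ∀ u v, s(u, v) ∈ E → G.Adj u v
  cls : ∀ u v, s(u, v) ∈ E → U.cls u = U.cls v
  cand : ∀ u v, s.Arc u v → v ∈ cd u
  growth_le : ∀ ℓ v, growth s ℓ v ≤ 20 ^ U.rk v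

variable {G : SimpleGraph (Fin n)} {cd : Fin n → Finset (Fin n)} {k : ℕ}
  {E : Set (Sym2 (Fin n))} {U : Comps n} {s : Config n}

theorem Core.orientedIn (h : Core G cd k E U s) : s.OrientedIn G where
  adj huv := h.adj _ _ ((h.arcs _ _).1 (Or.inl huv))
  antisymm := h.antisymm _ _

theorem Core.cls_arc (h : Core G cd k E U s) {u v : Fin n} (huv : s.Arc u v) :
    U.cls u = U.cls v := h.cls _ _ ((h.arcs _ _).1 (Or.inl huv))

theorem Core.cls_reach (h : Core G cd k E U s) {u v : Fin n} (huv : s.Reach u v) :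
    U.cls u = U.cls v := by
  induction huv with
  | refl => rfl
  | tail _ hc ih => exact ih.trans (h.cls_arc hc)

theorem core_start (G : SimpleGraph (Fin n)) (cd : Fin n → Finset (Fin n)) (k : ℕ) :
    Core G cd k ∅ (Comps.start n) (Config.init n) := by
  have harc : ∀ u v, ¬ (Config.init n).Arc u v := by
    rintro u v ⟨i, hi, -⟩
    exact absurd hi (Nat.not_lt_zero _)
  refine ⟨fun v => Nat.zero_le _, fun v => le_rfl, fun v i j hi => absurd hi (Nat.not_lt_zero _),
    fun u v => ?_, fun u v h => absurd h (harc _ _), by simp, by simp,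
    fun u v h => absurd h (harc _ _), fun ℓ v => ?_⟩
  · simp [harc]
  · cases ℓ <;> simp [growth, Config.init, Comps.start]

/-- This inequality fixes the base 20. For r < R it needs 5 · 20^r ≤ 20^R / 4, with equality when R
= r + 1; for r = R the factor 5 + 3/4 is below 20. -/
theorem growth_bound {r R : ℕ} (h : r ≤ R) :
    (20 : ℝ) ^ r + (4 * 20 ^ r + 3 / 4 * 20 ^ R) ≤ 20 ^ newRk r R := by
  unfold newRk
  split_ifs with h'
  · subst h'
    rw [pow_succ]
    have : (0 : ℝ) < 20 ^ r := by positivity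
    linarith
  · rw [max_eq_right h]
    obtain ⟨d, rfl⟩ : ∃ d, R = r + 1 + d := ⟨R - (r + 1), by omega⟩
    have h1 : (1 : ℝ) ≤ 20 ^ d := one_le_pow₀ (by norm_num)
    have h2 : (0 : ℝ) < 20 ^ r := by positivity
    rw [pow_add, pow_succ]
    nlinarith

theorem Core.found (h : Core G cd k E U s) {v u : Fin n} {path : List (Fin n × ℕ)}
    (hp : IsPath s.nbr v u path) (hc : ∀ e ∈ path, e.2 < s.deg e.1) : Found s G v u path :=
  ⟨h.orientedIn, h.inj, hp, hc⟩

/-- The invariant survives because all changes lie in the component of v, where the rank strictly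
increases: this pays for the additional out-edge of u and for the larger `growth`. -/
theorem Core.finish (hG : G.IsAcyclic) (h : Core G cd k E U s) (hU : U.Wf) {U' : Comps n}
    {v u x : Fin n} {path : List (Fin n × ℕ)}
    (hp : IsPath s.nbr v u path) (hc : ∀ e ∈ path, e.2 < s.deg e.1) (hu : s.deg u ≤ k)
    (hvx : G.Adj v x) (hcls : U.cls v ≠ U.cls x) (hrk : U.rk v ≤ U.rk x)
    (hU1 : ∀ p q, U.cls p = U.cls q → U'.cls p = U'.cls q) (hU2 : U'.cls v = U'.cls x)
    (hU3 : ∀ p, U.rk p ≤ U'.rk p)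
    (hU4 : ∀ p, U.cls p = U.cls v → U'.rk p = newRk (U.rk v) (U.rk x))
    (hcd : ∀ p, U.cls p = U.cls v → hop G p x ⊆ cd p) :
    Core G cd k (insert s(v, x) E) U' (finish s x u path) := by
  have hf := h.found hp hc
  have hr := hp.reach hc
  have hst : ∀ p q, Steps s path p q → s.Arc p q := fun p q => hf.steps_arc
  have hx : ∀ p, U.cls p = U.cls v → ¬ s.Arc p x ∧ ¬ s.Arc x p := by
    intro p hp
    refine ⟨fun ha => hcls ?_, fun ha => hcls ?_⟩
    · rw [← hp, h.cls_arc ha]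
    · rw [← hp, h.cls_arc ha]
  have harc := fun y q => finish_arc (x := x) hG hf y q
  have hcu : U.cls u = U.cls v := (h.cls_reach hr.1).symm
  have hdeg : ∀ w, (DancingWalk.finish s x u path).deg w ≤ if w = u then s.deg w + 1 else s.deg w := by
    intro w
    simp only [DancingWalk.finish, Function.update_apply]
    split_ifs with hw
    · rw [hw]
    · exact le_rfl
  have hlt : ∀ p, U.cls p = U.cls v → U.rk p < U'.rk p := by
    intro p hp
    rw [hU4 p hp, hU.rk_eq hp]
    exact lt_newRk hrk
  refine ⟨fun w => ?_, fun w => ?_, ?_, fun p q => ?_, fun p q => ?_, ?_, ?_, ?_, ?_⟩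
  · refine (hdeg w).trans ?_
    split_ifs with hw
    · subst hw; omega
    · exact h.deg_le w
  · refine (hdeg w).trans ?_
    have := h.deg_rk w
    split_ifs with hw
    · subst hw
      have := hlt w hcu
      omega
    · exact this.trans (hU3 w)
  · intro y i j hi hj hij
    by_cases hy : y ∈ u :: path.map Prod.fst
    · obtain ⟨c, p, hyc, hlt, hnbr, hp, hiff⟩ := finish_cell (x := x) hG hf hy
      have hnew : ∀ i, i ≠ c → i < s.deg y → s.nbr y i ≠ p := by
        rintro i hi hid rfl
        rcases hp with hp | ⟨rfl, hpx⟩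
        · exact h.antisymm _ _ (hst _ _ hp) (arc_cell hid)
        · exact (hx y rfl).1 (hpx ▸ arc_cell hid)
      rw [hnbr, Function.update_apply, Function.update_apply] at hij
      split_ifs at hij with h1 h2 h2
      · omega
      · exact absurd hij.symm (hnew j h2 ((hiff j h2).1 hj))
      · exact absurd hij (hnew i h1 ((hiff i h1).1 hi))
      · exact h.inj y i j ((hiff i h1).1 hi) ((hiff j h2).1 hj) hij
    · obtain ⟨e1, e2⟩ := finish_frame (x := x) hG hf hy
      rw [e2] at hi hj
      rw [e1] at hij
      exact h.inj y i j hi hj hij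
  · rw [harc, harc, Set.mem_insert_iff, ← h.arcs, Sym2.eq_iff]
    have h1 := hst p q
    have h2 := hst q p
    tauto
  · rw [harc, harc]
    have h1 := hst p q
    have h2 := hst q p
    have h3 := h.antisymm p q
    have h4 := hx v rfl
    rintro (⟨h5, h6⟩ | h5 | ⟨rfl, rfl⟩) (⟨h7, h8⟩ | h7 | h7)
    · exact h3 h5 h7
    · exact h6 h7
    · exact h4.2 (h7.1 ▸ h7.2 ▸ h5)
    · exact h8 h5
    · exact h3 (h1 h7) (h2 h5)
    · exact h4.1 (h7.1 ▸ h7.2 ▸ h2 h5)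
    · exact h4.2 h7
    · exact h4.1 (h1 h7)
    · exact hcls (by rw [h7.1])
  · intro p q hpq
    rcases hpq with hpq | hpq
    · rcases Sym2.eq_iff.1 hpq with ⟨rfl, rfl⟩ | ⟨rfl, rfl⟩
      · exact hvx
      · exact hvx.symm
    · exact h.adj p q hpq
  · intro p q hpq
    rcases hpq with hpq | hpq
    · rcases Sym2.eq_iff.1 hpq with ⟨rfl, rfl⟩ | ⟨rfl, rfl⟩
      · exact hU2
      · exact hU2.symm
    · exact hU1 _ _ (h.cls p q hpq)
  · intro y q hyq
    rw [harc] at hyq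
    rcases hyq with hyq | hyq | ⟨rfl, rfl⟩
    · exact h.cand y q hyq.1
    · have hqy := hst _ _ hyq
      obtain ⟨j, hj, -⟩ := hyq
      have hvq := (hr.2 _ hj).1
      dsimp only at hvq
      have hyv : U.cls y = U.cls v := by rw [h.cls_reach hvq, h.cls_arc hqy]
      refine hcd y hyv (mem_hop.2 ⟨(h.orientedIn.adj hqy).symm, ?_⟩)
      -- The walk came from v over q to y, so v lies behind q as seen from y. The edge from v to x
      -- cannot be the edge from q to y, whose ends lie in one component, so x lies behind q too.
      have hv := h.orientedIn.mem_side_of_reach hG hqy hvq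
      rcases side_step hG (h.orientedIn.adj hqy).symm hv hvx with hside | ⟨-, rfl⟩
      · exact hside
      · exact absurd hyv.symm hcls
    · exact hcd y rfl (mem_hop.2 ⟨hvx, mem_side_self _ _⟩)
  · intro ℓ y
    have hg := growth_finish (x := x) hG hf (S := 20 ^ U.rk v) (B := 20 ^ U.rk x)
      (fun hxu => hcls (by rw [h.cls_reach hxu, hcu])) (fun ℓ p hp => ?_)
      (fun ℓ => h.growth_le ℓ x) ℓ y
    · by_cases hy : s.Reach y u
      · have hyv : U.cls y = U.cls v := (h.cls_reach hy).trans hcu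
        refine hg.2.2.trans ?_
        rw [hU4 y hyv]
        refine le_trans ?_ (growth_bound hrk)
        have := h.growth_le ℓ y
        rw [hU.rk_eq hyv] at this
        linarith
      · rw [hg.1 hy]
        exact (h.growth_le ℓ y).trans (pow_le_pow_right₀ (by norm_num) (hU3 y))
    · refine (h.growth_le ℓ p).trans (le_of_eq ?_)
      congr 1
      apply hU.rk_eq
      rcases List.mem_cons.1 hp with rfl | hp
      · exact hcu
      · obtain ⟨e, he, rfl⟩ := List.mem_map.1 hp
        exact (h.cls_reach (hr.2 e he).1).symm

end Invariant

/-! ### Random walks -/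

section Walks

variable {n : ℕ} {k : ℕ}

/-- The possible ends of walks of exactly `ℓ` steps. -/
def ends (s : Config n) (k : ℕ) : ℕ → Fin n → Finset (Fin n)
  | 0, v => {v}
  | ℓ + 1, v => if s.deg v < k then ∅ else
      (Finset.univ : Finset (Fin k)).biUnion fun i => ends s k ℓ (s.nbr v i)

/-- The ends at which walks of `ℓ` steps fail. -/
def deadEnds (s : Config n) (k ℓ : ℕ) (v : Fin n) : Finset (Fin n) :=
  (ends s k ℓ v).filter fun w => k < s.deg w

/-- The probability that a walk goes `ℓ` steps and ends at `w`. -/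
noncomputable def endProb (s : Config n) (k : ℕ) : ℕ → Fin n → Fin n → ℝ≥0∞
  | 0, v, w => if v = w then 1 else 0
  | ℓ + 1, v, w => if s.deg v < k then 0 else
      (k : ℝ≥0∞)⁻¹ * ∑ i : Fin k, endProb s k ℓ (s.nbr v i) w

theorem endProb_ne_zero {s : Config n} {w : Fin n} : ∀ {ℓ : ℕ} {v : Fin n},
    endProb s k ℓ v w ≠ 0 → w ∈ ends s k ℓ v ∧ s.Reach v w := by
  intro ℓ
  induction ℓ with
  | zero =>
    intro v h
    simp only [endProb, ne_eq, ite_eq_right_iff, one_ne_zero, imp_false, not_not] at h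
    subst h
    exact ⟨by simp [ends], .refl⟩
  | succ ℓ ih =>
    intro v h
    simp only [endProb] at h
    split_ifs at h with hd
    · exact absurd rfl h
    · obtain ⟨i, -, hi⟩ := Finset.exists_ne_zero_of_sum_ne_zero (right_ne_zero_of_mul h)
      obtain ⟨h1, h2⟩ := ih hi
      refine ⟨?_, Relation.ReflTransGen.head (arc_cell (i.2.trans_le (not_lt.1 hd))) h2⟩
      simp only [ends, if_neg hd, Finset.mem_biUnion, Finset.mem_univ, true_and]
      exact ⟨i, h1⟩

/-- Only one of the k choices in each step can still lead to w, because directed walks to w are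
unique. -/
theorem endProb_le {G : SimpleGraph (Fin n)} (hG : G.IsAcyclic) {s : Config n}
    (hs : s.OrientedIn G)
    (hinj : ∀ v i j, i < s.deg v → j < s.deg v → s.nbr v i = s.nbr v j → i = j) (w : Fin n) :
    ∀ (ℓ : ℕ) (v : Fin n), endProb s k ℓ v w ≤ (k : ℝ≥0∞)⁻¹ ^ ℓ := by
  intro ℓ
  induction ℓ with
  | zero => intro v; simp only [endProb]; split_ifs <;> simp
  | succ ℓ ih =>
    intro v
    simp only [endProb]
    split_ifs with hd
    · simp
    · rw [pow_succ']
      gcongr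
      by_cases hex : ∃ i : Fin k, endProb s k ℓ (s.nbr v i) w ≠ 0
      · obtain ⟨i, hi⟩ := hex
        rw [Finset.sum_eq_single i]
        · exact ih _
        · intro j _ hji
          by_contra hj
          have hi' := i.2.trans_le (not_lt.1 hd)
          have hj' := j.2.trans_le (not_lt.1 hd)
          exact hji (Fin.ext (hinj v _ _ hj' hi' (hs.arc_unique hG (arc_cell hj') (arc_cell hi')
            (endProb_ne_zero hj).2 (endProb_ne_zero hi).2)))
        · simp
      · push Not at hex
        simp [hex]

variable [NeZero k]

theorem run_walk_succ_tick (r : ℕ) (v : Fin n) (path : List (Fin n × ℕ)) (s : Config n) (j : ℕ) :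
    (walk k (r + 1) v path).run (s.tick j) =
      if s.deg v < k then PMF.pure (some (v, path), s.tick (j + 1))
      else (PMF.uniformOfFintype (Fin k)).bind fun i =>
        (walk k r (s.nbr v i) ((v, (i : ℕ)) :: path)).run (s.tick (j + 3)) := by
  rw [run_walk_succ]
  simp only [Config.tick_tick]
  rfl

/-- The outcome of a successful walk of at most `L` steps from `v`. -/
structure Success (s : Config n) (k L : ℕ) (v : Fin n) (y : Fin n × List (Fin n × ℕ)) : Prop where
  deg_le : s.deg y.1 ≤ k
  isPath : IsPath s.nbr v y.1 y.2
  cell : ∀ e ∈ y.2, e.2 < s.deg e.1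
  full : ∀ e ∈ y.2, k ≤ s.deg e.1
  length_le : y.2.length ≤ L

/-- The elapsed time also bounds the number of arcs traversed, which later allows the flips to be
charged to the search. -/
theorem sat_walk (s : Config n) (v₀ : Fin n) : ∀ (ℓ : ℕ) (v : Fin n) (path : List (Fin n × ℕ))
    (j : ℕ), IsPath s.nbr v₀ v path → (∀ e ∈ path, e.2 < s.deg e.1) →
    (∀ e ∈ path, k ≤ s.deg e.1) →
    Sat ((walk k ℓ v path).run (s.tick j)) fun r =>
      (∃ i ≤ 3 * ℓ + 1, r.2 = s.tick (j + i) ∧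
        ∀ y, r.1 = some y → y.2.length ≤ path.length + i) ∧
      ∀ y, r.1 = some y → Success s k (path.length + ℓ) v₀ y := by
  intro ℓ
  induction ℓ with
  | zero =>
    intro v path j h1 h2 h3
    rw [run_walk_zero]
    refine sat_pure ⟨⟨1, by omega, by simp, fun y hy => ?_⟩, fun y hy => ?_⟩
    · dsimp only at hy
      split_ifs at hy
      cases hy
      simp
    dsimp only at hy
    split_ifs at hy with hd
    cases hy
    exact ⟨hd, h1, h2, h3, by simp⟩
  | succ ℓ ih =>
    intro v path j h1 h2 h3
    rw [run_walk_succ]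
    split_ifs with hd
    · refine sat_pure ⟨⟨1, by omega, by simp, fun y hy => by cases hy; simp⟩, fun y hy => ?_⟩
      cases hy
      exact ⟨le_of_lt hd, h1, h2, h3, by simp⟩
    · rw [Config.tick_deg, not_lt] at hd
      refine sat_bind (sat_true _) fun i _ => ?_
      rw [Config.tick_tick]
      refine (ih (s.nbr v i) ((v, (i : ℕ)) :: path) (j + 3) ⟨rfl, h1⟩ ?_ ?_).mono ?_
      · intro e he
        rcases List.mem_cons.1 he with rfl | he
        · exact i.2.trans_le hd
        · exact h2 e he
      · intro e he
        rcases List.mem_cons.1 he with rfl | he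
        · exact hd
        · exact h3 e he
      · rintro r ⟨⟨i', hi', hr, hlen⟩, hy⟩
        refine ⟨⟨3 + i', by omega, by rw [hr, add_assoc], fun y hry => ?_⟩, fun y hry => ?_⟩
        · have := hlen y hry
          rw [List.length_cons] at this
          omega
        have := hy y hry
        rw [List.length_cons] at this
        exact ⟨this.deg_le, this.isPath, this.cell, this.full, by have := this.length_le; omega⟩

theorem sat_walk_nil (s : Config n) (L : ℕ) (v : Fin n) (j : ℕ) :
    Sat ((walk k L v []).run (s.tick j)) fun r =>
      (∃ i ≤ 3 * L + 1, r.2 = s.tick (j + i) ∧ ∀ y, r.1 = some y → y.2.length ≤ i) ∧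
      ∀ y, r.1 = some y → Success s k L v y := by
  simpa using sat_walk (k := k) s v L v [] j rfl (by simp) (by simp)

theorem sat_search (s : Config n) (L : ℕ) (v : Fin n) : ∀ (a j : ℕ),
    Sat ((search k L a v).run (s.tick j)) fun r =>
      (∃ i ≤ a * (3 * L + 1), r.2 = s.tick (j + i) ∧ ∀ y, r.1 = some y → y.2.length ≤ i) ∧
      ∀ y, r.1 = some y → Success s k L v y := by
  intro a
  induction a with
  | zero =>
    intro j
    rw [run_search_zero]
    exact sat_pure ⟨⟨0, by omega, rfl, by simp⟩, by simp⟩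
  | succ a ih =>
    intro j
    rw [run_search_succ]
    refine sat_bind (sat_walk_nil s L v j) ?_
    rintro ⟨_ | y, s'⟩ ⟨⟨i, hi, hs, hl⟩, hy⟩
    · dsimp only at hs ⊢
      subst hs
      refine (ih (j + i)).mono ?_
      rintro r ⟨⟨i', hi', hr, hl'⟩, hry⟩
      exact ⟨⟨i + i', by rw [add_mul]; omega, by rw [hr, add_assoc],
        fun y h => (hl' y h).trans (by omega)⟩, hry⟩
    · dsimp only at hs ⊢
      exact sat_pure ⟨⟨i, by rw [add_mul]; omega, hs, hl⟩, hy⟩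

open Classical in
/-- The walk or search fails. -/
noncomputable def failInd (r : Option (Fin n × List (Fin n × ℕ)) × Config n) : ℝ≥0∞ :=
  if r.1 = none then 1 else 0

open Classical in
/-- The search ends at `w`. -/
noncomputable def endInd (w : Fin n) (r : Option (Fin n × List (Fin n × ℕ)) × Config n) : ℝ≥0∞ :=
  if ∃ path, r.1 = some (w, path) then 1 else 0

theorem expect_walk_fail (s : Config n) : ∀ (ℓ : ℕ) (v : Fin n) (path : List (Fin n × ℕ)) (j : ℕ),
    expect ((walk k ℓ v path).run (s.tick j)) failInd =
      ∑ w, endProb s k ℓ v w * if k < s.deg w then 1 else 0 := by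
  intro ℓ
  induction ℓ with
  | zero =>
    intro v path j
    rw [run_walk_zero, expect_pure]
    simp only [endProb, failInd, ite_mul, one_mul, zero_mul, Finset.sum_ite_eq, Finset.mem_univ,
      if_true, Config.tick_deg]
    by_cases h : s.deg v ≤ k
    · simp [h]
    · simp [h, not_le.1 h]
  | succ ℓ ih =>
    intro v path j
    rw [run_walk_succ_tick]
    simp only [endProb]
    split_ifs with hd
    · rw [expect_pure]; simp [failInd]
    · rw [expect_bind, expect_uniform]
      simp only [ih, mul_assoc, Finset.sum_mul]
      rw [← Finset.mul_sum, Finset.sum_comm]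

/-- A walk stops early only at out-degree below k. Ending at a vertex of out-degree exactly k thus
requires the full number of steps. -/
theorem expect_walk_end (s : Config n) (w : Fin n) (hw : s.deg w = k) :
    ∀ (ℓ : ℕ) (v : Fin n) (path : List (Fin n × ℕ)) (j : ℕ),
    expect ((walk k ℓ v path).run (s.tick j)) (endInd w) ≤ endProb s k ℓ v w := by
  intro ℓ
  induction ℓ with
  | zero =>
    intro v path j
    rw [run_walk_zero, expect_pure]
    simp only [endProb, endInd, Config.tick_deg]
    by_cases h : s.deg v ≤ k <;> by_cases hv : v = w <;> simp [h, hv]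
    all_goals split_ifs <;> simp
  | succ ℓ ih =>
    intro v path j
    rw [run_walk_succ_tick]
    simp only [endProb]
    split_ifs with hd
    · rw [expect_pure]
      have : v ≠ w := by rintro rfl; omega
      simp [endInd, this]
    · rw [expect_bind, expect_uniform]
      gcongr
      exact ih _ _ _

/-- Union bound over the attempts. Ending at a vertex of out-degree k is the only way in which a
vertex receives its secondary edge. -/
theorem expect_search_end {G : SimpleGraph (Fin n)} (hG : G.IsAcyclic) {s : Config n}
    (hs : s.OrientedIn G)
    (hinj : ∀ v i j, i < s.deg v → j < s.deg v → s.nbr v i = s.nbr v j → i = j) (w : Fin n)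
    (hw : s.deg w = k) (L : ℕ) (v : Fin n) : ∀ (a j : ℕ),
    expect ((search k L a v).run (s.tick j)) (endInd w) ≤ a * (k : ℝ≥0∞)⁻¹ ^ L := by
  intro a
  induction a with
  | zero =>
    intro j
    rw [run_search_zero, expect_pure]
    simp [endInd]
  | succ a ih =>
    intro j
    rw [run_search_succ, expect_bind]
    calc _ ≤ expect ((walk k L v []).run (s.tick j))
          (fun r => endInd w r + a * (k : ℝ≥0∞)⁻¹ ^ L) := by
          refine expect_mono_of_sat (sat_walk_nil s L v j) ?_
          rintro ⟨_ | y, s'⟩ ⟨⟨i, hi, hs, -⟩, -⟩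
          · dsimp only at hs ⊢
            rw [hs]
            exact (ih _).trans le_add_self
          · dsimp only
            rw [expect_pure]
            exact le_self_add
      _ ≤ (k : ℝ≥0∞)⁻¹ ^ L + a * (k : ℝ≥0∞)⁻¹ ^ L := by
          rw [expect_add, expect_const]
          gcongr
          exact (expect_walk_end s w hw L v [] j).trans (endProb_le hG hs hinj w L v)
      _ = _ := by push_cast; ring

theorem expect_search_fail (s : Config n) (L : ℕ) (v : Fin n) {φ : ℝ≥0∞}
    (hφ : ∀ j, expect ((walk k L v []).run (s.tick j)) failInd ≤ φ) : ∀ (a j : ℕ),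
    expect ((search k L a v).run (s.tick j)) failInd ≤ φ ^ a := by
  intro a
  induction a with
  | zero =>
    intro j
    rw [run_search_zero, expect_pure]
    simp [failInd]
  | succ a ih =>
    intro j
    rw [run_search_succ, expect_bind]
    calc _ ≤ expect ((walk k L v []).run (s.tick j)) (fun r => failInd r * φ ^ a) := by
          refine expect_mono_of_sat (sat_walk_nil s L v j) ?_
          rintro ⟨_ | y, s'⟩ ⟨⟨i, hi, hs, -⟩, -⟩
          · dsimp only at hs ⊢
            rw [hs]
            simpa [failInd] using ih (j + i)
          · dsimp only
            rw [expect_pure]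
            simp [failInd]
      _ ≤ _ := by
          rw [expect_mul_const, pow_succ']
          gcongr
          exact hφ j

/-- At most half of the walks of length `L` from `v` end at dead ends. -/
def Fine (s : Config n) (k L : ℕ) (v : Fin n) : Prop := 2 * (deadEnds s k L v).card ≤ k ^ L

/-- Each dead end has probability at most k^(-L), and there are at most k^L / 2 of them. -/
theorem Fine.expect_walk_fail_le {G : SimpleGraph (Fin n)} (hG : G.IsAcyclic) {s : Config n}
    (hs : s.OrientedIn G)
    (hinj : ∀ v i j, i < s.deg v → j < s.deg v → s.nbr v i = s.nbr v j → i = j) {L : ℕ}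
    {v : Fin n} (hf : Fine s k L v) (j : ℕ) :
    expect ((walk k L v []).run (s.tick j)) failInd ≤ 2⁻¹ := by
  have hk : (k : ℝ≥0∞) ^ L ≠ 0 := pow_ne_zero _ (Nat.cast_ne_zero.2 (NeZero.ne k))
  have hk' : (k : ℝ≥0∞) ^ L ≠ ⊤ := ENNReal.pow_ne_top (ENNReal.natCast_ne_top k)
  rw [expect_walk_fail]
  calc _ ≤ ∑ w, (if w ∈ deadEnds s k L v then (k : ℝ≥0∞)⁻¹ ^ L else 0) := by
        refine Finset.sum_le_sum fun w _ => ?_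
        by_cases h0 : endProb s k L v w = 0
        · simp [h0]
        · have := (endProb_ne_zero h0).1
          by_cases hw : k < s.deg w
          · simp only [deadEnds, Finset.mem_filter, this, hw, and_self, if_true, mul_one]
            exact endProb_le hG hs hinj w L v
          · simp [hw]
    _ = (deadEnds s k L v).card * ((k : ℝ≥0∞) ^ L)⁻¹ := by
        rw [← Finset.sum_filter, Finset.sum_const, nsmul_eq_mul, ENNReal.inv_pow]
        congr 3
        ext w; simp
    _ ≤ 2⁻¹ := by
        rw [← div_eq_mul_inv, ENNReal.div_le_iff hk hk', mul_comm, ← div_eq_mul_inv,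
          ENNReal.le_div_iff_mul_le (by simp) (by simp)]
        have : 2 * (deadEnds s k L v).card ≤ k ^ L := hf
        rw [mul_comm]
        exact_mod_cast this

/-! ### Expected duration of walks and searches -/

theorem avg_add (k : ℕ) [NeZero k] (c : ℝ≥0∞) (f : Fin k → ℝ) (hf : ∀ i, 0 ≤ f i) :
    (k : ℝ≥0∞)⁻¹ * ∑ i, (c + ENNReal.ofReal (f i)) =
      c + ENNReal.ofReal ((k : ℝ)⁻¹ * ∑ i, f i) := by
  have hk : (k : ℝ≥0∞) ≠ 0 := Nat.cast_ne_zero.2 (NeZero.ne k)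
  have hk' : (0 : ℝ) < k := Nat.cast_pos.2 (Nat.pos_of_ne_zero (NeZero.ne k))
  rw [Finset.sum_add_distrib, mul_add, Finset.sum_const, Finset.card_univ, Fintype.card_fin,
    nsmul_eq_mul, ← mul_assoc, ENNReal.inv_mul_cancel hk (ENNReal.natCast_ne_top k), one_mul,
    ENNReal.ofReal_mul (by positivity), ENNReal.ofReal_inv_of_pos hk', ENNReal.ofReal_natCast,
    ENNReal.ofReal_sum_of_nonneg fun i _ => hf i]

/-- The first m steps are charged in full. Beyond them, each route of i steps has probability at
most 2^(-i) = (3/4)^i (2/3)^i, so the rest is controlled by (2/3)^m times the growth. A step costs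
three instructions and the last vertex one. The free parameter m is chosen afterwards in terms of
the rank. -/
theorem expect_walk_clock (hk : 2 ≤ k) (s : Config n) :
    ∀ (ℓ : ℕ) (m : ℕ) (v : Fin n) (path : List (Fin n × ℕ)) (j : ℕ),
    expect ((walk k ℓ v path).run (s.tick j)) (fun r => (r.2.clock : ℝ≥0∞)) ≤
      (s.clock + j : ℕ) + ENNReal.ofReal (1 + 3 * (m + 2 * (2 / 3) ^ m * growth s ℓ v)) := by
  have hone : ∀ (ℓ m : ℕ) (v : Fin n) (j : ℕ), (((s.tick j).tick 1).clock : ℝ≥0∞) ≤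
      (s.clock + j : ℕ) + ENNReal.ofReal (1 + 3 * (m + 2 * (2 / 3) ^ m * growth s ℓ v)) := by
    intro ℓ m v j
    have : (1 : ℝ≥0∞) ≤ ENNReal.ofReal (1 + 3 * (m + 2 * (2 / 3) ^ m * growth s ℓ v)) := by
      rw [ENNReal.one_le_ofReal]
      have := growth_nonneg s ℓ v
      have : 0 ≤ 3 * (m + 2 * (2 / 3 : ℝ) ^ m * growth s ℓ v) := by positivity
      linarith
    simp only [Config.tick_clock]
    rw [Nat.cast_add (_ + _), Nat.cast_one]
    gcongr
  intro ℓ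
  induction ℓ with
  | zero =>
    intro m v path j
    rw [run_walk_zero, expect_pure]
    exact hone 0 m v j
  | succ ℓ ih =>
    intro m v path j
    rw [run_walk_succ]
    split_ifs with hd
    · rw [expect_pure]
      exact hone (ℓ + 1) m v j
    · rw [Config.tick_deg, not_lt] at hd
      rw [expect_bind, expect_uniform]
      simp only [Config.tick_tick, Config.tick_nbr]
      have hk0 : (0 : ℝ) < k := by positivity
      have hg := fun i : Fin k => growth_nonneg s ℓ (s.nbr v i)
      have hsum0 : 0 ≤ ∑ i : Fin k, growth s ℓ (s.nbr v i) := Finset.sum_nonneg fun i _ => hg i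
      have hsum : ∑ i : Fin k, growth s ℓ (s.nbr v i) ≤
          ∑ i ∈ Finset.range (s.deg v), growth s ℓ (s.nbr v i) := by
        rw [Fin.sum_univ_eq_sum_range (fun i => growth s ℓ (s.nbr v i))]
        exact Finset.sum_le_sum_of_subset_of_nonneg (Finset.range_subset_range.2 hd)
          fun _ _ _ => growth_nonneg _ _ _
      -- The weight 3/4 of a step exceeds its probability, which is at most 1/2, by the factor 3/2;
      -- this is the source of the decay 2/3.
      have havg : 1 + 3 / 2 * ((k : ℝ)⁻¹ * ∑ i : Fin k, growth s ℓ (s.nbr v i)) ≤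
          growth s (ℓ + 1) v := by
        have h2 : (k : ℝ)⁻¹ ≤ 1 / 2 := by
          rw [inv_eq_one_div]
          exact one_div_le_one_div_of_le (by norm_num) (by exact_mod_cast hk)
        simp only [growth]
        nlinarith
      have havg0 : 0 ≤ (k : ℝ)⁻¹ * ∑ i : Fin k, growth s ℓ (s.nbr v i) := by positivity
      have key : ∀ m' : ℕ, 3 + (k : ℝ)⁻¹ * ∑ i : Fin k,
            (1 + 3 * (m' + 2 * (2 / 3 : ℝ) ^ m' * growth s ℓ (s.nbr v i))) =
          4 + 3 * m' + 6 * (2 / 3) ^ m' * ((k : ℝ)⁻¹ * ∑ i : Fin k, growth s ℓ (s.nbr v i)) := by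
        intro m'
        rw [Finset.sum_add_distrib, ← Finset.mul_sum, Finset.sum_add_distrib, ← Finset.mul_sum]
        simp only [Finset.sum_const, Finset.card_univ, Fintype.card_fin, nsmul_eq_mul]
        field_simp
        ring
      have main : ∀ m' : ℕ, 4 + 3 * m' + 6 * (2 / 3 : ℝ) ^ m' *
            ((k : ℝ)⁻¹ * ∑ i : Fin k, growth s ℓ (s.nbr v i)) ≤
            1 + 3 * (m + 2 * (2 / 3) ^ m * growth s (ℓ + 1) v) →
          (k : ℝ≥0∞)⁻¹ * ∑ i : Fin k, expect ((walk k ℓ (s.nbr v i) ((v, (i : ℕ)) :: path)).run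
            (s.tick (j + 3))) (fun r => (r.2.clock : ℝ≥0∞)) ≤
          (s.clock + j : ℕ) +
            ENNReal.ofReal (1 + 3 * (m + 2 * (2 / 3) ^ m * growth s (ℓ + 1) v)) := by
        intro m' hm'
        calc _ ≤ (k : ℝ≥0∞)⁻¹ * ∑ i : Fin k, ((s.clock + (j + 3) : ℕ) +
              ENNReal.ofReal (1 + 3 * (m' + 2 * (2 / 3) ^ m' * growth s ℓ (s.nbr v i)))) := by
              gcongr with i
              exact ih m' _ _ _
          _ = (s.clock + j : ℕ) + (ENNReal.ofReal 3 + ENNReal.ofReal ((k : ℝ)⁻¹ * ∑ i : Fin k,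
              (1 + 3 * (m' + 2 * (2 / 3 : ℝ) ^ m' * growth s ℓ (s.nbr v i))))) := by
              rw [avg_add _ _ _ fun i => by have := hg i; positivity, ← add_assoc (_ : ℝ≥0∞),
                ← add_assoc s.clock]
              congr 1
              rw [Nat.cast_add (s.clock + j), ENNReal.ofReal_ofNat]
              rfl
          _ ≤ _ := by
              rw [← ENNReal.ofReal_add (by norm_num)
                (mul_nonneg (by positivity) (Finset.sum_nonneg fun i _ => by
                  have := hg i; positivity)), key]
              gcongr
      -- A step uses up one unit of m if there is one; at m = 0 the constant 2 in front of the
      -- growth absorbs its cost.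
      cases m with
      | zero =>
        apply main 0
        simp only [Nat.cast_zero, pow_zero]
        linarith
      | succ m =>
        apply main m
        rw [pow_succ]
        push_cast
        have h3 : (0 : ℝ) < (2 / 3) ^ m := by positivity
        nlinarith

theorem expect_walk_clock_le (hk : 2 ≤ k) (s : Config n) {r : ℕ} {v : Fin n} {L : ℕ}
    (h : growth s L v ≤ 20 ^ r) (j : ℕ) :
    expect ((walk k L v []).run (s.tick j)) (fun r => (r.2.clock : ℝ≥0∞)) ≤
      (s.clock + j : ℕ) + ((24 * r + 7 : ℕ) : ℝ≥0∞) := by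
  -- Eight steps per unit of rank suffice because (2/3)^8 · 20 < 1. The total is then 1 + 3 (8r +
  -- 2).
  refine (expect_walk_clock hk s L (8 * r) v [] j).trans ?_
  gcongr
  rw [← ENNReal.ofReal_natCast]
  apply ENNReal.ofReal_le_ofReal
  have h1 : (2 / 3 : ℝ) ^ (8 * r) * growth s L v ≤ 1 := by
    calc _ ≤ (2 / 3 : ℝ) ^ (8 * r) * 20 ^ r := by gcongr
      _ = ((2 / 3 : ℝ) ^ 8 * 20) ^ r := by rw [pow_mul, mul_pow]
      _ ≤ 1 := pow_le_one₀ (by positivity) (by norm_num)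
  push_cast
  nlinarith

/-- A geometric series: another attempt follows with probability at most 1/2, and M + (1/2) · 2M =
2M closes the induction for every number of attempts. -/
theorem expect_search_clock (s : Config n) (L : ℕ) (v : Fin n) {M : ℝ≥0∞}
    (hφ : ∀ j, expect ((walk k L v []).run (s.tick j)) failInd ≤ 2⁻¹)
    (hM : ∀ j, expect ((walk k L v []).run (s.tick j)) (fun r => (r.2.clock : ℝ≥0∞)) ≤
      (s.clock + j : ℕ) + M) : ∀ (a j : ℕ),
    expect ((search k L a v).run (s.tick j)) (fun r => (r.2.clock : ℝ≥0∞)) ≤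
      (s.clock + j : ℕ) + 2 * M := by
  intro a
  induction a with
  | zero =>
    intro j
    rw [run_search_zero, expect_pure]
    exact le_self_add
  | succ a ih =>
    intro j
    rw [run_search_succ, expect_bind]
    calc _ ≤ expect ((walk k L v []).run (s.tick j))
          (fun r => (r.2.clock : ℝ≥0∞) + failInd r * (2 * M)) := by
          refine expect_mono_of_sat (sat_walk_nil s L v j) ?_
          rintro ⟨_ | y, s'⟩ ⟨⟨i, hi, hs, -⟩, -⟩
          · dsimp only at hs ⊢
            rw [hs]
            simpa [failInd] using ih (j + i)
          · dsimp only
            rw [expect_pure]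
            exact le_self_add
      _ ≤ (s.clock + j : ℕ) + M + 2⁻¹ * (2 * M) := by
          rw [expect_add, expect_mul_const]
          gcongr
          · exact hM j
          · exact hφ j
      _ = _ := by
          rw [← mul_assoc, ENNReal.inv_mul_cancel (by simp) (by simp), one_mul, add_assoc, two_mul]

end Walks

/-! ### One insertion -/

section Insertion

variable {n : ℕ}

/-- Other contents of the memory of the rank trees, and another time. -/
def Config.aux (s : Config n) (par : ℕ → Option ℕ) (fresh clock : ℕ) : Config n :=
  { s with parent := par, fresh := fresh, clock := clock }

theorem growth_aux (s : Config n) (par : ℕ → Option ℕ) (fresh clock ℓ : ℕ) :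
    ∀ v, growth (s.aux par fresh clock) ℓ v = growth s ℓ v := by
  induction ℓ with
  | zero => intro v; rfl
  | succ ℓ ih =>
    intro v
    simp only [growth, ih]
    rfl

theorem ends_aux (s : Config n) (par : ℕ → Option ℕ) (fresh clock k ℓ : ℕ) :
    ∀ v, ends (s.aux par fresh clock) k ℓ v = ends s k ℓ v := by
  induction ℓ with
  | zero => intro v; rfl
  | succ ℓ ih =>
    intro v
    simp only [ends, ih]
    rfl

theorem fine_aux {s : Config n} {k L : ℕ} {v : Fin n} (h : Fine s k L v) (par : ℕ → Option ℕ)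
    (fresh clock : ℕ) : Fine (s.aux par fresh clock) k L v := by
  unfold Fine deadEnds at h ⊢
  rw [ends_aux]
  exact h

variable {G : SimpleGraph (Fin n)} {cd : Fin n → Finset (Fin n)} {k : ℕ}
  {E : Set (Sym2 (Fin n))} {U : Comps n} {s : Config n}

theorem Core.aux (h : Core G cd k E U s) (par : ℕ → Option ℕ) (fresh clock : ℕ) :
    Core G cd k E U (s.aux par fresh clock) where
  deg_le := h.deg_le
  deg_rk := h.deg_rk
  inj := h.inj
  arcs := h.arcs
  antisymm := h.antisymm
  adj := h.adj
  cls := h.cls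
  cand := h.cand
  growth_le ℓ v := by rw [growth_aux]; exact h.growth_le ℓ v

/-- The invariant of the algorithm. -/
structure State (G : SimpleGraph (Fin n)) (cd : Fin n → Finset (Fin n)) (k : ℕ)
    (E : Set (Sym2 (Fin n))) (U : Comps n) (s : Config n) : Prop where
  wf : U.Wf
  core : Core G cd k E U s
  forest : IsRankForest s.parent s.fresh U

theorem state_start (G : SimpleGraph (Fin n)) (cd : Fin n → Finset (Fin n)) (k : ℕ) :
    State G cd k ∅ (Comps.start n) (Config.init n) :=
  ⟨Comps.wf_start n, core_start G cd k, isRankForest_start n⟩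

variable [NeZero k]

/-- The insertion of an edge reduces to a search from the endpoint of smaller rank. -/
theorem State.exists_search (h : State G cd k E U s) {a b : Fin n} (hab : U.cls a ≠ U.cls b)
    (L A : ℕ) (tie : Config n → Fin n → Fin n → Bool) :
    ∃ v x par fresh c, (v = a ∧ x = b ∨ v = b ∧ x = a) ∧ U.rk v ≤ U.rk x ∧
      c ≤ 2 * U.rk v + 5 ∧ IsRankForest par fresh (U.link a b) ∧
      (insertEdge k L A tie a b).run s =
        ((search k L A v).run ((s.aux par fresh (s.clock + c)).tick 0)).map (conclude x) := by
  obtain ⟨hf, ρ, hc, hroot, hlt, hρ⟩ := h.forest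
  -- The fuel n suffices since a rank r satisfies r < 2^r ≤ n.
  have hn : min (U.rk a) (U.rk b) < n := by
    have h1 := (h.wf.card a).trans (Finset.card_le_univ _)
    rw [Fintype.card_fin] at h1
    have h2 : U.rk a < 2 ^ U.rk a := Nat.lt_two_pow_self
    omega
  obtain ⟨first, par, fresh, c, e1, e2, e3, e4, e5⟩ := combine_spec (tie s a b) n a b s _ _ _ _
    (hc a) (hc b) (hroot a) (hroot b) (hlt a) (hlt b) (fun h' => hab ((hρ _ _).1 h')) hf hn
  have hforest := IsRankForest.link h.wf hc hroot hlt hρ e5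
  cases first with
  | true =>
    have hle := e3 rfl
    refine ⟨a, b, par, fresh, c, Or.inl ⟨rfl, rfl⟩, hle, by rwa [min_eq_left hle] at e2, hforest, ?_⟩
    rw [run_insertEdge, e1, PMF.pure_bind]
    rfl
  | false =>
    have hle := e4 rfl
    refine ⟨b, a, par, fresh, c, Or.inr ⟨rfl, rfl⟩, hle, by rwa [min_eq_right hle] at e2, hforest, ?_⟩
    rw [run_insertEdge, e1, PMF.pure_bind]
    rfl

/-- A bound on the time of an insertion. -/
def insertionCost (D L A : ℕ) : ℕ := 2 * D + 5 + A * (3 * L + 1) + L + 3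

/-- The edge between `a` and `b` can be inserted next. -/
structure Insertable (G : SimpleGraph (Fin n)) (cd : Fin n → Finset (Fin n)) (U : Comps n)
    (a b : Fin n) : Prop where
  adj : G.Adj a b
  ne : U.cls a ≠ U.cls b
  hop : ∀ p, eventHop G U a b p ⊆ cd p

theorem State.sat_insertEdge (hG : G.IsAcyclic) (h : State G cd k E U s) {a b : Fin n}
    (hab : Insertable G cd U a b) (L A : ℕ) (tie : Config n → Fin n → Fin n → Bool) :
    Sat ((insertEdge k L A tie a b).run s) fun y =>
      (s.clock ≤ y.2.clock ∧ y.2.clock ≤ s.clock + insertionCost (Nat.log 2 n) L A) ∧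
      (y.1 = true → State G cd k (insert s(a, b) E) (U.link a b) y.2 ∧
        flips s y.2 ≤ if k ≤ Nat.log 2 n then L else 0) := by
  obtain ⟨v, x, par, fresh, c, hvx, hrk, hc, hforest, hrun⟩ := h.exists_search hab.ne L A tie
  have hD := h.wf.rk_le v
  rw [hrun, ← PMF.bind_pure_comp]
  refine sat_bind (sat_search (s.aux par fresh (s.clock + c)) L v A 0) ?_
  rintro ⟨res, s₂⟩ ⟨⟨i, hi, hs₂, -⟩, hy⟩
  dsimp only at hs₂ hy
  rw [zero_add] at hs₂
  subst hs₂
  rcases res with _ | ⟨u, path⟩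
  · refine sat_pure ⟨⟨?_, ?_⟩, by simp [conclude]⟩
    · simp [conclude, Config.aux, add_assoc]
    · simp only [conclude, Config.tick_clock, Config.aux, insertionCost]
      omega
  · have hsucc := hy _ rfl
    have hlen := hsucc.length_le
    dsimp only at hlen
    refine sat_pure ⟨⟨?_, ?_⟩, fun _ => ?_⟩
    · simp [conclude, finish, Config.aux, add_assoc]
    · simp only [conclude, finish, Config.tick_clock, Config.aux, insertionCost]
      omega
    · have hcore : Core G cd k E U
          ((s.aux par fresh (s.clock + c)).tick i) := h.core.aux par fresh (s.clock + c + i)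
      have hf := hcore.found hsucc.isPath hsucc.cell
      have hadj : G.Adj v x ∧ U.cls v ≠ U.cls x ∧ (U.link a b).cls v = (U.link a b).cls x ∧
          s(v, x) = s(a, b) ∧
          (∀ p, U.cls p = U.cls v → (U.link a b).rk p = newRk (U.rk v) (U.rk x)) ∧
          ∀ p, U.cls p = U.cls v → hop G p x ⊆ cd p := by
        rcases hvx with ⟨rfl, rfl⟩ | ⟨rfl, rfl⟩
        · refine ⟨hab.adj, hab.ne, by simp [Comps.link], rfl, fun p hp => by simp [Comps.link, hp],
            fun p hp => ?_⟩
          have := hab.hop p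
          rwa [eventHop, if_pos ⟨hp, hrk⟩] at this
        · refine ⟨hab.adj.symm, hab.ne.symm, by simp [Comps.link], Sym2.eq_swap,
            fun p hp => by simp [Comps.link, hp, newRk_comm], fun p hp => ?_⟩
          have := hab.hop p
          rwa [eventHop, if_neg (fun h' => hab.ne (h'.1.symm.trans hp)),
            if_pos ⟨hp, hrk⟩] at this
      obtain ⟨h1, h2, h3, h4, h5, h6⟩ := hadj
      refine ⟨⟨h.wf.link hab.ne, ?_, hforest⟩, ?_⟩
      · rw [← h4]
        refine hcore.finish hG h.wf hsucc.isPath hsucc.cell hsucc.deg_le h1 h2 hrk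
          (fun p q hpq => ?_) h3 (fun p => U.rk_le_link h.wf a b p) h5 h6
        simp only [Comps.link, hpq]
      · have hx : ¬ ((s.aux par fresh (s.clock + c)).tick i).Arc x v := fun ha =>
          h2 (hcore.cls_arc ha).symm
        have hfl := flips_finish_le (x := x) hG hf hx
        split_ifs with hk
        · exact hfl.trans hlen
        -- If k exceeds the largest possible rank, no vertex has k out-going edges, so no walk takes
        -- a step. This case matters because log_k log n may then be far below 1, whereas the
        -- rounded walk length may still be 1.
        · refine hfl.trans ?_
          rw [Nat.le_zero, List.length_eq_zero_iff]
          by_contra hne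
          obtain ⟨e, he⟩ := List.exists_mem_of_ne_nil _ hne
          have e1 : k ≤ s.deg e.1 := hsucc.full e he
          have e2 := h.core.deg_rk e.1
          have e3 := h.wf.rk_le e.1
          omega

theorem State.expect_insertEdge_fail (hG : G.IsAcyclic) (h : State G cd k E U s) {a b : Fin n}
    (hab : Insertable G cd U a b) {L : ℕ} (A : ℕ) (tie : Config n → Fin n → Fin n → Bool)
    (ha : Fine s k L a) (hb : Fine s k L b) :
    expect ((insertEdge k L A tie a b).run s) (fun y => if y.1 then 0 else 1) ≤ 2⁻¹ ^ A := by
  obtain ⟨v, x, par, fresh, c, hvx, hrk, hc, hforest, hrun⟩ := h.exists_search hab.ne L A tie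
  rw [hrun, expect_map]
  have hcore := h.core.aux par fresh (s.clock + c)
  have hv : Fine s k L v := by rcases hvx with ⟨rfl, -⟩ | ⟨rfl, -⟩ <;> assumption
  refine le_trans (expect_mono fun r => ?_) (expect_search_fail (s.aux par fresh (s.clock + c)) L v
    ((fine_aux hv par fresh (s.clock + c)).expect_walk_fail_le hG hcore.orientedIn hcore.inj) A 0)
  rcases r with ⟨_ | y, s'⟩ <;> simp [conclude, failInd]

/-- With r the smaller rank, combining costs at most 2r + 5, the search 2(24r + 7) in expectation,
and the flips at most as much as the search plus 3. The total is at most 98r + 36. -/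
theorem State.expect_insertEdge_clock (hG : G.IsAcyclic) (h : State G cd k E U s) {a b : Fin n}
    (hab : Insertable G cd U a b) {L : ℕ} (A : ℕ) (tie : Config n → Fin n → Fin n → Bool)
    (hk : 2 ≤ k) (ha : Fine s k L a) (hb : Fine s k L b) :
    expect ((insertEdge k L A tie a b).run s) (fun y => (y.2.clock : ℝ≥0∞)) ≤
      s.clock + (98 * (min (U.rk a) (U.rk b) + 1) : ℕ) := by
  obtain ⟨v, x, par, fresh, c, hvx, hrk, hc, hforest, hrun⟩ := h.exists_search hab.ne L A tie
  have hmin : U.rk v = min (U.rk a) (U.rk b) := by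
    rcases hvx with ⟨rfl, rfl⟩ | ⟨rfl, rfl⟩ <;> omega
  rw [hrun, expect_map, ← hmin]
  have hcore := h.core.aux par fresh (s.clock + c)
  have hv : Fine s k L v := by rcases hvx with ⟨rfl, -⟩ | ⟨rfl, -⟩ <;> assumption
  have hsearch := expect_search_clock (s.aux par fresh (s.clock + c)) L v
    ((fine_aux hv par fresh (s.clock + c)).expect_walk_fail_le hG hcore.orientedIn hcore.inj)
    (expect_walk_clock_le hk _ (hcore.growth_le L v)) A 0
  -- The path is no longer than the duration of the search, so the flips at most double it. The
  -- starting time is added on the left to avoid a subtraction.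
  have key : expect ((search k L A v).run ((s.aux par fresh (s.clock + c)).tick 0))
      (fun r => ((conclude x r).2.clock : ℝ≥0∞)) + (s.clock + c : ℕ) ≤
      2 * ((s.clock + c : ℕ) + 2 * ((24 * U.rk v + 7 : ℕ) : ℝ≥0∞)) + 3 := by
    rw [← expect_const ((search k L A v).run ((s.aux par fresh (s.clock + c)).tick 0))
      ((s.clock + c : ℕ) : ℝ≥0∞), ← expect_add]
    refine le_trans (expect_mono_of_sat (G := fun r => 2 * (r.2.clock : ℝ≥0∞) + 3)
      (sat_search (s.aux par fresh (s.clock + c)) L v A 0) ?_) ?_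
    · rintro ⟨res, s₂⟩ ⟨⟨i, -, hs₂, hlen⟩, -⟩
      dsimp only at hs₂ hlen
      subst hs₂
      have : (conclude x (res, (s.aux par fresh (s.clock + c)).tick (0 + i))).2.clock +
          (s.clock + c) ≤ 2 * ((s.aux par fresh (s.clock + c)).tick (0 + i)).clock + 3 := by
        rcases res with _ | y
        · simp only [conclude, Config.tick_clock, Config.aux]
          omega
        · have := hlen y rfl
          simp only [conclude, finish, Config.tick_clock, Config.aux]
          omega
      exact_mod_cast this
    · rw [expect_add, expect_const_mul, expect_const, expect_const]
      gcongr
      exact hsearch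
  have hfin : ((s.clock + c : ℕ) : ℝ≥0∞) ≠ ⊤ := ENNReal.natCast_ne_top _
  refine (ENNReal.add_le_add_iff_right hfin).1 (key.trans ?_)
  have : 2 * ((s.clock + c) + 2 * (24 * U.rk v + 7)) + 3 ≤
      s.clock + 98 * (U.rk v + 1) + (s.clock + c) := by omega
  exact_mod_cast this

/-- The left side consists of the terms of degree at most one in g of the expanded product. These
are the only ones that occur, as one insertion creates at most one secondary edge. -/
theorem prod_add_sum_le {ι : Type*} [DecidableEq ι] (W : Finset ι) (f g : ι → ℝ≥0∞) :
    ∏ w ∈ W, f w + ∑ w ∈ W, g w * ∏ w' ∈ W.erase w, f w' ≤ ∏ w ∈ W, (f w + g w) := by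
  induction W using Finset.induction_on with
  | empty => simp
  | insert i W hi ih =>
    rw [Finset.prod_insert hi, Finset.prod_insert hi, Finset.sum_insert hi,
      Finset.erase_insert hi]
    have hsum : ∑ w ∈ W, g w * ∏ w' ∈ (insert i W).erase w, f w' =
        f i * ∑ w ∈ W, g w * ∏ w' ∈ W.erase w, f w' := by
      rw [Finset.mul_sum]
      refine Finset.sum_congr rfl fun w hw => ?_
      have hwi : i ≠ w := by rintro rfl; exact hi hw
      rw [Finset.erase_insert_of_ne hwi,
        Finset.prod_insert fun h => hi (Finset.mem_of_mem_erase h)]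
      ring
    rw [hsum]
    calc _ = f i * (∏ w ∈ W, f w + ∑ w ∈ W, g w * ∏ w' ∈ W.erase w, f w') +
          g i * ∏ w ∈ W, f w := by ring
      _ ≤ f i * ∏ w ∈ W, (f w + g w) + g i * ∏ w ∈ W, (f w + g w) := by
          gcongr
          exact le_self_add
      _ = _ := by ring

/-- `1` if `w` has a secondary edge. -/
noncomputable def secondary (k : ℕ) (s : Config n) (w : Fin n) : ℝ≥0∞ :=
  if k < s.deg w then 1 else 0

/-- A bound on the probability that all vertices of `W` get a secondary edge. -/
noncomputable def risk (k : ℕ) (q : ℝ≥0∞) (U : Comps n) (s : Config n) (W : Finset (Fin n)) :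
    ℝ≥0∞ :=
  ∏ w ∈ W, (secondary k s w + q * (Nat.log 2 n - U.rk w : ℕ))

/-- A vertex w of the searched component receives a secondary edge with probability at most q. At
the same time its rank grows, so its term q (D - rank) gives up at least q, which compensates for
this. Factors of different vertices are not independent, but at most one indicator changes per
insertion, so linearity of expectation suffices. -/
theorem State.expect_insertEdge_risk (hG : G.IsAcyclic) (h : State G cd k E U s) {a b : Fin n}
    (hab : Insertable G cd U a b) (L A : ℕ) (tie : Config n → Fin n → Fin n → Bool)
    (W : Finset (Fin n)) :
    expect ((insertEdge k L A tie a b).run s) (fun y => if y.1 then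
      risk k (A * (k : ℝ≥0∞)⁻¹ ^ L) (U.link a b) y.2 W else 0) ≤
      risk k (A * (k : ℝ≥0∞)⁻¹ ^ L) U s W := by
  obtain ⟨v, x, par, fresh, c, hvx, hrk, hc, hforest, hrun⟩ := h.exists_search hab.ne L A tie
  rw [hrun, expect_map]
  have hcore := h.core.aux par fresh (s.clock + c)
  set q : ℝ≥0∞ := A * (k : ℝ≥0∞)⁻¹ ^ L with hq
  set f : Fin n → ℝ≥0∞ := fun w => secondary k s w + q * (Nat.log 2 n - (U.link a b).rk w : ℕ)
    with hf
  set S : Fin n → Prop := fun w => s.deg w = k ∧ U.cls w = U.cls v with hS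
  classical
  have hpt : expect ((search k L A v).run ((s.aux par fresh (s.clock + c)).tick 0))
      (fun r => if (conclude x r).1 then risk k q (U.link a b) (conclude x r).2 W else 0) ≤
      expect ((search k L A v).run ((s.aux par fresh (s.clock + c)).tick 0))
      (fun r => ∏ w ∈ W, f w +
        ∑ w ∈ W, (if S w then endInd w r else 0) * ∏ w' ∈ W.erase w, f w') := by
    refine expect_mono_of_sat (sat_search (s.aux par fresh (s.clock + c)) L v A 0) ?_
    rintro ⟨res, s₂⟩ ⟨⟨i, -, hs₂, -⟩, hy⟩
    dsimp only at hs₂ hy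
    subst hs₂
    rcases res with _ | ⟨u, path⟩
    · simp [conclude]
    · have hsucc := hy _ rfl
      have hreach := (IsPath.reach hsucc.cell hsucc.isPath).1
      have hcu : U.cls u = U.cls v := (hcore.cls_reach hreach).symm
      simp only [conclude, if_true]
      have hsec : ∀ w, secondary k
          (finish ((s.aux par fresh (s.clock + c)).tick (0 + i)) x u path) w ≤
          secondary k s w + if w = u ∧ s.deg w = k then 1 else 0 := by
        intro w
        have hdeg : (finish ((s.aux par fresh (s.clock + c)).tick (0 + i)) x u path).deg w =
            if w = u then s.deg u + 1 else s.deg w := Function.update_apply _ _ _ _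
        have hdu : s.deg u ≤ k := hsucc.deg_le
        simp only [secondary, hdeg]
        by_cases hwu : w = u
        · subst hwu
          by_cases hk : s.deg w = k
          · simp [hk]
          · have : ¬ k < s.deg w + 1 := by omega
            simp [this]
        · simp [hwu]
      -- Unless the search ends at a vertex of W with exactly k out-going edges, no indicator in the
      -- product changes.
      by_cases hu : u ∈ W ∧ s.deg u = k
      · calc _ ≤ ∏ w ∈ W, (f w + if w = u then 1 else 0) := by
              refine Finset.prod_le_prod' fun w _ => ?_
              have := hsec w
              have h2 : (if w = u ∧ s.deg w = k then (1 : ℝ≥0∞) else 0) ≤ if w = u then 1 else 0 := by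
                split_ifs <;> simp_all
              calc _ ≤ (secondary k s w + if w = u ∧ s.deg w = k then 1 else 0) +
                    q * (Nat.log 2 n - (U.link a b).rk w : ℕ) := by gcongr
                _ ≤ (secondary k s w + if w = u then 1 else 0) +
                    q * (Nat.log 2 n - (U.link a b).rk w : ℕ) := by gcongr
                _ = _ := by rw [hf]; ring
          _ = ∏ w ∈ W, f w + ∏ w' ∈ W.erase u, f w' := by
              rw [← Finset.mul_prod_erase _ _ hu.1, ← Finset.mul_prod_erase _ f hu.1, if_pos rfl,
                add_mul, one_mul]
              have : ∏ w ∈ W.erase u, (f w + if w = u then 1 else 0) = ∏ w ∈ W.erase u, f w :=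
                Finset.prod_congr rfl fun w hw => by
                  rw [if_neg (Finset.ne_of_mem_erase hw), add_zero]
              rw [this]
          _ ≤ _ := by
              gcongr
              have hSu : S u := ⟨hu.2, hcu⟩
              have : (if S u then endInd u (some (u, path),
                  (s.aux par fresh (s.clock + c)).tick (0 + i)) else 0) *
                  ∏ w' ∈ W.erase u, f w' = ∏ w' ∈ W.erase u, f w' := by
                simp [hSu, endInd]
              rw [← this]
              exact Finset.single_le_sum (f := fun w => (if S w then endInd w (some (u, path),
                (s.aux par fresh (s.clock + c)).tick (0 + i)) else 0) *
                  ∏ w' ∈ W.erase w, f w') (fun _ _ => zero_le) hu.1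
      · refine le_trans ?_ le_self_add
        refine Finset.prod_le_prod' fun w hw => ?_
        have := hsec w
        rw [if_neg (by rintro ⟨rfl, h2⟩; exact hu ⟨hw, h2⟩), add_zero] at this
        exact add_le_add this le_rfl
  refine hpt.trans ?_
  rw [expect_add, expect_const, expect_finset_sum]
  calc _ ≤ ∏ w ∈ W, f w + ∑ w ∈ W, (if S w then q else 0) * ∏ w' ∈ W.erase w, f w' := by
        gcongr with w hw
        rw [expect_mul_const]
        gcongr
        split_ifs with hSw
        · exact expect_search_end hG hcore.orientedIn hcore.inj w hSw.1 L v A 0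
        · rw [expect_const]
    _ ≤ ∏ w ∈ W, (f w + if S w then q else 0) := prod_add_sum_le _ _ _
    _ ≤ _ := by
        refine Finset.prod_le_prod' fun w _ => ?_
        have hrk' := U.rk_le_link h.wf a b w
        have hD := (h.wf.link hab.ne).rk_le w
        rw [hf]
        split_ifs with hSw
        · have hlt : U.rk w < (U.link a b).rk w := by
            rcases hvx with ⟨rfl, rfl⟩ | ⟨rfl, rfl⟩
            · exact U.rk_lt_link_left h.wf hSw.2 hrk
            · exact U.rk_lt_link_right h.wf hSw.2 hrk
          rw [add_assoc]
          gcongr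
          have : ((Nat.log 2 n - (U.link a b).rk w : ℕ) : ℝ≥0∞) + 1 ≤
              (Nat.log 2 n - U.rk w : ℕ) := by
            have : (Nat.log 2 n - (U.link a b).rk w) + 1 ≤ Nat.log 2 n - U.rk w := by omega
            exact_mod_cast this
          calc _ = q * (((Nat.log 2 n - (U.link a b).rk w : ℕ) : ℝ≥0∞) + 1) := by ring
            _ ≤ _ := by gcongr
        · rw [add_zero]
          dsimp only
          gcongr

end Insertion

/-! ### The possible sets of dead ends -/

section Families

variable {n : ℕ}

/-- All sets that can consist of the dead ends of the walks of length `ℓ` from a vertex, when the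
heads of arcs are chosen among the candidates. -/
noncomputable def families (cd : Fin n → Finset (Fin n)) (k : ℕ) :
    ℕ → Fin n → Finset (Finset (Fin n))
  | 0, v => {∅, {v}}
  | ℓ + 1, v => insert ∅
      ((Fintype.piFinset fun _ : Fin k => (cd v).biUnion (families cd k ℓ)).image
        fun φ => Finset.univ.biUnion φ)

/-- The walks either stop at v, whence the empty set in the definition, or continue over k primary
edges, whose heads are candidates. -/
theorem deadEnds_mem_families {cd : Fin n → Finset (Fin n)} {k : ℕ} {s : Config n}
    (h : ∀ u v, s.Arc u v → v ∈ cd u) : ∀ (ℓ : ℕ) (v : Fin n),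
    deadEnds s k ℓ v ∈ families cd k ℓ v := by
  intro ℓ
  induction ℓ with
  | zero =>
    intro v
    simp only [deadEnds, ends, families, Finset.filter_singleton]
    split_ifs <;> simp
  | succ ℓ ih =>
    intro v
    simp only [families, Finset.mem_insert, Finset.mem_image, Fintype.mem_piFinset]
    by_cases hd : s.deg v < k
    · left
      simp [deadEnds, ends, hd]
    · right
      refine ⟨fun i => deadEnds s k ℓ (s.nbr v i), fun i => ?_, ?_⟩
      · exact Finset.mem_biUnion.2
          ⟨_, h _ _ (arc_cell (i.2.trans_le (not_lt.1 hd))), ih _⟩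
      · simp only [deadEnds, ends, if_neg hd, Finset.filter_biUnion]

/-- The recursion is f ↦ 1 + (D f)^k ≤ (2 D f)^k. Multiplied by (2D)² ≤ (2D)^k it becomes F ↦ F^k
for F = (2D)² f, with F ≤ 8 D² at length 0. -/
theorem card_families {cd : Fin n → Finset (Fin n)} {k D : ℕ} (hk : 2 ≤ k) (hD : 1 ≤ D)
    (hcd : ∀ v, (cd v).card ≤ D) : ∀ (ℓ : ℕ) (v : Fin n),
    (2 * D) ^ 2 * (families cd k ℓ v).card ≤ (8 * D ^ 2) ^ k ^ ℓ := by
  intro ℓ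
  induction ℓ with
  | zero =>
    intro v
    have : (families cd k 0 v).card ≤ 2 := Finset.card_le_two
    simp only [pow_zero, pow_one]
    rw [mul_pow]
    nlinarith [pow_pos (show 0 < D from hD) 2]
  | succ ℓ ih =>
    intro v
    have hpos : 0 < (2 * D) ^ 2 := by positivity
    set M := (8 * D ^ 2) ^ k ^ ℓ / (2 * D) ^ 2 with hM
    have hcard : ∀ u, (families cd k ℓ u).card ≤ M := fun u => by
      rw [hM, Nat.le_div_iff_mul_le hpos, mul_comm]
      exact ih u
    have hM1 : 1 ≤ M := by
      rw [hM, Nat.le_div_iff_mul_le hpos, one_mul]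
      calc (2 * D) ^ 2 ≤ 8 * D ^ 2 := by rw [mul_pow]; omega
        _ ≤ _ := Nat.le_self_pow (pow_ne_zero _ (by omega)) _
    have hT : ((cd v).biUnion (families cd k ℓ)).card ≤ D * M :=
      Finset.card_biUnion_le.trans ((Finset.sum_le_card_nsmul _ _ M fun u _ => hcard u).trans
        (by rw [smul_eq_mul]; gcongr; exact hcd v))
    have hfam : (families cd k (ℓ + 1) v).card ≤ 1 + (D * M) ^ k := by
      simp only [families]
      refine (Finset.card_insert_le _ _).trans ?_
      rw [add_comm]
      gcongr
      refine Finset.card_image_le.trans ?_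
      rw [Fintype.card_piFinset, Finset.prod_const, Finset.card_univ, Fintype.card_fin]
      gcongr
    have hpow : 1 + (D * M) ^ k ≤ (2 * D * M) ^ k := by
      have h1 : 1 ≤ (D * M) ^ k := Nat.one_le_pow _ _ (by positivity)
      have h2 : 2 ≤ 2 ^ k := Nat.le_self_pow (by omega) 2
      rw [mul_assoc, mul_pow 2]
      nlinarith
    calc (2 * D) ^ 2 * (families cd k (ℓ + 1) v).card
        ≤ (2 * D) ^ k * (2 * D * M) ^ k := by
          gcongr
          · omega
          · exact hfam.trans hpow
      _ = ((2 * D) ^ 2 * M) ^ k := by rw [← mul_pow]; ring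
      _ ≤ ((8 * D ^ 2) ^ k ^ ℓ) ^ k := by
          gcongr
          exact Nat.mul_div_le _ _
      _ = _ := by rw [← pow_mul, ← pow_succ]

/-- The members of `families` with more than half the elements of a full set of ends. -/
noncomputable def manyDead (cd : Fin n → Finset (Fin n)) (k L : ℕ) (v : Fin n) :
    Finset (Finset (Fin n)) :=
  (families cd k L v).filter fun W => k ^ L < 2 * W.card

theorem mem_manyDead {cd : Fin n → Finset (Fin n)} {k L : ℕ} {v : Fin n} {W : Finset (Fin n)} :
    W ∈ manyDead cd k L v ↔ W ∈ families cd k L v ∧ k ^ L < 2 * W.card :=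
  Finset.mem_filter

theorem card_manyDead_le (cd : Fin n → Finset (Fin n)) (k L : ℕ) (v : Fin n) :
    (manyDead cd k L v).card ≤ (families cd k L v).card := Finset.card_filter_le _ _

/-- A bound on the probability that the walks from some vertex ever have many dead ends. -/
noncomputable def totalRisk (cd : Fin n → Finset (Fin n)) (k L : ℕ) (q : ℝ≥0∞) (U : Comps n)
    (s : Config n) : ℝ≥0∞ :=
  ∑ v, ∑ W ∈ manyDead cd k L v, risk k q U s W

/-- The actual set of dead ends is one of the sets in the sum, and every factor of its product is at
least 1. -/
theorem one_le_totalRisk {cd : Fin n → Finset (Fin n)} {k L : ℕ} {q : ℝ≥0∞} {U : Comps n}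
    {s : Config n} (h : ∀ u v, s.Arc u v → v ∈ cd u) {v : Fin n} (hv : ¬ Fine s k L v) :
    1 ≤ totalRisk cd k L q U s := by
  have hmem : deadEnds s k L v ∈ manyDead cd k L v :=
    mem_manyDead.2 ⟨deadEnds_mem_families h L v, not_le.1 hv⟩
  have h1 : 1 ≤ risk k q U s (deadEnds s k L v) := by
    refine Finset.one_le_prod' fun w hw => ?_
    have : k < s.deg w := (Finset.mem_filter.1 hw).2
    simp [secondary, this]
  have h2 : risk k q U s (deadEnds s k L v) ≤
      ∑ W ∈ manyDead cd k L v, risk k q U s W :=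
    Finset.single_le_sum_of_canonicallyOrdered hmem
  have h3 : ∑ W ∈ manyDead cd k L v, risk k q U s W ≤
      totalRisk cd k L q U s := by
    unfold totalRisk
    exact Finset.single_le_sum_of_canonicallyOrdered (f := fun v =>
      ∑ W ∈ manyDead cd k L v, risk k q U s W)
      (Finset.mem_univ v)
  exact h1.trans (h2.trans h3)

/-- The union bound. Since 2|W| exceeds k^L, the number (8D²)^(k^L) of sets is at most (8D²)^(2|W|),
and the hypothesis on q makes its product with (qD)^|W| at most 4^(-|W|). -/
theorem totalRisk_start {cd : Fin n → Finset (Fin n)} {k L : ℕ} {q : ℝ≥0∞} (hk : 2 ≤ k)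
    (hD : 1 ≤ Nat.log 2 n) (hcd : ∀ v, (cd v).card ≤ Nat.log 2 n)
    (hq : (8 * (Nat.log 2 n : ℝ≥0∞) ^ 2) ^ 2 * (q * Nat.log 2 n) ≤ 2⁻¹ ^ 2) :
    totalRisk cd k L q (Comps.start n) (Config.init n) ≤ n * 2⁻¹ ^ k ^ L := by
  set D := Nat.log 2 n with hDdef
  have hD' : (1 : ℝ≥0∞) ≤ 8 * (D : ℝ≥0∞) ^ 2 := by
    have : 1 ≤ 8 * D ^ 2 := by nlinarith
    exact_mod_cast this
  have hv : ∀ v, ∑ W ∈ manyDead cd k L v,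
      risk k q (Comps.start n) (Config.init n) W ≤ 2⁻¹ ^ k ^ L := by
    intro v
    have hW : ∀ W : Finset (Fin n), k ^ L < 2 * W.card →
        (8 * (D : ℝ≥0∞) ^ 2) ^ k ^ L * risk k q (Comps.start n) (Config.init n) W ≤
          2⁻¹ ^ k ^ L := by
      intro W hW
      have hrisk : risk k q (Comps.start n) (Config.init n) W = (q * D) ^ W.card := by
        simp [risk, secondary, Config.init, Comps.start, hDdef]
      rw [hrisk]
      calc _ ≤ (8 * (D : ℝ≥0∞) ^ 2) ^ (2 * W.card) * (q * D) ^ W.card := by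
            gcongr
        _ = ((8 * (D : ℝ≥0∞) ^ 2) ^ 2 * (q * D)) ^ W.card := by
            rw [pow_mul, ← mul_pow]
        _ ≤ (2⁻¹ ^ 2) ^ W.card := by gcongr
        _ = 2⁻¹ ^ (2 * W.card) := by rw [pow_mul]
        _ ≤ _ := pow_le_pow_of_le_one (by simp) (by simp) hW.le
    have hne : (8 * (D : ℝ≥0∞) ^ 2) ^ k ^ L ≠ 0 :=
      pow_ne_zero _ (one_pos.trans_le hD').ne'
    have hnt : (8 * (D : ℝ≥0∞) ^ 2) ^ k ^ L ≠ ⊤ := by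
      have : ((8 * D ^ 2 : ℕ) : ℝ≥0∞) ^ k ^ L ≠ ⊤ :=
        ENNReal.pow_ne_top (ENNReal.natCast_ne_top _)
      push_cast at this
      exact this
    calc _ ≤ ∑ W ∈ manyDead cd k L v,
          2⁻¹ ^ k ^ L / (8 * (D : ℝ≥0∞) ^ 2) ^ k ^ L := by
          refine Finset.sum_le_sum fun W hWm => ?_
          rw [ENNReal.le_div_iff_mul_le (Or.inl hne) (Or.inl hnt), mul_comm]
          exact hW W (mem_manyDead.1 hWm).2
      _ ≤ (8 * (D : ℝ≥0∞) ^ 2) ^ k ^ L * (2⁻¹ ^ k ^ L / (8 * (D : ℝ≥0∞) ^ 2) ^ k ^ L) := by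
          rw [Finset.sum_const, nsmul_eq_mul]
          gcongr
          have h1 := card_families hk hD hcd L v
          have h2 : (manyDead cd k L v).card ≤
              (8 * D ^ 2) ^ k ^ L := by
            refine (card_manyDead_le cd k L v).trans (le_trans ?_ h1)
            exact Nat.le_mul_of_pos_left _ (by positivity)
          exact_mod_cast h2
      _ = _ := ENNReal.mul_div_cancel hne hnt
  refine (Finset.sum_le_sum fun v _ => hv v).trans ?_
  simp

end Families

/-! ### The whole run -/

section Run

variable {n : ℕ} {G : SimpleGraph (Fin n)} {cd : Fin n → Finset (Fin n)}

/-- The edges of the list can be inserted one after the other. -/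
def Ready (G : SimpleGraph (Fin n)) (cd : Fin n → Finset (Fin n)) :
    Comps n → List (Fin n × Fin n) → Prop
  | _, [] => True
  | U, e :: es => Insertable G cd U e.1 e.2 ∧ Ready G cd (U.link e.1 e.2) es

theorem ready_of_merges : ∀ (es : List (Fin n × Fin n)) (U : Comps n), Merges U es →
    (∀ e ∈ es, G.Adj e.1 e.2) → (∀ p, cand G es U p ⊆ cd p) → Ready G cd U es := by
  intro es
  induction es with
  | nil => intros; trivial
  | cons e es ih =>
    intro U hm hadj hcd
    refine ⟨⟨hadj e (by simp), hm.1, fun p => Finset.subset_union_left.trans (hcd p)⟩,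
      ih _ hm.2 (fun e' he' => hadj e' (by simp [he'])) fun p =>
        Finset.subset_union_right.trans (hcd p)⟩

theorem edgeSet_cons (e : Fin n × Fin n) (es : List (Fin n × Fin n)) :
    edgeSet (e :: es) = insert s(e.1, e.2) (edgeSet es) := by
  ext z
  simp [edgeSet]

theorem edgeSet_nil : edgeSet ([] : List (Fin n × Fin n)) = ∅ := by
  ext z
  simp [edgeSet]

theorem edgeSet_append (es es' : List (Fin n × Fin n)) :
    edgeSet (es ++ es') = edgeSet es ∪ edgeSet es' := by
  ext z
  simp [edgeSet, or_and_right, exists_or]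

/-- If the ends of the next edge were in one class, the earlier edges would connect them; but in a
forest every edge is a bridge, and the edge itself does not occur earlier. -/
theorem merges_of_acyclic : ∀ (es pre : List (Fin n × Fin n)) (U : Comps n),
    (SimpleGraph.fromEdgeSet (edgeSet (pre ++ es))).IsAcyclic →
    ((pre ++ es).map fun e => s(e.1, e.2)).Nodup → (∀ e ∈ es, e.1 ≠ e.2) →
    (∀ u v, U.cls u = U.cls v → (SimpleGraph.fromEdgeSet (edgeSet pre)).Reachable u v) →
    Merges U es := by
  intro es
  induction es with
  | nil => intros; trivial
  | cons e es ih =>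
    intro pre U hac hnd hne hU
    have hadj : (SimpleGraph.fromEdgeSet (edgeSet (pre ++ e :: es))).Adj e.1 e.2 := by
      rw [SimpleGraph.fromEdgeSet_adj]
      exact ⟨⟨e, by simp, rfl⟩, hne e (by simp)⟩
    refine ⟨fun hcls => ?_, ih (pre ++ [e]) _ ?_ ?_ (fun e' he' => hne e' (by simp [he'])) ?_⟩
    · have hb := SimpleGraph.isAcyclic_iff_forall_adj_isBridge.1 hac hadj
      rw [SimpleGraph.isBridge_iff] at hb
      refine hb ((hU _ _ hcls).mono fun x y hxy => ?_)
      rw [SimpleGraph.fromEdgeSet_adj] at hxy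
      rw [SimpleGraph.deleteEdges_adj, SimpleGraph.fromEdgeSet_adj]
      obtain ⟨⟨f, hf, hfe⟩, hxy⟩ := hxy
      refine ⟨⟨⟨f, by simp [hf], hfe⟩, hxy⟩, fun hmem => ?_⟩
      rw [Set.mem_singleton_iff] at hmem
      rw [List.map_append, List.nodup_append] at hnd
      exact hnd.2.2 _ (List.mem_map_of_mem hf) s(e.1, e.2) (by simp) (hfe.symm.trans hmem)
    · simpa using hac
    · simpa using hnd
    · have hmono : ∀ {x y}, (SimpleGraph.fromEdgeSet (edgeSet pre)).Reachable x y →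
          (SimpleGraph.fromEdgeSet (edgeSet (pre ++ [e]))).Reachable x y := fun h =>
        h.mono (SimpleGraph.fromEdgeSet_mono (by
          rw [edgeSet_append]; exact Set.subset_union_left))
      have he : (SimpleGraph.fromEdgeSet (edgeSet (pre ++ [e]))).Reachable e.1 e.2 := by
        apply SimpleGraph.Adj.reachable
        rw [SimpleGraph.fromEdgeSet_adj]
        exact ⟨⟨e, by simp, rfl⟩, hne e (by simp)⟩
      intro u v huv
      simp only [Comps.link] at huv
      split_ifs at huv with h1 h2 h2
      · exact hmono (hU _ _ (h1.trans h2.symm))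
      · exact (hmono (hU _ _ h1)).trans (he.trans (hmono (hU _ _ huv)))
      · exact (hmono (hU _ _ huv)).trans (he.symm.trans (hmono (hU _ _ h2.symm)))
      · exact hmono (hU _ _ huv)

/-- A tree on n vertices has n - 1 edges, as many as the list has entries, so none is wasted on a
repetition or a loop. -/
theorem IsTreeSequence.nodup {es : List (Fin n × Fin n)} (h : IsTreeSequence es) :
    (es.map fun e => s(e.1, e.2)).Nodup ∧ ∀ e ∈ es, e.1 ≠ e.2 := by
  classical
  obtain ⟨hlen, htree⟩ := h
  have hcard := htree.card_edgeFinset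
  rw [Fintype.card_fin] at hcard
  set l := es.map fun e => s(e.1, e.2) with hl
  have hll : l.length = es.length := by simp [hl]
  have hset : ∀ z, z ∈ (SimpleGraph.fromEdgeSet (edgeSet es)).edgeFinset ↔
      z ∈ l.toFinset.filter fun z => ¬ z.IsDiag := by
    intro z
    rw [SimpleGraph.mem_edgeFinset, SimpleGraph.edgeSet_fromEdgeSet]
    simp only [edgeSet, hl, Finset.mem_filter, List.mem_toFinset, List.mem_map]
    constructor
    · rintro ⟨⟨e, he, rfl⟩, h2⟩
      exact ⟨⟨e, he, rfl⟩, h2⟩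
    · rintro ⟨⟨e, he, rfl⟩, h2⟩
      exact ⟨⟨e, he, rfl⟩, h2⟩
  have heq := Finset.ext hset
  rw [heq] at hcard
  have h1 := Finset.card_filter_le l.toFinset fun z => ¬ z.IsDiag
  have h2 := List.toFinset_card_le l
  have h3 : l.toFinset.card = l.length := by omega
  have h4 : (l.toFinset.filter fun z => ¬ z.IsDiag).card = l.toFinset.card := by omega
  refine ⟨?_, fun e he hee => ?_⟩
  · exact Multiset.coe_nodup.1 (Multiset.toFinset_card_eq_card_iff_nodup.1 h3)
  · have h5 := Finset.filter_card_eq h4 s(e.1, e.2)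
      (List.mem_toFinset.2 (List.mem_map_of_mem (f := fun e => s(e.1, e.2)) he))
    exact h5 hee

theorem IsTreeSequence.merges {es : List (Fin n × Fin n)} (h : IsTreeSequence es) :
    Merges (Comps.start n) es :=
  merges_of_acyclic es [] _ h.2.isAcyclic h.nodup.1 h.nodup.2 fun u v huv => by
    rw [show u = v from huv]

theorem IsTreeSequence.adj {es : List (Fin n × Fin n)} (h : IsTreeSequence es) :
    ∀ e ∈ es, (SimpleGraph.fromEdgeSet (edgeSet es)).Adj e.1 e.2 := fun e he =>
  (SimpleGraph.fromEdgeSet_adj _).2 ⟨⟨e, he, rfl⟩, h.nodup.2 e he⟩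

end Run

/-! ### All insertions -/

section AllInsertions

variable {n : ℕ} {G : SimpleGraph (Fin n)} {cd : Fin n → Finset (Fin n)} {k : ℕ}

theorem sat_map {α β : Type} {p : PMF α} {f : α → β} {Q : β → Prop} (h : Sat p fun x => Q (f x)) :
    Sat (p.map f) Q := by
  rw [← PMF.bind_pure_comp]
  exact sat_bind h fun x hx => sat_pure hx

/-- What holds in every run. -/
structure Trace (G : SimpleGraph (Fin n)) (cd : Fin n → Finset (Fin n)) (k L A : ℕ)
    (E : Set (Sym2 (Fin n))) (es : List (Fin n × Fin n)) (s : Config n)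
    (l : List (Config n)) : Prop where
  head : l[0]? = some s
  state : ∀ (t : ℕ) (s' : Config n), l[t]? = some s' →
    ∃ U, State G cd k (E ∪ edgeSet (es.take t)) U s'
  step : ∀ (t : ℕ) (s₁ s₂ : Config n), l[t]? = some s₁ → l[t + 1]? = some s₂ →
    (flips s₁ s₂ ≤ if k ≤ Nat.log 2 n then L else 0) ∧
      s₂.clock ≤ s₁.clock + insertionCost (Nat.log 2 n) L A

theorem Trace.single {E : Set (Sym2 (Fin n))} {U : Comps n} {s : Config n} (h : State G cd k E U s)
    (L A : ℕ) (es : List (Fin n × Fin n)) : Trace G cd k L A E es s [s] where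
  head := rfl
  state t s' hs := by
    cases t with
    | zero =>
      cases hs
      exact ⟨U, by simpa [edgeSet_nil] using h⟩
    | succ t => simp at hs
  step t s₁ s₂ _ h₂ := by simp at h₂

theorem Trace.cons {E : Set (Sym2 (Fin n))} {U : Comps n} {s s' : Config n} {L A : ℕ}
    (h : State G cd k E U s) {e : Fin n × Fin n} {es : List (Fin n × Fin n)}
    {l : List (Config n)} (hl : Trace G cd k L A (insert s(e.1, e.2) E) es s' l)
    (hflip : flips s s' ≤ if k ≤ Nat.log 2 n then L else 0)
    (hclock : s'.clock ≤ s.clock + insertionCost (Nat.log 2 n) L A) :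
    Trace G cd k L A E (e :: es) s (s :: l) where
  head := rfl
  state t s'' hs := by
    cases t with
    | zero =>
      cases hs
      exact ⟨U, by simpa [edgeSet_nil] using h⟩
    | succ t =>
      rw [List.getElem?_cons_succ] at hs
      rw [List.take_succ_cons, edgeSet_cons, Set.union_insert, ← Set.insert_union]
      exact hl.state t s'' hs
  step t s₁ s₂ h₁ h₂ := by
    rw [List.getElem?_cons_succ] at h₂
    cases t with
    | zero =>
      rw [hl.head] at h₂
      cases h₁
      cases h₂
      exact ⟨hflip, hclock⟩
    | succ t =>
      rw [List.getElem?_cons_succ] at h₁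
      exact hl.step t s₁ s₂ h₁ h₂

variable [NeZero k]

theorem sat_insertAll (hG : G.IsAcyclic) (L A : ℕ) (tie : Config n → Fin n → Fin n → Bool) :
    ∀ (es : List (Fin n × Fin n)) (E : Set (Sym2 (Fin n))) (U : Comps n) (s : Config n),
    State G cd k E U s → Ready G cd U es →
    Sat ((insertAll k L A tie es).run s) fun z =>
      (z.1.2 = false → z.1.1.length = es.length + 1) ∧ Trace G cd k L A E es s z.1.1 := by
  intro es
  induction es with
  | nil =>
    intro E U s h _
    rw [run_insertAll_nil]
    exact sat_pure ⟨fun _ => rfl, Trace.single h L A []⟩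
  | cons e es ih =>
    intro E U s h hr
    rw [run_insertAll_cons]
    refine sat_bind (h.sat_insertEdge hG hr.1 L A tie) ?_
    rintro ⟨_ | _, s'⟩ ⟨hclock, hok⟩
    · exact sat_pure ⟨by simp, Trace.single h L A _⟩
    · obtain ⟨hstate, hflip⟩ := hok rfl
      simp only [if_true]
      refine sat_map ((ih _ _ s' hstate hr.2).mono ?_)
      rintro z ⟨h1, h2⟩
      exact ⟨fun hz => by simp [h1 hz], h2.cons h hflip hclock.2⟩

/-- The probability that some search starts from a vertex that is not fine. -/
noncomputable def riskProb (k L A : ℕ) [NeZero k] (tie : Config n → Fin n → Fin n → Bool) :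
    List (Fin n × Fin n) → Config n → ℝ≥0∞
  | [], _ => 0
  | e :: es, s =>
    open Classical in
    if Fine s k L e.1 ∧ Fine s k L e.2 then
      expect ((insertEdge k L A tie e.1 e.2).run s) fun y =>
        if y.1 then riskProb k L A tie es y.2 else 0
    else 1

/-- Optional stopping: the total risk does not grow in expectation, and it is at least 1 as soon as
an endpoint is not fine. -/
theorem riskProb_le (hG : G.IsAcyclic) (L A : ℕ) (tie : Config n → Fin n → Fin n → Bool) :
    ∀ (es : List (Fin n × Fin n)) (E : Set (Sym2 (Fin n))) (U : Comps n) (s : Config n),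
    State G cd k E U s → Ready G cd U es →
    riskProb k L A tie es s ≤ totalRisk cd k L (A * (k : ℝ≥0∞)⁻¹ ^ L) U s := by
  intro es
  induction es with
  | nil => intros; simp [riskProb]
  | cons e es ih =>
    intro E U s h hr
    simp only [riskProb]
    split_ifs with hfine
    · set q : ℝ≥0∞ := A * (k : ℝ≥0∞)⁻¹ ^ L with hq
      calc _ ≤ expect ((insertEdge k L A tie e.1 e.2).run s) (fun y => ∑ v,
            ∑ W ∈ manyDead cd k L v, if y.1 then risk k q (U.link e.1 e.2) y.2 W else 0) := by
            refine expect_mono_of_sat (h.sat_insertEdge hG hr.1 L A tie) ?_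
            rintro ⟨_ | _, s'⟩ ⟨-, hok⟩
            · simp
            · simpa [totalRisk] using ih _ _ s' (hok rfl).1 hr.2
        _ ≤ _ := by
            rw [expect_finset_sum]
            refine Finset.sum_le_sum fun v _ => ?_
            rw [expect_finset_sum]
            exact Finset.sum_le_sum fun W _ => h.expect_insertEdge_risk hG hr.1 L A tie W
    · rw [not_and_or] at hfine
      rcases hfine with hfine | hfine
      · exact one_le_totalRisk h.core.cand hfine
      · exact one_le_totalRisk h.core.cand hfine

theorem expect_insertAll_failed (hG : G.IsAcyclic) (L A : ℕ)
    (tie : Config n → Fin n → Fin n → Bool) :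
    ∀ (es : List (Fin n × Fin n)) (E : Set (Sym2 (Fin n))) (U : Comps n) (s : Config n),
    State G cd k E U s → Ready G cd U es →
    expect ((insertAll k L A tie es).run s) (fun z => if z.1.2 then 1 else 0) ≤
      riskProb k L A tie es s + es.length * 2⁻¹ ^ A := by
  intro es
  induction es with
  | nil =>
    intro E U s _ _
    rw [run_insertAll_nil, expect_pure]
    simp
  | cons e es ih =>
    intro E U s h hr
    by_cases hfine : Fine s k L e.1 ∧ Fine s k L e.2
    · simp only [riskProb, if_pos hfine]
      rw [run_insertAll_cons, expect_bind]
      calc _ ≤ expect ((insertEdge k L A tie e.1 e.2).run s) (fun y =>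
            ((if y.1 then riskProb k L A tie es y.2 else 0) + es.length * 2⁻¹ ^ A) +
              if y.1 then 0 else 1) := by
            refine expect_mono_of_sat (h.sat_insertEdge hG hr.1 L A tie) ?_
            rintro ⟨_ | _, s'⟩ ⟨-, hok⟩
            · simp [expect_pure]
            · simpa [expect_map] using ih _ _ s' (hok rfl).1 hr.2
        _ ≤ expect ((insertEdge k L A tie e.1 e.2).run s)
              (fun y => if y.1 then riskProb k L A tie es y.2 else 0) +
            es.length * 2⁻¹ ^ A + 2⁻¹ ^ A := by
            rw [expect_add, expect_add, expect_const]
            gcongr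
            exact h.expect_insertEdge_fail hG hr.1 A tie hfine.1 hfine.2
        _ = _ := by
            rw [List.length_cons]
            push_cast
            ring
    · simp only [riskProb, if_neg hfine]
      refine le_trans ?_ le_self_add
      refine (expect_mono (G := fun _ => 1) fun z => ?_).trans (expect_const _ _).le
      split_ifs <;> simp

/-- Exponential moments of a bounded quantity with small expectation. -/
theorem expect_exp_le {α : Type} {p : PMF α} {c : α → ℕ} {c₀ B M : ℕ} (hB : 0 < B)
    (hsat : Sat p fun x => c₀ ≤ c x ∧ c x ≤ c₀ + B)
    (hM : expect p (fun x => (c x : ℝ≥0∞)) ≤ c₀ + M) (δ : ℝ) :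
    expect p (fun x => ENNReal.ofReal (Real.exp ((c x + δ) / B))) ≤
      ENNReal.ofReal (Real.exp ((c₀ + 2 * M + δ) / B)) := by
  have hB' : (0 : ℝ) < B := by exact_mod_cast hB
  have hdiff : expect p (fun x => ((c x - c₀ : ℕ) : ℝ≥0∞)) ≤ M := by
    have : expect p (fun x => (c x : ℝ≥0∞)) =
        c₀ + expect p (fun x => ((c x - c₀ : ℕ) : ℝ≥0∞)) := by
      rw [← expect_const p (c₀ : ℝ≥0∞), ← expect_add]
      refine expect_congr_of_sat hsat fun x hx => ?_
      rw [← Nat.cast_add, Nat.add_sub_cancel' hx.1]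
    rw [this] at hM
    exact (ENNReal.add_le_add_iff_left (ENNReal.natCast_ne_top _)).1 hM
  set K := ENNReal.ofReal (Real.exp ((c₀ + δ) / B)) with hK
  calc _ ≤ expect p (fun x => K * (1 + ENNReal.ofReal (2 / B) * ((c x - c₀ : ℕ) : ℝ≥0∞))) := by
        refine expect_mono_of_sat hsat fun x hx => ?_
        have hd : (0 : ℝ) ≤ ((c x - c₀ : ℕ) : ℝ) := Nat.cast_nonneg _
        rw [hK, ← ENNReal.ofReal_natCast, ← ENNReal.ofReal_mul (by positivity),
          ← ENNReal.ofReal_one, ← ENNReal.ofReal_add (by norm_num) (by positivity),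
          ← ENNReal.ofReal_mul (Real.exp_pos _).le]
        apply ENNReal.ofReal_le_ofReal
        have hsplit : ((c x : ℝ) + δ) / B = (c₀ + δ) / B + ((c x - c₀ : ℕ) : ℝ) / B := by
          rw [Nat.cast_sub hx.1]
          ring
        rw [hsplit, Real.exp_add]
        refine mul_le_mul_of_nonneg_left ?_ (Real.exp_pos _).le
        set y := ((c x - c₀ : ℕ) : ℝ) / B with hy
        have hy0 : 0 ≤ y := by positivity
        have hy1 : y ≤ 1 := by
          rw [hy, div_le_one hB']
          have : c x - c₀ ≤ B := by omega
          exact_mod_cast this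
        -- For y between 0 and 1 this gives exp y ≤ 1 + y + y² ≤ 1 + 2y, the origin of the factor 2
        -- in front of M.
        have := Real.abs_exp_sub_one_sub_id_le (x := y) (by rw [abs_of_nonneg hy0]; exact hy1)
        have h2 := (abs_le.1 this).2
        have h3 : 2 / (B : ℝ) * ((c x - c₀ : ℕ) : ℝ) = 2 * y := by rw [hy]; ring
        rw [h3]
        nlinarith
    _ ≤ K * (1 + ENNReal.ofReal (2 / B) * M) := by
        rw [expect_const_mul, expect_add, expect_const, expect_const_mul]
        gcongr
    _ ≤ _ := by
        rw [hK, ← ENNReal.ofReal_natCast, ← ENNReal.ofReal_mul (by positivity),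
          ← ENNReal.ofReal_one, ← ENNReal.ofReal_add (by norm_num) (by positivity),
          ← ENNReal.ofReal_mul (Real.exp_pos _).le]
        apply ENNReal.ofReal_le_ofReal
        have hsplit : ((c₀ : ℝ) + 2 * M + δ) / B = (c₀ + δ) / B + 2 / B * M := by ring
        rw [hsplit, Real.exp_add]
        refine mul_le_mul_of_nonneg_left ?_ (Real.exp_pos _).le
        have := Real.add_one_le_exp (2 / (B : ℝ) * M)
        linarith

/-- A Chernoff bound with the potential clock + 196 · weight, where 196 = 2 · 98. The weight
released by a merger pays twice the expected time of the insertion, so the exponential of the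
potential divided by B does not grow in expectation while the endpoints are fine. -/
theorem expect_insertAll_time (hG : G.IsAcyclic) (hk : 2 ≤ k) (L A : ℕ)
    (tie : Config n → Fin n → Fin n → Bool) (Θ : ℝ) :
    ∀ (es : List (Fin n × Fin n)) (E : Set (Sym2 (Fin n))) (U : Comps n) (s : Config n),
    State G cd k E U s → Ready G cd U es →
    expect ((insertAll k L A tie es).run s) (fun z => if Θ < z.2.clock then 1 else 0) ≤
      riskProb k L A tie es s + ENNReal.ofReal (Real.exp
        ((s.clock + (196 * U.weight - Θ)) / insertionCost (Nat.log 2 n) L A)) := by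
  set B := insertionCost (Nat.log 2 n) L A with hBdef
  have hB : 0 < B := by rw [hBdef, insertionCost]; omega
  have hB' : (0 : ℝ) < B := by exact_mod_cast hB
  have hone : ∀ (U : Comps n) (s : Config n), (if Θ < s.clock then 1 else 0 : ℝ≥0∞) ≤
      ENNReal.ofReal (Real.exp ((s.clock + (196 * U.weight - Θ)) / B)) := by
    intro U s
    split_ifs with h
    · rw [ENNReal.one_le_ofReal, Real.one_le_exp_iff]
      have : (0 : ℝ) ≤ 196 * U.weight := by positivity
      exact div_nonneg (by linarith) hB'.le
    · exact zero_le
  intro es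
  induction es with
  | nil =>
    intro E U s _ _
    rw [run_insertAll_nil, expect_pure]
    exact (hone U s).trans le_add_self
  | cons e es ih =>
    intro E U s h hr
    by_cases hfine : Fine s k L e.1 ∧ Fine s k L e.2
    · simp only [riskProb, if_pos hfine]
      rw [run_insertAll_cons, expect_bind]
      calc _ ≤ expect ((insertEdge k L A tie e.1 e.2).run s) (fun y =>
            (if y.1 then riskProb k L A tie es y.2 else 0) + ENNReal.ofReal (Real.exp
              ((y.2.clock + (196 * (U.link e.1 e.2).weight - Θ)) / B))) := by
            refine expect_mono_of_sat (h.sat_insertEdge hG hr.1 L A tie) ?_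
            rintro ⟨_ | _, s'⟩ ⟨-, hok⟩
            · simpa [expect_pure] using hone (U.link e.1 e.2) s'
            · simpa [expect_map] using ih _ _ s' (hok rfl).1 hr.2
        _ ≤ _ := by
            rw [expect_add]
            gcongr
            refine (expect_exp_le hB ((h.sat_insertEdge hG hr.1 L A tie).mono fun y hy => hy.1)
              (h.expect_insertEdge_clock hG hr.1 A tie hk hfine.1 hfine.2) _).trans ?_
            apply ENNReal.ofReal_le_ofReal
            rw [Real.exp_le_exp]
            have hw := Comps.weight_link h.wf hr.1.ne
            have hw' : ((U.link e.1 e.2).weight : ℝ) +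
                ((min (U.rk e.1) (U.rk e.2) + 1 : ℕ) : ℝ) ≤ U.weight := by exact_mod_cast hw
            gcongr ?_ / _
            rw [Nat.cast_mul]
            push_cast at hw' ⊢
            linarith
    · simp only [riskProb, if_neg hfine]
      refine le_trans ?_ le_self_add
      refine (expect_mono (G := fun _ => 1) fun z => ?_).trans (expect_const _ _).le
      split_ifs <;> simp

end AllInsertions

/-! ### The law of the run -/

section Law

variable {n k : ℕ}

theorem State.isOrientation {G : SimpleGraph (Fin n)} {cd : Fin n → Finset (Fin n)}
    {E : Set (Sym2 (Fin n))} {U : Comps n} {s : Config n} (h : State G cd k E U s) :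
    s.IsOrientation E ∧ ∀ v, s.outDegree v ≤ k + 1 := by
  refine ⟨⟨h.core.arcs, h.core.antisymm⟩, fun v => ?_⟩
  have hsub : {w | s.Arc v w} ⊆
      (((Finset.range (s.deg v)).image (s.nbr v) : Finset (Fin n)) : Set (Fin n)) := by
    rintro w ⟨i, hi, rfl⟩
    exact Finset.mem_coe.2 (Finset.mem_image_of_mem _ (Finset.mem_range.2 hi))
  refine (Set.ncard_le_ncard hsub (Finset.finite_toSet _)).trans ?_
  rw [Set.ncard_coe_finset]
  exact Finset.card_image_le.trans (by rw [Finset.card_range]; exact h.core.deg_le v)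

variable [NeZero k]

/-- The tree formed by the edges. -/
abbrev treeOf (es : List (Fin n × Fin n)) : SimpleGraph (Fin n) :=
  SimpleGraph.fromEdgeSet (edgeSet es)

/-- The possible heads of arcs. -/
noncomputable abbrev heads (es : List (Fin n × Fin n)) : Fin n → Finset (Fin n) :=
  cand (treeOf es) es (Comps.start n)

theorem IsTreeSequence.ready {es : List (Fin n × Fin n)} (h : IsTreeSequence es) :
    Ready (treeOf es) (heads es) (Comps.start n) es :=
  ready_of_merges es _ h.merges h.adj fun _ => Finset.Subset.refl _

theorem sat_run {es : List (Fin n × Fin n)} (h : IsTreeSequence es) (L A : ℕ)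
    (tie : Config n → Fin n → Fin n → Bool) :
    Sat (run k L A tie es) fun o => (o.failed = false → o.snapshots.length = n) ∧
      Trace (treeOf es) (heads es) k L A ∅ es (Config.init n) o.snapshots := by
  refine sat_map ((sat_insertAll h.2.isAcyclic L A tie es ∅ (Comps.start n) (Config.init n)
    (state_start _ _ k) h.ready).mono ?_)
  rintro z ⟨h1, h2⟩
  exact ⟨fun hz => (h1 hz).trans h.1, h2⟩

theorem riskProb_start_le {es : List (Fin n × Fin n)} (h : IsTreeSequence es) (hk : 2 ≤ k)
    {L A : ℕ} (tie : Config n → Fin n → Fin n → Bool) (hD : 1 ≤ Nat.log 2 n)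
    (hq : (8 * (Nat.log 2 n : ℝ≥0∞) ^ 2) ^ 2 *
      (A * (k : ℝ≥0∞)⁻¹ ^ L * Nat.log 2 n) ≤ 2⁻¹ ^ 2) :
    riskProb k L A tie es (Config.init n) ≤ n * 2⁻¹ ^ k ^ L :=
  (riskProb_le h.2.isAcyclic L A tie es ∅ _ _ (state_start _ (heads es) k) h.ready).trans
    (totalRisk_start hk hD (fun p => (Nat.le_add_right _ _).trans
      (card_cand h.2.isAcyclic p es _ (Comps.wf_start n) h.merges)) hq)

theorem run_failed_le {es : List (Fin n × Fin n)} (h : IsTreeSequence es) (hk : 2 ≤ k)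
    {L A : ℕ} (tie : Config n → Fin n → Fin n → Bool) (hD : 1 ≤ Nat.log 2 n)
    (hq : (8 * (Nat.log 2 n : ℝ≥0∞) ^ 2) ^ 2 *
      (A * (k : ℝ≥0∞)⁻¹ ^ L * Nat.log 2 n) ≤ 2⁻¹ ^ 2) :
    (run k L A tie es).toOuterMeasure {o | o.failed = true} ≤
      n * 2⁻¹ ^ k ^ L + n * 2⁻¹ ^ A := by
  rw [toOuterMeasure_eq_expect, run, expect_map]
  refine le_trans (le_of_eq ?_) ((expect_insertAll_failed h.2.isAcyclic L A tie es ∅ _ _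
    (state_start _ (heads es) k) h.ready).trans (add_le_add (riskProb_start_le h hk tie hD hq) ?_))
  · congr 1
    funext z
    simp [Set.indicator]
  · gcongr
    have := h.1
    omega

theorem run_time_le {es : List (Fin n × Fin n)} (h : IsTreeSequence es) (hk : 2 ≤ k)
    {L A : ℕ} (tie : Config n → Fin n → Fin n → Bool) (hD : 1 ≤ Nat.log 2 n)
    (hq : (8 * (Nat.log 2 n : ℝ≥0∞) ^ 2) ^ 2 *
      (A * (k : ℝ≥0∞)⁻¹ ^ L * Nat.log 2 n) ≤ 2⁻¹ ^ 2) (Θ : ℝ) :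
    (run k L A tie es).toOuterMeasure {o | Θ < o.time} ≤
      n * 2⁻¹ ^ k ^ L + ENNReal.ofReal (Real.exp
        ((392 * n - Θ) / insertionCost (Nat.log 2 n) L A)) := by
  rw [toOuterMeasure_eq_expect, run, expect_map]
  refine le_trans (le_of_eq ?_) ((expect_insertAll_time h.2.isAcyclic hk L A tie Θ es ∅ _ _
    (state_start _ (heads es) k) h.ready).trans (add_le_add (riskProb_start_le h hk tie hD hq)
      (le_of_eq ?_)))
  · rfl
  · rw [Comps.weight_start]
    congr 3
    simp only [Config.init]
    push_cast
    ring

end Law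

/-! ### Estimates -/

section Estimates

theorem log_le_logb (n : ℕ) : (Nat.log 2 n : ℝ) ≤ Real.logb 2 n := by
  have := Real.natLog_le_logb n 2
  exact_mod_cast this

theorem logLog_nonneg {n k : ℕ} (hk : 2 ≤ k) (hx : 1 ≤ Real.logb 2 n) : 0 ≤ logLog k n :=
  Real.logb_nonneg (by exact_mod_cast hk) hx

theorem pow_le_pow_walkLength {c : ℝ} {n k : ℕ} (hc : 8 ≤ c) (hk : 2 ≤ k)
    (hx : 1 ≤ Real.logb 2 n) : Real.logb 2 n ^ 8 ≤ (k : ℝ) ^ walkLength c k n := by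
  have hk1 : (1 : ℝ) < k := by exact_mod_cast hk
  have h0 := logLog_nonneg hk hx
  have h1 : c * logLog k n ≤ walkLength c k n := Nat.le_ceil _
  have h2 : Real.logb k (Real.logb 2 n ^ 8) ≤ walkLength c k n := by
    rw [Real.logb_pow]
    refine le_trans ?_ h1
    push_cast
    exact mul_le_mul_of_nonneg_right hc h0
  have hpos : (0 : ℝ) < Real.logb 2 n ^ 8 := by positivity
  rw [Real.logb_le_iff_le_rpow hk1 hpos, Real.rpow_natCast] at h2
  exact h2

theorem walkLength_le {c : ℝ} {n k : ℕ} (hc : 0 ≤ c) (hk : 2 ≤ k) (hx : 1 ≤ Real.logb 2 n) :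
    (walkLength c k n : ℝ) ≤ c * logLog k n + 1 :=
  (Nat.ceil_lt_add_one (mul_nonneg hc (logLog_nonneg hk hx))).le

theorem maxAttempts_le {d : ℝ} {n : ℕ} (hd : 0 ≤ d) (hx : 1 ≤ Real.logb 2 n) :
    (maxAttempts d n : ℝ) ≤ (d + 1) * Real.logb 2 n := by
  have := (Nat.ceil_lt_add_one (mul_nonneg hd (zero_le_one.trans hx))).le
  rw [maxAttempts]
  linarith

theorem logLog_le {n k : ℕ} (hk : 2 ≤ k) (hx : 1 ≤ Real.logb 2 n) :
    logLog k n ≤ Real.logb 2 n := by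
  have hk2 : (2 : ℝ) ≤ k := by exact_mod_cast hk
  rw [logLog, Real.logb_le_iff_le_rpow (by linarith) (by linarith)]
  calc Real.logb 2 n ≤ (2 : ℝ) ^ Real.logb 2 n := by
        rw [Real.rpow_def_of_pos (by norm_num)]
        have h2 := Real.add_one_le_exp (Real.log 2 * Real.logb 2 n / 2)
        have h3 : Real.exp (Real.log 2 * Real.logb 2 n) =
            Real.exp (Real.log 2 * Real.logb 2 n / 2) ^ 2 := by
          rw [← Real.exp_nat_mul]; congr 1; push_cast; ring
        have h4 := Real.log_two_gt_d9
        rw [h3]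
        -- Here 0.34 is less than half of log 2, and squaring suffices because (1 + 0.34 x)² ≥ 1.36
        -- x.
        have h5 : 0.34 * Real.logb 2 n + 1 ≤ Real.exp (Real.log 2 * Real.logb 2 n / 2) := by
          nlinarith
        have h6 := pow_le_pow_left₀ (by linarith) h5 2
        nlinarith [sq_nonneg (0.34 * Real.logb 2 n - 1)]
    _ ≤ (k : ℝ) ^ Real.logb 2 n := Real.rpow_le_rpow (by norm_num) hk2 (by linarith)

theorem insertionCost_le {c d : ℝ} {n k : ℕ} (hc : 0 ≤ c) (hd : 0 ≤ d) (hk : 2 ≤ k)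
    (hx : 1 ≤ Real.logb 2 n) :
    (insertionCost (Nat.log 2 n) (walkLength c k n) (maxAttempts d n) : ℝ) ≤
      (10 + (d + 1) * (3 * c + 4) + (c + 1)) * (Real.logb 2 n * max 1 (logLog k n)) := by
  set x := Real.logb 2 n
  set μ := max 1 (logLog k n)
  have hμ1 : 1 ≤ μ := le_max_left _ _
  have hμ2 : logLog k n ≤ μ := le_max_right _ _
  have hD : (Nat.log 2 n : ℝ) ≤ x := log_le_logb n
  have hL : (walkLength c k n : ℝ) ≤ (c + 1) * μ := by
    have := walkLength_le hc hk hx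
    nlinarith
  have hA : (maxAttempts d n : ℝ) ≤ (d + 1) * x := maxAttempts_le hd hx
  have hx0 : 0 ≤ x := by linarith
  have h1 : (maxAttempts d n : ℝ) * (3 * walkLength c k n + 1) ≤
      (d + 1) * x * ((3 * c + 4) * μ) := by
    apply mul_le_mul hA _ (by positivity) (by positivity)
    nlinarith
  have h2 : (c + 1) * μ ≤ (c + 1) * (x * μ) := by
    apply mul_le_mul_of_nonneg_left _ (by linarith)
    nlinarith
  have h3 : x ≤ x * μ := by nlinarith
  have h4 : 1 ≤ x * μ := by nlinarith
  unfold insertionCost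
  push_cast
  nlinarith

theorem inv_two_pow_le {γ : ℝ} {n m : ℕ} (hn : 2 ≤ n)
    (h : (γ + 2) * Real.logb 2 n ≤ m) :
    (n : ℝ≥0∞) * 2⁻¹ ^ m ≤ ENNReal.ofReal ((n : ℝ) ^ (-γ) / 2) := by
  have hn0 : (0 : ℝ) < n := by positivity
  have h2 : (2 : ℝ≥0∞)⁻¹ = ENNReal.ofReal (2⁻¹) := by
    rw [ENNReal.ofReal_inv_of_pos (by norm_num), ENNReal.ofReal_ofNat]
  rw [h2, ← ENNReal.ofReal_pow (by norm_num), ← ENNReal.ofReal_natCast n,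
    ← ENNReal.ofReal_mul (by positivity)]
  apply ENNReal.ofReal_le_ofReal
  have h3 : (n : ℝ) ^ (γ + 2) ≤ 2 ^ m := by
    rw [← Real.rpow_natCast]
    calc (n : ℝ) ^ (γ + 2) = ((2 : ℝ) ^ Real.logb 2 n) ^ (γ + 2) := by
          rw [Real.rpow_logb (by norm_num) (by norm_num) hn0]
      _ = (2 : ℝ) ^ ((γ + 2) * Real.logb 2 n) := by
          rw [← Real.rpow_mul (by norm_num), mul_comm]
      _ ≤ _ := Real.rpow_le_rpow_of_exponent_le (by norm_num) h
  rw [inv_pow]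
  have h4 : ((2 : ℝ) ^ m)⁻¹ ≤ ((n : ℝ) ^ (γ + 2))⁻¹ :=
    inv_anti₀ (Real.rpow_pos_of_pos hn0 _) h3
  have h5 : ((n : ℝ) ^ (γ + 2))⁻¹ = (n : ℝ) ^ (-γ) * ((n : ℝ) * n)⁻¹ := by
    rw [Real.rpow_add hn0, Real.rpow_neg hn0.le, Real.rpow_two, mul_inv, sq]
  calc (n : ℝ) * (2 ^ m)⁻¹ ≤ n * ((n : ℝ) ^ (-γ) * ((n : ℝ) * n)⁻¹) := by
        rw [← h5]; gcongr
    _ = (n : ℝ) ^ (-γ) / n := by field_simp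
    _ ≤ _ := by
        apply div_le_div_of_nonneg_left (Real.rpow_nonneg hn0.le _) (by norm_num)
        exact_mod_cast hn

theorem exp_neg_le {γ y : ℝ} {n : ℕ} (hγ : 0 < γ) (hn : 2 ≤ n)
    (hy : (γ + 1) * Real.logb 2 n ≤ y) : Real.exp (-y) ≤ (n : ℝ) ^ (-γ) / 2 := by
  have hn0 : (0 : ℝ) < n := by positivity
  have hn2 : (2 : ℝ) ≤ n := by exact_mod_cast hn
  have hlog : 0 < Real.log n := Real.log_pos (by linarith)
  have h1 : Real.log n ≤ Real.logb 2 n := by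
    rw [Real.logb, le_div_iff₀ (Real.log_pos (by norm_num))]
    have := Real.log_two_lt_d9
    nlinarith
  have h2 : Real.log 2 ≤ Real.log n := Real.log_le_log (by norm_num) hn2
  have h3 : (n : ℝ) ^ (-γ) / 2 = Real.exp (-(γ * Real.log n) - Real.log 2) := by
    rw [Real.exp_sub, Real.exp_log (by norm_num), Real.rpow_def_of_pos hn0]
    congr 2
    ring
  rw [h3, Real.exp_le_exp]
  nlinarith

/-- What has to be shown is 256 D^5 A ≤ k^L. With x = log n, the left side is at most 256 (d + 1)
x^6 ≤ x^7, while k^L ≥ x^8 by the choice of the walk length. -/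
theorem risk_base_le {c d : ℝ} {n k : ℕ} (hc : 8 ≤ c) (hd : 0 ≤ d) (hk : 2 ≤ k)
    (hx : 256 * (d + 1) ≤ Real.logb 2 n) :
    (8 * (Nat.log 2 n : ℝ≥0∞) ^ 2) ^ 2 * (maxAttempts d n *
      (k : ℝ≥0∞)⁻¹ ^ walkLength c k n * Nat.log 2 n) ≤ 2⁻¹ ^ 2 := by
  have hx1 : 1 ≤ Real.logb 2 n := by linarith
  set x := Real.logb 2 n
  set D := Nat.log 2 n
  set A := maxAttempts d n
  set m := k ^ walkLength c k n with hm
  have hD : (D : ℝ) ≤ x := log_le_logb n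
  have hA : (A : ℝ) ≤ (d + 1) * x := maxAttempts_le hd hx1
  have hmx : x ^ 8 ≤ (m : ℝ) := by
    rw [hm]; push_cast
    exact pow_le_pow_walkLength hc hk hx1
  have hm0 : m ≠ 0 := pow_ne_zero _ (by omega)
  have key : 256 * D ^ 5 * A ≤ m := by
    have : (256 * (D : ℝ) ^ 5 * A) ≤ m := by
      calc (256 * (D : ℝ) ^ 5 * A) ≤ 256 * x ^ 5 * ((d + 1) * x) := by gcongr
        _ = (256 * (d + 1)) * x ^ 6 := by ring
        _ ≤ x * x ^ 6 := by gcongr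
        _ = x ^ 7 := by ring
        _ ≤ x ^ 8 := pow_le_pow_right₀ hx1 (by norm_num)
        _ ≤ m := hmx
    exact_mod_cast this
  have hminv : (k : ℝ≥0∞)⁻¹ ^ walkLength c k n = (m : ℝ≥0∞)⁻¹ := by
    rw [hm, ← ENNReal.inv_pow]; push_cast; rfl
  rw [hminv]
  calc _ = (64 * (D : ℝ≥0∞) ^ 5 * A) / m := by rw [div_eq_mul_inv]; ring
    _ ≤ _ := by
      rw [ENNReal.div_le_iff (by exact_mod_cast hm0) (ENNReal.natCast_ne_top m), ← ENNReal.inv_pow,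
        mul_comm ((2 ^ 2)⁻¹ : ℝ≥0∞), ← div_eq_mul_inv,
        ENNReal.le_div_iff_mul_le (by simp) (by simp)]
      have : 64 * D ^ 5 * A * 2 ^ 2 ≤ m := by
        refine le_trans (le_of_eq ?_) key
        ring
      exact_mod_cast this

theorem logLog_le_of_floor {n k : ℕ} {q : ℝ} (hk : 2 ≤ k) (hq : 0 < q)
    (hx : 1 ≤ Real.logb 2 n) (h : k = ⌊(Real.logb 2 n) ^ (1 / q)⌋₊) : logLog k n ≤ 2 * q := by
  set x := Real.logb 2 n with hxdef
  have hk1 : (2 : ℝ) ≤ k := by exact_mod_cast hk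
  have h1 : x ^ (1 / q) < k + 1 := by
    rw [h]; exact Nat.lt_floor_add_one _
  have hx0 : 0 < x := by linarith
  rw [logLog, ← hxdef, Real.logb_le_iff_le_rpow (by linarith) hx0]
  calc x = (x ^ (1 / q)) ^ q := by
        rw [← Real.rpow_mul hx0.le, one_div, inv_mul_cancel₀ hq.ne', Real.rpow_one]
    -- Rounding down is harmless since k + 1 ≤ k² for k ≥ 2.
    _ ≤ ((k : ℝ) ^ (2 : ℝ)) ^ q := by
        apply Real.rpow_le_rpow (Real.rpow_nonneg hx0.le _) _ hq.le
        rw [Real.rpow_two]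
        nlinarith
    _ = _ := by rw [← Real.rpow_mul (by linarith)]

theorem eventually_large (X K : ℝ) : ∃ N : ℕ, ∀ n : ℕ, N ≤ n →
    2 ≤ n ∧ X ≤ Real.logb 2 n ∧ K * Real.logb 2 n ^ 3 ≤ n := by
  rw [← Filter.eventually_atTop]
  refine (Filter.eventually_ge_atTop 2).and (Filter.Eventually.and ?_ ?_)
  · exact ((Real.tendsto_logb_atTop (by norm_num : (1 : ℝ) < 2)).comp
      tendsto_natCast_atTop_atTop).eventually_ge_atTop X
  · have h := (Real.isLittleO_pow_log_id_atTop (n := 3)).comp_tendsto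
      (tendsto_natCast_atTop_atTop (R := ℝ))
    have hlog : 0 < Real.log 2 := Real.log_pos (by norm_num)
    have hc : 0 < Real.log 2 ^ 3 / (|K| + 1) := by positivity
    filter_upwards [h.bound hc] with n hn
    simp only [Function.comp, id, Real.norm_eq_abs] at hn
    have hnn : |(n : ℝ)| = n := abs_of_nonneg (Nat.cast_nonneg n)
    rw [hnn] at hn
    have h1 : Real.log n ^ 3 ≤ Real.log 2 ^ 3 / (|K| + 1) * n := (le_abs_self _).trans hn
    have h2 : Real.logb 2 n ^ 3 ≤ n / (|K| + 1) := by
      rw [Real.logb, div_pow, div_le_iff₀ (by positivity)]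
      calc _ ≤ _ := h1
        _ = _ := by ring
    have h3 : 0 ≤ Real.logb 2 n ^ 3 := by
      apply pow_nonneg
      rw [Real.logb]
      exact div_nonneg (Real.log_natCast_nonneg n) hlog.le
    rw [le_div_iff₀ (by positivity)] at h2
    nlinarith [le_abs_self K]

end Estimates

end DancingWalk

theorem mainTheorem3 :
    ∃ c₀ : ℝ, ∀ c : ℝ, c₀ ≤ c → ∀ γ : ℝ, 0 < γ → ∃ d₀ : ℝ, ∀ d : ℝ, d₀ ≤ d →
    ∃ (C : ℝ) (N : ℕ), ∀ (n k : ℕ) [NeZero k], N ≤ n → 2 ≤ k →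
    ∀ (tie : DancingWalk.Config n → Fin n → Fin n → Bool) (edges : List (Fin n × Fin n)),
    DancingWalk.IsTreeSequence edges →
    ∀ P : PMF (DancingWalk.Outcome n),
    P = DancingWalk.run k (DancingWalk.walkLength c k n) (DancingWalk.maxAttempts d n) tie edges →
      -- with high probability, no failure is declared
      P.toOuterMeasure {o | o.failed = true} ≤ ENNReal.ofReal ((n : ℝ) ^ (-γ)) ∧
      -- with high probability, the total running time is linear
      P.toOuterMeasure {o | C * n < o.time} ≤ ENNReal.ofReal ((n : ℝ) ^ (-γ)) ∧
      -- the bounds that hold with certainty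
      (∀ o ∈ P.support,
        (o.failed = false → o.snapshots.length = n) ∧
        (∀ (t : ℕ) (s : DancingWalk.Config n), o.snapshots[t]? = some s →
          s.IsOrientation (DancingWalk.edgeSet (edges.take t)) ∧ ∀ v, s.outDegree v ≤ k + 1) ∧
        (∀ (t : ℕ) (s s' : DancingWalk.Config n),
          o.snapshots[t]? = some s → o.snapshots[t + 1]? = some s' →
          (DancingWalk.flips s s' : ℝ) ≤ C * DancingWalk.logLog k n ∧
          (s'.clock : ℝ) ≤
            s.clock + C * (Real.logb 2 n * max 1 (DancingWalk.logLog k n)))) ∧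
      -- the case where `k` is `(log n) ^ (1 / q)`, rounded down
      (∀ q : ℝ, 0 < q → k = ⌊(Real.logb 2 n) ^ (1 / q)⌋₊ → ∀ o ∈ P.support,
        (∀ (t : ℕ) (s : DancingWalk.Config n), o.snapshots[t]? = some s →
          ∀ v, (s.outDegree v : ℝ) ≤ (Real.logb 2 n) ^ (1 / q) + 1) ∧
        (∀ (t : ℕ) (s s' : DancingWalk.Config n),
          o.snapshots[t]? = some s → o.snapshots[t + 1]? = some s' →
          (DancingWalk.flips s s' : ℝ) ≤ C * q)) := by
  -- The value 8 gives k^L ≥ (log n)^8, and d ≥ γ + 3 gives more than the (γ + 2) log n attempts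
  -- needed for n 2^(-A) ≤ n^(-γ)/2.
  refine ⟨8, fun c hc γ hγ => ⟨γ + 3, fun d hd => ?_⟩⟩
  set K : ℝ := 10 + (d + 1) * (3 * c + 4) + (c + 1) with hK
  have hd0 : 0 ≤ d := by linarith
  have hc0 : 0 ≤ c := by linarith
  have hK0 : 0 < K := by positivity
  obtain ⟨N, hN⟩ := DancingWalk.eventually_large (256 * (d + 1) + (γ + 2)) ((γ + 1) * K)
  -- K bounds the time of one insertion, 2(c + 1) the flips, including the case log_k log n ≤ 2q,
  -- and 393 the total time: 392 n is twice the expected cost and one further n is the deviation.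
  refine ⟨K + 2 * (c + 1) + 393, N, ?_⟩
  intro n k _ hn hk tie edges htree P hP
  subst hP
  obtain ⟨hn2, hX, hn3⟩ := hN n hn
  set x := Real.logb 2 n with hx
  have hx1 : 1 ≤ x := by linarith
  have hn0 : (0 : ℝ) < n := by positivity
  have hD : 1 ≤ Nat.log 2 n := Nat.log_pos (by norm_num) hn2
  have hq := DancingWalk.risk_base_le (c := c) (d := d) (n := n) (k := k) hc hd0 hk
    (by linarith)
  have hll := DancingWalk.logLog_nonneg hk hx1
  have hcost := DancingWalk.insertionCost_le (n := n) (k := k) hc0 hd0 hk hx1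
  rw [← hK, ← hx] at hcost
  have hhalf : ENNReal.ofReal ((n : ℝ) ^ (-γ)) =
      ENNReal.ofReal ((n : ℝ) ^ (-γ) / 2) + ENNReal.ofReal ((n : ℝ) ^ (-γ) / 2) := by
    have := Real.rpow_nonneg hn0.le (-γ)
    rw [← ENNReal.ofReal_add (by positivity) (by positivity), add_halves]
  have hrisk : (n : ENNReal) * 2⁻¹ ^ k ^ DancingWalk.walkLength c k n ≤
      ENNReal.ofReal ((n : ℝ) ^ (-γ) / 2) := by
    apply DancingWalk.inv_two_pow_le hn2
    push_cast
    refine le_trans ?_ (DancingWalk.pow_le_pow_walkLength hc hk hx1)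
    calc (γ + 2) * x ≤ x * x := by gcongr; linarith
      _ = x ^ 2 := by ring
      _ ≤ x ^ 8 := pow_le_pow_right₀ hx1 (by norm_num)
  have hflips : ∀ s s' : DancingWalk.Config n, DancingWalk.flips s s' ≤
      (if k ≤ Nat.log 2 n then DancingWalk.walkLength c k n else 0) →
      (DancingWalk.flips s s' : ℝ) ≤ (c + 1) * DancingWalk.logLog k n := by
    intro s s' h
    split_ifs at h with hkD
    · have h1 : (1 : ℝ) ≤ DancingWalk.logLog k n := by
        have hk1 : (1 : ℝ) < k := by exact_mod_cast hk
        rw [DancingWalk.logLog, ← hx, Real.le_logb_iff_rpow_le hk1 (by linarith), Real.rpow_one]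
        have : (k : ℝ) ≤ Nat.log 2 n := by exact_mod_cast hkD
        exact this.trans (DancingWalk.log_le_logb n)
      have h2 := DancingWalk.walkLength_le hc0 hk hx1
      have h3 : (DancingWalk.flips s s' : ℝ) ≤ DancingWalk.walkLength c k n := by exact_mod_cast h
      linarith
    · rw [Nat.le_zero.1 h]
      push_cast
      positivity
  have hsat := DancingWalk.sat_run (k := k) htree (DancingWalk.walkLength c k n)
    (DancingWalk.maxAttempts d n) tie
  refine ⟨?_, ?_, fun o ho => ?_, fun q hq0 hkq o ho => ?_⟩
  · rw [hhalf]
    refine (DancingWalk.run_failed_le htree hk tie hD hq).trans (add_le_add hrisk ?_)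
    apply DancingWalk.inv_two_pow_le hn2
    refine le_trans ?_ (Nat.le_ceil (d * Real.logb 2 n))
    gcongr
    linarith
  · rw [hhalf]
    refine (DancingWalk.run_time_le htree hk tie hD hq _).trans (add_le_add hrisk ?_)
    apply ENNReal.ofReal_le_ofReal
    set B : ℝ := ((DancingWalk.insertionCost (Nat.log 2 n) (DancingWalk.walkLength c k n)
      (DancingWalk.maxAttempts d n) : ℕ) : ℝ) with hB
    have hB0 : 0 < B := by
      rw [hB]
      exact_mod_cast (by unfold DancingWalk.insertionCost; omega)
    -- The crude bound log_k log n ≤ log n is enough here, as n / B only has to exceed a multiple of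
    -- log n.
    have hBx : B ≤ K * x ^ 2 := by
      refine hcost.trans ?_
      rw [sq]
      gcongr
      exact max_le hx1 (DancingWalk.logLog_le hk hx1)
    refine le_trans ?_ (DancingWalk.exp_neg_le hγ hn2 (y := n / B) ?_)
    · rw [Real.exp_le_exp, ← neg_div]
      gcongr
      nlinarith
    · rw [le_div_iff₀ hB0, ← hx]
      calc (γ + 1) * x * B ≤ (γ + 1) * x * (K * x ^ 2) := by gcongr
        _ = (γ + 1) * K * x ^ 3 := by ring
        _ ≤ n := hn3
  · obtain ⟨h1, h2⟩ := hsat o ho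
    refine ⟨h1, fun t s hs => ?_, fun t s s' hs hs' => ?_⟩
    · obtain ⟨U, hU⟩ := h2.state t s hs
      rw [Set.empty_union] at hU
      exact hU.isOrientation
    · obtain ⟨h3, h4⟩ := h2.step t s s' hs hs'
      refine ⟨(hflips s s' h3).trans ?_, ?_⟩
      · exact mul_le_mul_of_nonneg_right (by linarith) hll
      · have h5 : (s'.clock : ℝ) ≤ s.clock + DancingWalk.insertionCost (Nat.log 2 n)
            (DancingWalk.walkLength c k n) (DancingWalk.maxAttempts d n) := by exact_mod_cast h4
        refine h5.trans ?_
        gcongr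
        exact hcost.trans (mul_le_mul_of_nonneg_right (by linarith) (by positivity))
  · obtain ⟨-, h2⟩ := hsat o ho
    refine ⟨fun t s hs v => ?_, fun t s s' hs hs' => ?_⟩
    · obtain ⟨U, hU⟩ := h2.state t s hs
      have h3 : (s.outDegree v : ℝ) ≤ k + 1 := by exact_mod_cast hU.isOrientation.2 v
      have h4 : (k : ℝ) ≤ x ^ (1 / q) := by
        rw [hkq]
        exact Nat.floor_le (Real.rpow_nonneg (by linarith) _)
      linarith
    · refine (hflips s s' (h2.step t s s' hs hs').1).trans ?_
      have h3 := DancingWalk.logLog_le_of_floor hk hq0 hx1 hkq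
      nlinarith
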